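/- \textbf{Setting.} Let $n\ge 4$ and let $\pi$ be the labelled permutation with top row $1\,2\,\dots\,n$ and bottom row $n\;3\;2\;5\;4\dots(n-1)\;(n-2)\;1$ if $n$ is even, and $n\;3\;2\;5\;4\dots(n-2)\;(n-3)\;(n-1)\;1$ if $n$ is odd. In a step of (right) Rauzy induction of type $0$ (respectively $1$) the last letter of the top (respectively bottom) row labels the longer of the two rightmost intervals and is called the winner $w$. The last letter $l$ of the other row is called the loser. In its own row, $l$ is moved to the place immediately after $w$, and the length of $w$ is diminished by that of $l$. The matrix of the step, which expresses the old lengths in terms of the new ones, is $\mathrm{Id}+E_{w,l}$. For integers $a,c\ge 1$ let $\gamma_{a,c}$ be the closed Rauzy path at $\pi$ $$\gamma_{a,c}=\sigma\;\dot\gamma_{m_0,a}\,\dot\gamma_{m_0-2,a}\cdots\dot\gamma_{4,a}\,\dot\gamma_{2,a}\;1^{c(n-1)},\qquad \dot\gamma_{m,a}=1^{\,n-1-m}\,0^a\,1\,0^2,$$ where $m_0=2\lfloor n/2\rfloor-2$, and $\sigma=0$ for even $n$, $\sigma=0\,1\,0$ for odd $n$. Let $\Theta_{c,a}$ be its transition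 matrix, that is, the product, in the order of the path, of the matrices of its steps. Let $p\ge n+1$ be an integer, and let $(a_i)_{i\ge1},(c_i)_{i\ge1}$ be sequences of positive integers with $c_{i+1}=pa_i=p^2c_i$ for all $i$. Let $T:[0,1)\to[0,1)$ be an interval exchange transformation with permutation $\pi$ and positive interval lengths of sum $1$, exchanged intervals $X_1,\dots,X_n$, whose Rauzy induction follows the infinite path $\gamma_{a_1,c_1}\gamma_{a_2,c_2}\gamma_{a_3,c_3}\cdots$. Put $J=\{3,5,\dots,2\lfloor n/2\rfloor-1,n\}$. \textbf{Statement.} For every $j\in J$ there is exactly one $T$-invariant Borel probability measure $\lambda_j$ on $[0,1)$ such that $$\big(\lambda_j(X_1),\dots,\lambda_j(X_n)\big)=\lim_{m\to\infty}\frac{\Theta_{c_1,a_1}\cdots\Theta_{c_m,a_m}e_j}{|\Theta_{c_1,a_1}\cdots\Theta_{c_m,a_m}e_j|},\qquad |v|=\sum_t v_t .$$ For any distinct $i,j\in J$, the function $d_{\lambda_j}(x,y)=\lambda_j([x,y))$ for $x\le y$, extended symmetrically, is a metric on $[0,1)$, and $$\dim_H(\lambda_i,d_{\lambda_j})=1 .$$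 Here $\dim_H(\lambda_i,d_{\lambda_j})$ is the infimum, over all Borel sets $A\subseteq[0,1)$ with $\lambda_i(A)=1$, of the Hausdorff dimension of $A$ in the metric $d_{\lambda_j}$. -/

import Mathlib

open MeasureTheory Filter Topology
open scoped ENNReal

namespace RauzyIET

/-- The two types of (right) Rauzy induction: in type `zero` the last interval of the top row
wins, in type `one` the last interval of the bottom row wins. -/
inductive Move where
  | zero
  | one

/-- A labelled permutation `{top row / bottom row}`. -/
structure Rows (A : Type) where
  top : List A
  bot : List A

/-- Remove the last letter of a row and put it back immediately after the letter `w`. -/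
def moveLastAfter {A : Type} [DecidableEq A] (w : Option A) (row : List A) : List A :=
  row.dropLast.flatMap fun x => if some x = w then x :: row.getLast?.toList else [x]

namespace Rows

variable {A : Type}

/-- The winner: the longer one of the two rightmost intervals. -/
def winner (R : Rows A) : Move → Option A
  | .zero => R.top.getLast?
  | .one => R.bot.getLast?

/-- The loser: the shorter one of the two rightmost intervals. -/
def loser (R : Rows A) : Move → Option A
  | .zero => R.bot.getLast?
  | .one => R.top.getLast?

/-- Action of Rauzy induction on labelled permutations: the loser is moved, in its row, to the
place immediately after the winner. -/
def move [DecidableEq A] (R : Rows A) : Move → Rows A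
  | .zero => ⟨R.top, moveLastAfter R.top.getLast? R.bot⟩
  | .one => ⟨moveLastAfter R.bot.getLast? R.top, R.bot⟩

/-- The matrix of one Rauzy move, `old lengths = matrix * new lengths`: the old length of the
winner is the sum of the new lengths of winner and loser. -/
def stepMatrix [DecidableEq A] (R : Rows A) (m : Move) : Matrix A A ℕ :=
  match R.winner m, R.loser m with
  | some w, some l => 1 + Matrix.single w l 1
  | _, _ => 1

/-- The transition matrix of a Rauzy path starting at a given labelled permutation,
`lengths at the start = matrix * lengths at the end`. -/
def pathMatrix [DecidableEq A] [Fintype A] : Rows A → List Move → Matrix A A ℕ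
  | _, [] => 1
  | R, m :: ms => R.stepMatrix m * pathMatrix (R.move m) ms

end Rows

/-- The data (labelled permutation and interval lengths) of an interval exchange. -/
structure IETData (A : Type) where
  rows : Rows A
  len : A → ℝ

namespace IETData

variable {A : Type} [DecidableEq A]

/-- Left end point of the interval labelled `t` when the intervals are laid out, starting at `0`,
in the order given by `row`. -/
noncomputable def offset (row : List A) (len : A → ℝ) (t : A) : ℝ :=
  ((row.takeWhile fun s => s ≠ t).map len).sum

/-- The exchanged interval labelled `t`. -/
noncomputable def interval (S : IETData A) (t : A) : Set ℝ :=
  Set.Ico (offset S.rows.top S.len t) (offset S.rows.top S.len t + S.len t)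

/-- The interval exchange transformation: each exchanged interval is translated from its place in
the top row to its place in the bottom row. (Points outside all of the intervals are fixed.) -/
noncomputable def toFun [Fintype A] (S : IETData A) (x : ℝ) : ℝ :=
  x + ∑ t, (S.interval t).indicator
    (fun _ => offset S.rows.bot S.len t - offset S.rows.top S.len t) x

/-- `S'` is the result of applying Rauzy induction to `S`, and the step is of type `m`. -/
def IsStep (m : Move) (S S' : IETData A) : Prop :=
  ∃ w l, S.rows.winner m = some w ∧ S.rows.loser m = some l ∧ S.len l < S.len w ∧
    S'.rows = S.rows.move m ∧ S'.len = Function.update S.len w (S.len w - S.len l)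

/-- Iterating Rauzy induction leads from the first to the last argument, and the types of the
successive steps are those of the path. -/
def Follows : IETData A → List Move → IETData A → Prop
  | S, [], S' => S = S'
  | S, m :: ms, S' => ∃ S₁, IsStep m S S₁ ∧ Follows S₁ ms S'

end IETData

/-! ### The family

The letters `1, …, n` are represented by `Fin n`, the letter `k` being the element of value
`k - 1`. -/

/-- The bottom row is `n 3 2 5 4 … (n-1) (n-2) 1` for even `n` and
`n 3 2 5 4 … (n-2) (n-3) (n-1) 1` for odd `n`; this is the letter at (zero-based) place `q`. -/
def bottomLetter (n : ℕ) (q : Fin n) : Fin n :=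
  if q.val = 0 then ⟨n - 1, by have := q.isLt; omega⟩
  else if q.val = n - 1 then ⟨0, by have := q.isLt; omega⟩
  else if Even q.val then ⟨q.val - 1, by have := q.isLt; omega⟩
  else if h : q.val + 1 < n - 1 then ⟨q.val + 1, by omega⟩
  else q

/-- The initial labelled permutation. -/
def initialRows (n : ℕ) : Rows (Fin n) :=
  ⟨List.finRange n, (List.finRange n).map (bottomLetter n)⟩

/-- The path `1^(n-1-m) 0^a 1 0^2`. -/
def block (n a m : ℕ) : List Move :=
  List.replicate (n - 1 - m) .one ++ List.replicate a .zero ++ [.one, .zero, .zero]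

/-- The Rauzy cycle: the initial piece `0` (`n` even) or `0 1 0` (`n` odd), then the blocks with
`m = 2⌊n/2⌋ - 2, …, 4, 2`, and then `1^(c(n-1))`. -/
def cycle (n a c : ℕ) : List Move :=
  (if Even n then [.zero] else [.zero, .one, .zero]) ++
    (List.range (n / 2 - 1)).reverse.flatMap (fun s => block n a (2 * (s + 1))) ++
    List.replicate (c * (n - 1)) .one

/-- The transition matrix of the cycle. -/
def Theta (n a c : ℕ) : Matrix (Fin n) (Fin n) ℕ :=
  (initialRows n).pathMatrix (cycle n a c)

/-- The product of the first `m` transition matrices. -/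
def ThetaProd (n : ℕ) (a c : ℕ → ℕ) (m : ℕ) : Matrix (Fin n) (Fin n) ℕ :=
  ((List.range m).map fun i => Theta n (a i) (c i)).prod

/-- The `j`-th column of the product of the first `m` transition matrices, divided by the sum of
its entries. -/
noncomputable def normalizedColumn (n : ℕ) (a c : ℕ → ℕ) (j : Fin n) (m : ℕ) (t : Fin n) : ℝ :=
  (ThetaProd n a c m t j : ℝ) / ∑ s, (ThetaProd n a c m s j : ℝ)

/-- The Rauzy induction, started from the interval exchange `S`, runs successively through the
cycles with the parameters `(a 0, c 0), (a 1, c 1), …`. -/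
def IsGeneratedBy (n : ℕ) (a c : ℕ → ℕ) (S : IETData (Fin n)) : Prop :=
  ∃ U : ℕ → IETData (Fin n), U 0 = S ∧ ∀ k, (U k).Follows (cycle n (a k) (c k)) (U (k + 1))

/-- The letters in `{3, 5, …, 2⌊n/2⌋ - 1, n}`. -/
def indexSet (n : ℕ) : Set (Fin n) :=
  {j | (Odd (j.val + 1) ∧ 3 ≤ j.val + 1 ∧ j.val + 1 ≤ 2 * (n / 2) - 1) ∨ j.val + 1 = n}

/-- `μ` is a Borel probability measure on `[0,1)` that is invariant under the interval exchange
`S`, and the vector of the measures of the exchanged intervals is the limit of the normalized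
`j`-th columns. -/
structure IsLimitMeasure (n : ℕ) (a c : ℕ → ℕ) (S : IETData (Fin n)) (j : Fin n)
    (μ : Measure ℝ) : Prop where
  isProbabilityMeasure : IsProbabilityMeasure μ
  measure_Ico : μ (Set.Ico 0 1) = 1
  invariant : MeasurePreserving S.toFun μ μ
  tendsto : ∀ t, Tendsto (fun m => normalizedColumn n a c j m t) atTop
    (𝓝 (μ (S.interval t)).toReal)

/-! ### Hausdorff dimension of a measure with respect to the distance given by a measure -/

/-- The set `[0,1)`, to be equipped with the distance given by `ν`. -/
def MeasureLine (_ν : Measure ℝ) : Type := Set.Ico (0 : ℝ) 1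

/-- The distance `d_ν(x, y) = ν([x, y))` for `x ≤ y`. -/
noncomputable instance (ν : Measure ℝ) : PseudoEMetricSpace (MeasureLine ν) where
  edist x y := ν (Set.Ico (min x.1 y.1) (max x.1 y.1))
  edist_self x := by simp
  edist_comm x y := by rw [min_comm, max_comm]
  edist_triangle x y z := by
    refine (measure_mono ?_).trans (measure_union_le _ _)
    intro t ht
    simp only [Set.mem_union, Set.mem_Ico, min_le_iff, lt_max_iff] at ht ⊢
    grind

/-- The Hausdorff dimension of a set `A ⊆ [0,1)` for the distance `d_ν`. Points at distance `0`
are identified, which changes nothing when `d_ν` is a metric. -/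
noncomputable def setDim (ν : Measure ℝ) (A : Set ℝ) : ℝ≥0∞ :=
  dimH ((SeparationQuotient.mk : MeasureLine ν → SeparationQuotient (MeasureLine ν)) ''
    {x | x.1 ∈ A})

/-- The Hausdorff dimension of the measure `μ` on `[0,1)` for the distance `d_ν`: the infimum of
the dimensions of the Borel sets of full `μ`-measure. -/
noncomputable def measureDim (μ ν : Measure ℝ) : ℝ≥0∞ :=
  ⨅ (A : Set ℝ) (_ : A ⊆ Set.Ico 0 1) (_ : MeasurableSet A) (_ : μ (Set.Ico 0 1 \ A) = 0),
    setDim ν A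

end RauzyIET

/-! Rauzy induction presents `T` by towers. At stage `k` (after `k` cycles) the interval of the
letter `j` moves through `h_k(j)` floors before it returns, where `h_k(j)` is the sum of the `j`-th
column of the product of the first `k` matrices. Let `F` be the distribution function of an
invariant measure. All floors of a tower have the same `F`-increment, and these increments transform
by the same matrices as the lengths, so that `∑ h_k(j) · incr_k(j) = 1`. Hence every floor has
measure at most `1 / min h_k`. Since a product of three consecutive matrices has positive entries,
every floor also has measure at least `1 / max h_{k+3}`.

Dimension. An interval of `ν`-measure below `1 / max h_{k+3}` meets at most two floors of stage `k`,
so its `μ`-measure is at most `2 / min h_k` (`TowerSeq.sub_le`). The heights are at least `p ^ (k² -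
O(k))`, whereas `max h_{k+4} / min h_k` is only exponential in `k`; so for every `d < 1` the
`μ`-measure of a short interval is at most the `d`-th power of its `ν`-measure
(`eventually_rpow_maxHeight_le`). The distribution function of `ν` maps `[0,1)` with `d_ν`
isometrically into the line. The mass distribution principle for the image of `μ` gives dimension at
least `d`, and the line gives the upper bound `1`.

Limit measures. Following the path explicitly gives the action of a cycle on row vectors
(`run_cycle`), so the heights obey a recursion with five values `u, e, x, y, z`. The relations
`c_{i+1} = p a_i = p² c_i` make both `x / y` and `c y / x` grow by a factor of about `p` per cycle;
hence `u ≪ y ≪ x ≪ c y`. Consequently, for `j ∈ J`, the new tower `j` consists of copies of the old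
tower `j` up to a proportion `O(2⁻ᵐ)`, and the normalized columns form a Cauchy sequence. The
invariant measure is a limit of visit frequencies along the orbits that go up the towers `j`. It has
no atoms because all floors become small. It is unique because the values of `F` at all floor ends
are determined by its increments on the exchanged intervals. -/

namespace RauzyIET

open IETData

/-! ### Offsets in a row and the effect of a Rauzy move on them -/

section Rows

variable {A : Type} [DecidableEq A]

theorem offset_append_cons {p q : List A} {t : A} (h : t ∉ p) (len : A → ℝ) :
    offset (p ++ t :: q) len t = (p.map len).sum := by
  have : (p ++ t :: q).takeWhile (fun s => s ≠ t) = p := by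
    rw [List.takeWhile_append_of_pos]
    · simp
    · intro a ha
      simp only [ne_eq, decide_not, Bool.not_eq_eq_eq_not, Bool.not_true, decide_eq_false_iff_not]
      rintro rfl
      exact h ha
  rw [offset, this]

theorem offset_cons_self (q : List A) (t : A) (len : A → ℝ) : offset (t :: q) len t = 0 := by
  simp [offset]

theorem offset_cons_of_ne {q : List A} {s t : A} (h : s ≠ t) (len : A → ℝ) :
    offset (s :: q) len t = len s + offset q len t := by
  simp [offset, h]

theorem offset_append_right {p q : List A} {t : A} (h : t ∉ p) (len : A → ℝ) :
    offset (p ++ q) len t = (p.map len).sum + offset q len t := by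
  induction p with
  | nil => simp
  | cons s p ih =>
    simp only [List.mem_cons, not_or] at h
    rw [List.cons_append, offset_cons_of_ne (Ne.symm h.1), ih h.2, List.map_cons, List.sum_cons,
      add_assoc]

theorem offset_append_left {p q : List A} {t : A} (h : t ∈ p) (len : A → ℝ) :
    offset (p ++ q) len t = offset p len t := by
  obtain ⟨a, b, rfl, ha⟩ := List.eq_append_cons_of_mem h
  rw [List.append_assoc, List.cons_append, offset_append_cons ha, offset_append_cons ha]

theorem offset_congr {row : List A} {len len' : A → ℝ} {t : A}
    (h : ∀ s ∈ row, s ≠ t → len s = len' s) : offset row len t = offset row len' t := by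
  rw [offset, offset]
  congr 1
  apply List.map_congr_left
  intro s hs
  exact h s (List.takeWhile_subset _ hs) (by simpa using List.mem_takeWhile_imp hs)

theorem moveLastAfter_append {p q : List A} {w l : A} (hp : w ∉ p) (hq : w ∉ q) :
    moveLastAfter (some w) (p ++ w :: (q ++ [l])) = p ++ w :: l :: q := by
  have e : p ++ w :: (q ++ [l]) = (p ++ w :: q) ++ [l] := by simp
  have key : ∀ r : List A, w ∉ r →
      (r.flatMap fun x => if some x = some w then x :: (some l).toList else [x]) = r := by
    intro r hr
    induction r with
    | nil => rfl
    | cons x r ih =>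
      simp only [List.mem_cons, not_or] at hr
      rw [List.flatMap_cons, ih hr.2]
      simp [Ne.symm hr.1]
  rw [moveLastAfter, e, List.dropLast_concat, List.getLast?_concat, List.flatMap_append,
    List.flatMap_cons, key p hp, key q hq]
  simp

theorem exists_mem_interval {row : List A} {len : A → ℝ} (hn : row.Nodup)
    {y : ℝ} (h0 : 0 ≤ y) (h1 : y < (row.map len).sum) :
    ∃ t ∈ row, offset row len t ≤ y ∧ y < offset row len t + len t := by
  induction row generalizing y with
  | nil => simp at h1; linarith
  | cons s row ih =>
    rw [List.nodup_cons] at hn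
    by_cases hy : y < len s
    · exact ⟨s, by simp, by rw [offset_cons_self]; exact h0, by rw [offset_cons_self]; linarith⟩
    · obtain ⟨t, ht, h2, h3⟩ := ih hn.2 (y := y - len s) (by linarith)
        (by simp at h1; linarith)
      have hne : s ≠ t := by rintro rfl; exact hn.1 ht
      exact ⟨t, by simp [ht], by rw [offset_cons_of_ne hne]; linarith,
        by rw [offset_cons_of_ne hne]; linarith⟩

theorem offset_nonneg {row : List A} {len : A → ℝ} (hl : ∀ t, 0 ≤ len t) (t : A) :
    0 ≤ offset row len t := by
  apply List.sum_nonneg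
  intro x hx
  obtain ⟨s, -, rfl⟩ := List.mem_map.1 hx
  exact hl s

theorem offset_add_le {row : List A} {len : A → ℝ} (hl : ∀ t, 0 ≤ len t) {t : A} (ht : t ∈ row) :
    offset row len t + len t ≤ (row.map len).sum := by
  obtain ⟨p, q, rfl, hp⟩ := List.eq_append_cons_of_mem ht
  rw [offset_append_cons hp, List.map_append, List.sum_append, List.map_cons, List.sum_cons]
  have : 0 ≤ (q.map len).sum := List.sum_nonneg fun x hx => by
    obtain ⟨s, -, rfl⟩ := List.mem_map.1 hx
    exact hl s
  linarith

theorem offset_disjoint {row : List A} {len : A → ℝ} (hl : ∀ t, 0 ≤ len t) {s t : A}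
    (hs : s ∈ row) (ht : t ∈ row) (hne : s ≠ t) :
    offset row len s + len s ≤ offset row len t ∨ offset row len t + len t ≤ offset row len s := by
  induction row with
  | nil => simp at hs
  | cons r row ih =>
    by_cases h1 : r = s
    · subst h1
      left
      rw [offset_cons_self, offset_cons_of_ne hne]
      linarith [offset_nonneg (row := row) hl t]
    · by_cases h2 : r = t
      · subst h2
        right
        rw [offset_cons_self, offset_cons_of_ne h1]
        linarith [offset_nonneg (row := row) hl s]
      · rw [offset_cons_of_ne h1, offset_cons_of_ne h2]
        rcases ih (by simpa [Ne.symm h1] using hs) (by simpa [Ne.symm h2] using ht) with h | h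
        · left; linarith
        · right; linarith

theorem sum_map_eq [Fintype A] {row : List A} (hn : row.Nodup) (hm : ∀ t, t ∈ row) (f : A → ℝ) :
    (row.map f).sum = ∑ t, f t := by
  rw [← List.sum_toFinset f hn]
  congr 1
  ext t
  simp [hm t]

/-- Telescoping: consecutive letters of a row label adjacent intervals. -/
theorem sum_increments {row : List A} {len : A → ℝ} (hn : row.Nodup) (F : ℝ → ℝ) (x : ℝ) :
    (row.map fun t => F (x + offset row len t + len t) - F (x + offset row len t)).sum
      = F (x + (row.map len).sum) - F x := by
  induction row generalizing x with
  | nil => simp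
  | cons s row ih =>
    rw [List.nodup_cons] at hn
    have := ih hn.2 (x + len s)
    rw [List.map_cons, List.sum_cons, List.map_cons, List.sum_cons, offset_cons_self, ← add_assoc,
      ← sub_add_sub_cancel _ (F (x + len s)) (F x), ← this, add_zero, add_comm]
    congr 2
    apply List.map_congr_left
    intro t ht
    have hne : s ≠ t := by rintro rfl; exact hn.1 ht
    rw [offset_cons_of_ne hne, add_assoc x (len s)]

/-- Rows that list every letter exactly once. -/
structure Rows.IsValid (R : Rows A) : Prop where
  nodup_top : R.top.Nodup
  nodup_bot : R.bot.Nodup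
  mem_top : ∀ t, t ∈ R.top
  mem_bot : ∀ t, t ∈ R.bot

omit [DecidableEq A] in
theorem exists_eq_append_of_getLast? {row : List A} {l : A} (h : row.getLast? = some l) :
    ∃ r, row = r ++ [l] := by
  rw [List.getLast?_eq_some_iff] at h
  exact h

/-- How the offsets change when the row `row` is moved with winner `w` and loser `l`. -/
theorem exists_split {row : List A} {w l : A} (hn : row.Nodup) (hm : ∀ t, t ∈ row) (hwl : l ≠ w)
    (hl : row.getLast? = some l) :
    ∃ p q, row = p ++ w :: (q ++ [l]) ∧ moveLastAfter (some w) row = p ++ w :: l :: q ∧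
      (p ++ w :: l :: q).Nodup ∧ ∀ t, t ∈ p ++ w :: l :: q := by
  obtain ⟨r, rfl⟩ := exists_eq_append_of_getLast? hl
  have hw : w ∈ r := by
    have := hm w
    simp only [List.mem_append, List.mem_singleton] at this
    exact this.resolve_right (Ne.symm hwl)
  obtain ⟨p, q, rfl⟩ := List.append_of_mem hw
  have hn' : (p ++ w :: (q ++ [l])).Nodup := by simpa using hn
  have hperm : (p ++ w :: l :: q).Perm (p ++ w :: (q ++ [l])) :=
    List.Perm.append_left _ (List.Perm.cons _ (List.perm_append_singleton l q).symm)
  have h1 : w ∉ p ∧ w ∉ q := by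
    rw [List.nodup_append, List.nodup_cons] at hn'
    refine ⟨fun h => hn'.2.2 w h w (by simp) rfl, fun h => hn'.2.1.1 (by simp [h])⟩
  refine ⟨p, q, by simp, ?_, hperm.nodup_iff.2 hn', fun t => hperm.mem_iff.2 (by simpa using hm t)⟩
  rw [← moveLastAfter_append h1.1 h1.2]
  simp

/-- In the row of the loser the offset of every letter but the loser is unchanged, and the loser
comes immediately after the winner. -/
theorem offset_moveLastAfter {row : List A} {w l : A} (hn : row.Nodup) (hm : ∀ t, t ∈ row)
    (hwl : l ≠ w) (hl : row.getLast? = some l) (len : A → ℝ) :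
    (∀ t, t ≠ l → offset (moveLastAfter (some w) row) (Function.update len w (len w - len l)) t
      = offset row len t) ∧
    offset (moveLastAfter (some w) row) (Function.update len w (len w - len l)) l
      = offset row len w + (len w - len l) ∧
    offset row len l = (row.map len).sum - len l := by
  obtain ⟨p, q, e, e', hn', -⟩ := exists_split hn hm hwl hl
  rw [e'] 
  set len' := Function.update len w (len w - len l) with hlen'
  have hwp : w ∉ p := fun h => by
    rw [List.nodup_append] at hn'; exact hn'.2.2 w h w (by simp) rfl
  have hlp : l ∉ p := fun h => by
    rw [List.nodup_append] at hn'; exact hn'.2.2 l h l (by simp) rfl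
  have hwq : w ∉ q := fun h => by
    rw [List.nodup_append, List.nodup_cons] at hn'; exact hn'.2.1.1 (by simp [h])
  have hlq : l ∉ q := fun h => by
    rw [List.nodup_append, List.nodup_cons, List.nodup_cons] at hn'; exact hn'.2.1.2.1 h
  have hmap : ∀ r : List A, w ∉ r → r.map len' = r.map len := by
    intro r hr
    apply List.map_congr_left
    intro x hx
    rw [hlen', Function.update_of_ne]
    rintro rfl
    exact hr hx
  have hw' : len' w = len w - len l := by simp [hlen']
  have hl' : len' l = len l := by rw [hlen', Function.update_of_ne hwl]
  have e2 : p ++ w :: (q ++ [l]) = (p ++ w :: q) ++ l :: [] := by simp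
  have e3 : p ++ w :: l :: q = (p ++ [w]) ++ l :: q := by simp
  refine ⟨?_, ?_, ?_⟩
  · intro t htl
    rw [e]
    by_cases htp : t ∈ p
    · rw [offset_append_left htp, offset_append_left htp]
      apply offset_congr
      intro s hs _
      rw [hlen', Function.update_of_ne]
      rintro rfl
      exact hwp hs
    · rw [offset_append_right htp, offset_append_right htp, hmap p hwp]
      by_cases htw : w = t
      · subst htw
        rw [offset_cons_self, offset_cons_self]
      · rw [offset_cons_of_ne htw, offset_cons_of_ne htw, offset_cons_of_ne (Ne.symm htl), hw', hl']
        have htq : t ∈ q := by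
          have := hm t
          rw [e] at this
          simpa [htp, Ne.symm htw, htl] using this
        rw [offset_append_left htq, offset_congr (len := len') (len' := len)]
        · ring
        · intro s hs _
          rw [hlen', Function.update_of_ne]
          rintro rfl
          exact hwq hs
  · rw [e3, offset_append_cons, e, offset_append_cons hwp, List.map_append, List.sum_append,
      hmap p hwp]
    · simp [hw']
    · simp [hlp, hwl]
  · rw [e, e2, offset_append_cons]
    · simp
      ring
    · simp [hlp, hlq, hwl]

theorem offset_of_getLast? {row : List A} {w : A} (hn : row.Nodup) (hw : row.getLast? = some w)
    (len : A → ℝ) (x : ℝ) :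
    (∀ t ∈ row, offset row (Function.update len w x) t = offset row len t) ∧
      offset row len w = (row.map len).sum - len w := by
  obtain ⟨r, rfl⟩ := exists_eq_append_of_getLast? hw
  have hwr : w ∉ r := fun h => by
    rw [List.nodup_append] at hn; exact hn.2.2 w h w (by simp) rfl
  refine ⟨fun t ht => ?_, ?_⟩
  · by_cases htr : t ∈ r
    · rw [offset_append_left htr, offset_append_left htr]
      apply offset_congr
      intro s hs _
      rw [Function.update_of_ne]
      rintro rfl
      exact hwr hs
    · rw [offset_append_right htr, offset_append_right htr]
      have : w = t := by simpa [htr, eq_comm] using ht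
      subst this
      rw [offset_cons_self, offset_cons_self]
      congr 2
      apply List.map_congr_left
      intro s hs
      rw [Function.update_of_ne]
      rintro rfl
      exact hwr hs
  · rw [offset_append_cons hwr]
    simp

end Rows

/-! ### The geometry of one step of Rauzy induction -/

section Step

variable {A : Type} [DecidableEq A] [Fintype A]

/-- Left end point of the interval `t` in the top row. -/
noncomputable abbrev topPos (S : IETData A) (t : A) : ℝ := offset S.rows.top S.len t

/-- Left end point of the interval `t` in the bottom row. -/
noncomputable abbrev botPos (S : IETData A) (t : A) : ℝ := offset S.rows.bot S.len t

/-- The geometric content of a step of Rauzy induction with winner `w` and loser `l`; `b` tells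
whether the top interval wins. -/
structure StepGeom (S S' : IETData A) (w l : A) (b : Bool) : Prop where
  ne : l ≠ w
  len_winner : S'.len w = S.len w - S.len l
  len_of_ne : ∀ t, t ≠ w → S'.len t = S.len t
  top_of_ne : ∀ t, t ≠ l → topPos S' t = topPos S t
  bot_of_ne : ∀ t, t ≠ l → botPos S' t = botPos S t
  top_loser : topPos S' l = if b then topPos S l else topPos S w + S'.len w
  bot_loser : botPos S' l = if b then botPos S w + S'.len w else botPos S l
  meet : if b then botPos S l = topPos S w + S'.len w else topPos S l = botPos S w + S'.len w

/-- Passes from labelled rows to positions on the line; the later arguments about towers use only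
`StepGeom` and no longer the rows. The two types of moves become the two values of `b`. -/
theorem exists_stepGeom {S S' : IETData A} {m : Move} (hS : S.rows.IsValid) (h : IsStep m S S')
    (hpos : ∀ t, 0 < S.len t) :
    S'.rows.IsValid ∧ (∀ t, 0 < S'.len t) ∧ ∃ w l b, StepGeom S S' w l b ∧
      S.rows.stepMatrix m = 1 + Matrix.single w l 1 ∧ S'.rows = S.rows.move m := by
  obtain ⟨w, l, hw, hl, hlt, hrows, hlen⟩ := h
  have hne : l ≠ w := by rintro rfl; exact lt_irrefl _ hlt
  have hpos' : ∀ t, 0 < S'.len t := by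
    intro t
    rw [hlen]
    by_cases ht : t = w
    · subst ht; simpa using hlt
    · rw [Function.update_of_ne ht]; exact hpos t
  -- Both rows have the same total length, so their last intervals end at the same point. This gives
  -- `meet`: the interval of the loser is the right end of that of the winner.
  have htot : (S.rows.top.map S.len).sum = (S.rows.bot.map S.len).sum := by
    rw [sum_map_eq hS.nodup_top hS.mem_top, sum_map_eq hS.nodup_bot hS.mem_bot]
  have hw' : S'.len w = S.len w - S.len l := by rw [hlen]; simp
  have hm : S.rows.stepMatrix m = 1 + Matrix.single w l 1 := by
    rw [Rows.stepMatrix, hw, hl]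
  cases m with
  | zero =>
    simp only [Rows.winner, Rows.loser, Rows.move] at hw hl hrows
    obtain ⟨p, q, -, e, e1, e2⟩ := exists_split hS.nodup_bot hS.mem_bot hne hl
    obtain ⟨h1, h2, h3⟩ := offset_moveLastAfter hS.nodup_bot hS.mem_bot hne hl S.len
    obtain ⟨h4, h5⟩ := offset_of_getLast? hS.nodup_top hw S.len (S.len w - S.len l)
    refine ⟨?_, hpos', w, l, true, ⟨hne, hw', ?_, ?_, ?_, ?_, ?_, ?_⟩, hm, ?_⟩
    · rw [hrows, hw]
      exact ⟨hS.nodup_top, by rw [e]; exact e1, hS.mem_top, by rw [e]; exact e2⟩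
    · intro t ht; rw [hlen, Function.update_of_ne ht]
    · intro t _; rw [topPos, hrows, hlen]; exact h4 t (hS.mem_top t)
    · intro t ht; rw [botPos, hrows, hlen, hw]; exact h1 t ht
    · rw [topPos, hrows, hlen]; exact h4 l (hS.mem_top l)
    · rw [botPos, hw', hrows, hlen, hw]; exact h2
    · simp only [if_true, hw', topPos, botPos, h5, h3]; rw [htot]; ring
    · rw [hrows]; rfl
  | one =>
    simp only [Rows.winner, Rows.loser, Rows.move] at hw hl hrows
    obtain ⟨p, q, -, e, e1, e2⟩ := exists_split hS.nodup_top hS.mem_top hne hl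
    obtain ⟨h1, h2, h3⟩ := offset_moveLastAfter hS.nodup_top hS.mem_top hne hl S.len
    obtain ⟨h4, h5⟩ := offset_of_getLast? hS.nodup_bot hw S.len (S.len w - S.len l)
    refine ⟨?_, hpos', w, l, false, ⟨hne, hw', ?_, ?_, ?_, ?_, ?_, ?_⟩, hm, ?_⟩
    · rw [hrows, hw]
      exact ⟨by rw [e]; exact e1, hS.nodup_bot, by rw [e]; exact e2, hS.mem_bot⟩
    · intro t ht; rw [hlen, Function.update_of_ne ht]
    · intro t ht; rw [topPos, hrows, hlen, hw]; exact h1 t ht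
    · intro t _; rw [botPos, hrows, hlen]; exact h4 t (hS.mem_bot t)
    · rw [topPos, hw', hrows, hlen, hw]; exact h2
    · rw [botPos, hrows, hlen]; exact h4 l (hS.mem_bot l)
    · simp only [hw', topPos, botPos, h5, h3, Bool.false_eq_true, if_false]; rw [htot]; ring
    · rw [hrows]; rfl

end Step

/-! ### Rokhlin towers over the stages of the induction -/

section Tower

variable {A : Type} [DecidableEq A]

/-- The translation performed on the exchanged interval `t`. -/
noncomputable def disp (S : IETData A) (t : A) : ℝ := botPos S t - topPos S t

/-- The interval of length `ℓ` with left end `x` is moved by the interval exchange successively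
through the exchanged intervals labelled by the word, and arrives at `y`. -/
def Orbit (S : IETData A) (ℓ : ℝ) : ℝ → List A → ℝ → Prop
  | x, [], y => x = y
  | x, t :: ws, y =>
    topPos S t ≤ x ∧ x + ℓ ≤ topPos S t + S.len t ∧ Orbit S ℓ (x + disp S t) ws y

/-- The successive positions of the point `x` that follows the given itinerary. -/
noncomputable def points (S : IETData A) : ℝ → List A → List ℝ
  | _, [] => []
  | x, t :: ws => x :: points S (x + disp S t) ws

theorem Orbit.append {S : IETData A} {ℓ x y z : ℝ} {v w : List A} (h : Orbit S ℓ x v y)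
    (h' : Orbit S ℓ y w z) : Orbit S ℓ x (v ++ w) z := by
  induction v generalizing x with
  | nil => cases h; exact h'
  | cons t v ih => exact ⟨h.1, h.2.1, ih h.2.2⟩

theorem Orbit.shift {S : IETData A} {ℓ ℓ' d x y : ℝ} {v : List A} (h : Orbit S ℓ x v y)
    (hd : 0 ≤ d) (hℓ : d + ℓ' ≤ ℓ) : Orbit S ℓ' (x + d) v (y + d) := by
  induction v generalizing x with
  | nil => cases h; rfl
  | cons t v ih =>
    refine ⟨by linarith [h.1], by linarith [h.2.1], ?_⟩
    have := ih h.2.2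
    rwa [add_right_comm] at this

theorem points_append {S : IETData A} {ℓ x y : ℝ} {v : List A} (h : Orbit S ℓ x v y)
    (w : List A) : points S x (v ++ w) = points S x v ++ points S y w := by
  induction v generalizing x with
  | nil => cases h; rfl
  | cons t v ih => rw [List.cons_append, points, points, ih h.2.2, List.cons_append]

theorem points_shift (S : IETData A) (x d : ℝ) (v : List A) :
    points S (x + d) v = (points S x v).map (· + d) := by
  induction v generalizing x with
  | nil => rfl
  | cons t v ih => rw [points, points, List.map_cons, ← ih, add_right_comm]

theorem length_points (S : IETData A) (x : ℝ) (v : List A) :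
    (points S x v).length = v.length := by
  induction v generalizing x with
  | nil => rfl
  | cons t v ih => rw [points, List.length_cons, ih, List.length_cons]

/-- Rokhlin towers: the interval exchange `S` is induced by `S₀` on a subinterval, the points of
its exchanged interval `j` return along the itinerary `W j`, and the floors of the towers
cover `[0,1)`. -/
structure Tower (S₀ S : IETData A) (W : A → List A) : Prop where
  valid : S.rows.IsValid
  len_pos : ∀ t, 0 < S.len t
  orbit : ∀ j, Orbit S₀ (S.len j) (topPos S j) (W j) (botPos S j)
  ne_nil : ∀ j, W j ≠ []
  cover : ∀ y, 0 ≤ y → y < 1 → ∃ j, ∃ p ∈ points S₀ (topPos S j) (W j), p ≤ y ∧ y < p + S.len j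
  right_end : ∀ j, ∀ p ∈ points S₀ (topPos S j) (W j), p + S.len j = 1 ∨
    ∃ j', p + S.len j ∈ points S₀ (topPos S j') (W j')
  zero_mem : ∃ j, (0 : ℝ) ∈ points S₀ (topPos S j) (W j)

/-- `countMatrix W t j` is the number of floors of the tower `j` in the exchanged interval `t`. -/
def countMatrix (W : A → List A) : Matrix A A ℕ := Matrix.of fun t j => (W j).count t

/-- Right multiplication by `1 + E_{w,l}` adds column `w` to column `l`, just as the loser's
itinerary absorbs the winner's. Only letter counts matter, so the order of concatenation is left
open. -/
theorem StepGeom.mul_single [Fintype A] {S S' : IETData A} {w l : A} {b : Bool} (W : A → List A)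
    (h : StepGeom S S' w l b) {v : List A} (hv : v.Perm (W l ++ W w)) :
    countMatrix (Function.update W l v) = countMatrix W * (1 + Matrix.single w l 1) := by
  ext t j
  rw [mul_add, mul_one, Matrix.add_apply]
  by_cases hj : j = l
  · subst hj
    rw [Matrix.mul_single_apply_same]
    simp [countMatrix, hv.count_eq]
  · rw [Matrix.mul_single_apply_of_ne _ _ _ _ _ hj]
    simp [countMatrix, hj]

/-- The word of the loser after a step of Rauzy induction. -/
def loserWord (W : A → List A) (w l : A) (b : Bool) : List A :=
  if b then W l ++ W w else W w ++ W l

omit [DecidableEq A] in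
theorem loserWord_perm (W : A → List A) (w l : A) (b : Bool) :
    (loserWord W w l b).Perm (W l ++ W w) := by
  cases b
  · exact List.perm_append_comm
  · exact List.Perm.refl _

theorem StepGeom.len_loser {S S' : IETData A} {w l : A} {b : Bool} (h : StepGeom S S' w l b) :
    S'.len l = S.len l := h.len_of_ne l h.ne

/-- By `meet`, the interval of the loser fits onto the right part of the winner's interval. If the
top interval wins, the tower of `l` arrives below the right part of the tower of `w`, which is then
climbed. If the bottom interval wins, the right part of the tower of `w` is climbed first and
arrives at the interval of `l`. -/
theorem StepGeom.orbit_loser {S₀ S S' : IETData A} {W : A → List A} {w l : A} {b : Bool}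
    (h : StepGeom S S' w l b) (hT : Tower S₀ S W) (hpos : 0 < S'.len w) :
    Orbit S₀ (S'.len l) (topPos S' l) (loserWord W w l b) (botPos S' l) ∧
    (points S₀ (topPos S' l) (loserWord W w l b)).Perm (points S₀ (topPos S l) (W l) ++
      (points S₀ (topPos S w) (W w)).map (· + S'.len w)) := by
  have hw := (hT.orbit w).shift (d := S'.len w) (ℓ' := S'.len l) hpos.le
    (by rw [h.len_winner, h.len_loser]; linarith)
  have hl := hT.orbit l
  rw [← h.len_loser] at hl
  have e1 := h.top_loser
  have e2 := h.bot_loser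
  have e3 := h.meet
  cases b
  · simp only [Bool.false_eq_true, if_false] at e1 e2 e3
    rw [e1, e2, loserWord, if_neg (by simp), ← points_shift]
    rw [← e3] at hw
    exact ⟨hw.append hl, by rw [points_append hw]; exact List.perm_append_comm⟩
  · simp only [if_true] at e1 e2 e3
    rw [e1, e2, loserWord, if_pos rfl, ← points_shift]
    rw [e3] at hl
    exact ⟨hl.append hw, by rw [points_append hl]⟩

/-- Cutting and stacking: each floor of the winner splits into a left part, which stays in its
tower, and a right part, which becomes a floor of the loser. Old left ends survive, and the only new
ones are the cutting points. -/
theorem StepGeom.tower {S₀ S S' : IETData A} {W : A → List A} {w l : A} {b : Bool}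
    (h : StepGeom S S' w l b) (hT : Tower S₀ S W) (hvalid : S'.rows.IsValid)
    (hpos : ∀ t, 0 < S'.len t) :
    Tower S₀ S' (Function.update W l (loserWord W w l b)) := by
  obtain ⟨ho, hperm⟩ := h.orbit_loser hT (hpos w)
  set W' := Function.update W l (loserWord W w l b) with hW'
  have hWl : W' l = loserWord W w l b := by simp [hW']
  have hWn : ∀ j, j ≠ l → W' j = W j := fun j hj => by rw [hW', Function.update_of_ne hj]
  have hpl : ∀ x, x ∈ points S₀ (topPos S' l) (W' l) ↔ x ∈ points S₀ (topPos S l) (W l) ∨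
      ∃ p ∈ points S₀ (topPos S w) (W w), p + S'.len w = x := by
    intro x
    rw [hWl, hperm.mem_iff, List.mem_append, List.mem_map]
  have hpn : ∀ j, j ≠ l → points S₀ (topPos S' j) (W' j) = points S₀ (topPos S j) (W j) := by
    intro j hj
    rw [hWn j hj, h.top_of_ne j hj]
  have hmono : ∀ j x, x ∈ points S₀ (topPos S j) (W j) → x ∈ points S₀ (topPos S' j) (W' j) := by
    intro j x hx
    by_cases hj : j = l
    · subst hj; exact (hpl x).2 (Or.inl hx)
    · rwa [hpn j hj]
  have hlw : S.len w = S'.len w + S'.len l := by rw [h.len_winner, h.len_loser]; ring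
  have hwl : w ≠ l := Ne.symm h.ne
  refine ⟨hvalid, hpos, ?_, ?_, ?_, ?_, ?_⟩
  · intro j
    by_cases hj : j = l
    · subst hj; rw [hWl]; exact ho
    · rw [hWn j hj, h.top_of_ne j hj, h.bot_of_ne j hj]
      by_cases hjw : j = w
      · subst hjw
        -- The winner keeps the left part of its interval, hence the shift `0` with a smaller
        -- length.
        have := (hT.orbit j).shift (d := 0) (ℓ' := S'.len j) le_rfl (by linarith [hpos l])
        simpa using this
      · rw [h.len_of_ne j hjw]; exact hT.orbit j
  · intro j
    by_cases hj : j = l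
    · subst hj
      rw [hWl]
      intro h0
      have := loserWord_perm W w j b
      rw [h0, List.nil_perm, List.append_eq_nil_iff] at this
      exact hT.ne_nil _ this.1
    · rw [hWn j hj]; exact hT.ne_nil j
  · intro y hy0 hy1
    obtain ⟨j, p, hp, h1, h2⟩ := hT.cover y hy0 hy1
    by_cases hjw : j = w
    · subst hjw
      by_cases hy : y < p + S'.len j
      · exact ⟨j, p, hmono _ _ hp, h1, hy⟩
      · exact ⟨l, p + S'.len j, (hpl _).2 (Or.inr ⟨p, hp, rfl⟩), by linarith, by linarith⟩
    · exact ⟨j, p, hmono _ _ hp, h1, by rwa [h.len_of_ne j hjw]⟩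
  · have key : ∀ j, ∀ p ∈ points S₀ (topPos S j) (W j), p + S.len j = 1 ∨
        ∃ j', p + S.len j ∈ points S₀ (topPos S' j') (W' j') := fun j p hp =>
      (hT.right_end j p hp).imp_right fun ⟨j', hj'⟩ => ⟨j', hmono _ _ hj'⟩
    intro j p hp
    by_cases hj : j = l
    · subst hj
      rcases (hpl p).1 hp with hp' | ⟨p, hp', rfl⟩
      · rw [h.len_loser]; exact key j p hp'
      · have := key w p hp'
        rw [hlw, ← add_assoc] at this
        exact this
    · rw [hpn j hj] at hp
      by_cases hjw : j = w
      · subst hjw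
        exact Or.inr ⟨l, (hpl _).2 (Or.inr ⟨p, hp, rfl⟩)⟩
      · rw [h.len_of_ne j hjw]; exact key j p hp
  · obtain ⟨j, hj⟩ := hT.zero_mem
    exact ⟨j, hmono _ _ hj⟩

/-- Stage zero, where each tower has a single floor, namely an exchanged interval. -/
theorem Tower.refl [Fintype A] {S : IETData A} (hv : S.rows.IsValid) (hpos : ∀ t, 0 < S.len t)
    (hsum : ∑ t, S.len t = 1) : Tower S S fun j => [j] := by
  have htop : (S.rows.top.map S.len).sum = 1 := by rw [sum_map_eq hv.nodup_top hv.mem_top, hsum]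
  have hp : ∀ j, points S (topPos S j) [j] = [topPos S j] := fun j => rfl
  have hcover : ∀ y, 0 ≤ y → y < 1 → ∃ j, topPos S j ≤ y ∧ y < topPos S j + S.len j := by
    intro y h0 h1
    obtain ⟨t, -, h⟩ := exists_mem_interval hv.nodup_top h0 (htop.symm ▸ h1)
    exact ⟨t, h⟩
  have hend : ∀ j, topPos S j + S.len j = 1 ∨ ∃ j', topPos S j + S.len j = topPos S j' := by
    intro j
    by_cases h : topPos S j + S.len j = 1
    · exact Or.inl h
    · right
      have h1 : topPos S j + S.len j < 1 :=
        lt_of_le_of_ne (htop ▸ offset_add_le (fun t => (hpos t).le) (hv.mem_top j)) h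
      obtain ⟨t, h2, h3⟩ := hcover _ (by
        have := offset_nonneg (row := S.rows.top) (fun t => (hpos t).le) j
        linarith [hpos j]) h1
      refine ⟨t, le_antisymm ?_ h2⟩
      by_contra hlt
      push Not at hlt
      have hne : j ≠ t := by rintro rfl; linarith
      rcases offset_disjoint (fun t => (hpos t).le) (hv.mem_top j) (hv.mem_top t) hne with h | h
      · exact absurd h (not_le.2 hlt)
      · have : topPos S t + S.len t ≤ topPos S j := h
        linarith [hpos j]
  refine ⟨hv, hpos, ?_, ?_, ?_, ?_, ?_⟩
  · intro j
    refine ⟨le_rfl, le_rfl, ?_⟩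
    change topPos S j + disp S j = botPos S j
    rw [disp]; ring
  · simp
  · intro y h0 h1
    obtain ⟨j, hj⟩ := hcover y h0 h1
    exact ⟨j, _, by rw [hp]; simp, hj⟩
  · intro j p hpp
    rw [hp, List.mem_singleton] at hpp
    subst hpp
    exact (hend j).imp_right fun ⟨j', h⟩ => ⟨j', by rw [h, hp]; simp⟩
  · obtain ⟨j, h1, h2⟩ := hcover 0 le_rfl one_pos
    refine ⟨j, ?_⟩
    rw [hp, List.mem_singleton]
    exact le_antisymm (offset_nonneg (fun t => (hpos t).le) j) h1

end Tower

/-! ### Invariant distribution functions along the induction -/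

section InvCDF

variable {A : Type} [DecidableEq A]

/-- Monotone functions from `[0,1]` onto a set with end points `0`, `1` whose increments are
invariant under the interval exchange. -/
structure InvCDF (S : IETData A) (F : ℝ → ℝ) : Prop where
  mono : Monotone F
  zero : F 0 = 0
  one : F 1 = 1
  inv : ∀ t u v, topPos S t ≤ u → u ≤ v → v ≤ topPos S t + S.len t →
    F (v + disp S t) - F (u + disp S t) = F v - F u

/-- The increments of `F` over the exchanged intervals. -/
noncomputable def incr (F : ℝ → ℝ) (S : IETData A) (t : A) : ℝ :=
  F (topPos S t + S.len t) - F (topPos S t)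

/-- With the identity, estimates for invariant functions become estimates for lengths; continuity
and strict monotonicity are obtained in this way. -/
theorem InvCDF.id (S : IETData A) : InvCDF S id :=
  ⟨monotone_id, rfl, rfl, fun t u v _ _ _ => by simp⟩

variable {S₀ : IETData A} {F : ℝ → ℝ}

theorem InvCDF.orbit_end (hF : InvCDF S₀ F) {ℓ x y u v : ℝ} {W : List A}
    (h : Orbit S₀ ℓ x W y) (hu : 0 ≤ u) (huv : u ≤ v) (hv : v ≤ ℓ) :
    F (y + v) - F (y + u) = F (x + v) - F (x + u) := by
  induction W generalizing x with
  | nil => cases h; rfl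
  | cons t W ih =>
    rw [ih h.2.2, add_right_comm, add_right_comm x _ u]
    exact hF.inv t _ _ (by linarith [h.1]) (by linarith) (by linarith [h.2.1])

theorem InvCDF.orbit_point (hF : InvCDF S₀ F) {ℓ x y u v : ℝ} {W : List A}
    (h : Orbit S₀ ℓ x W y) (hu : 0 ≤ u) (huv : u ≤ v) (hv : v ≤ ℓ) :
    ∀ p ∈ points S₀ x W, F (p + v) - F (p + u) = F (x + v) - F (x + u) := by
  induction W generalizing x with
  | nil => simp [points]
  | cons t W ih =>
    intro p hp
    rw [points, List.mem_cons] at hp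
    rcases hp with rfl | hp
    · rfl
    · rw [ih h.2.2 p hp, add_right_comm, add_right_comm x _ u]
      exact hF.inv t _ _ (by linarith [h.1]) (by linarith) (by linarith [h.2.1])

/-- All floors of a tower have the same increment. -/
theorem InvCDF.floor (hF : InvCDF S₀ F) {S : IETData A} {W : A → List A} (hT : Tower S₀ S W)
    (j : A) {p : ℝ} (hp : p ∈ points S₀ (topPos S j) (W j)) :
    F (p + S.len j) - F p = incr F S j := by
  have := hF.orbit_point (hT.orbit j) le_rfl (hT.len_pos j).le le_rfl p hp
  simp only [add_zero] at this
  exact this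

/-- The right part of the winner's interval and the interval of the loser are carried to one another
by translations along the itinerary of one tower, so they have equal increments. Thus the increments
change exactly as the lengths do. -/
theorem InvCDF.incr_of_step (hF : InvCDF S₀ F) {S S' : IETData A} {W : A → List A} {w l : A}
    {b : Bool} (h : StepGeom S S' w l b) (hT : Tower S₀ S W) (hpos : ∀ t, 0 < S'.len t) :
    incr F S w = incr F S' w + incr F S' l ∧ ∀ t, t ≠ w → incr F S t = incr F S' t := by
  have hwl : w ≠ l := Ne.symm h.ne
  have hlw : S.len w = S'.len w + S'.len l := by rw [h.len_winner, h.len_loser]; ring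
  have key : F (topPos S w + S.len w) - F (topPos S w + S'.len w) = incr F S l ∧
      incr F S l = incr F S' l := by
    have e1 := h.top_loser
    have e3 := h.meet
    have hl := hF.orbit_end (hT.orbit l) le_rfl (hT.len_pos l).le le_rfl
    have hw := hF.orbit_end (hT.orbit w) (u := S'.len w) (v := S.len w) (hpos w).le
      (by linarith [hpos l]) le_rfl
    simp only [add_zero] at hl
    cases b
    · simp only [Bool.false_eq_true, if_false] at e1 e3
      rw [incr, incr, e1, ← hw, e3, hlw, h.len_loser]
      simp only [add_assoc, true_and]
      rw [hlw, h.len_loser] at hw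
      exact hw
    · simp only [if_true] at e1 e3
      exact ⟨by rw [incr, ← hl, e3, hlw, h.len_loser, add_assoc],
        by rw [incr, incr, e1, h.len_loser]⟩
  refine ⟨?_, fun t ht => ?_⟩
  · rw [← key.2, ← key.1, incr, incr, h.top_of_ne w hwl]
    ring
  · by_cases htl : t = l
    · subst htl; exact key.2
    · rw [incr, incr, h.top_of_ne t htl, h.len_of_ne t ht]

/-- Two invariant functions that agree on the exchanged intervals of `S` and at the end points
of the floors. -/
def AgreeAt (S₀ : IETData A) (F G : ℝ → ℝ) (S : IETData A) (W : A → List A) : Prop :=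
  (∀ t, incr F S t = incr G S t) ∧ ∀ j, ∀ p ∈ points S₀ (topPos S j) (W j), F p = G p

/-- A new left end has the form `q + S'.len w` with `q` a left end of a floor of the winner, and
there the value is that at `q` plus the increment of `w`. Both are already known to agree. -/
theorem AgreeAt.step {G : ℝ → ℝ} (hF : InvCDF S₀ F) (hG : InvCDF S₀ G) {S S' : IETData A}
    {W : A → List A} {w l : A} {b : Bool} (h : StepGeom S S' w l b) (hT : Tower S₀ S W)
    (hvalid : S'.rows.IsValid) (hpos : ∀ t, 0 < S'.len t) (hA : AgreeAt S₀ F G S W) :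
    AgreeAt S₀ F G S' (Function.update W l (loserWord W w l b)) := by
  have hT' := h.tower hT hvalid hpos
  obtain ⟨hFw, hFn⟩ := hF.incr_of_step h hT hpos
  obtain ⟨hGw, hGn⟩ := hG.incr_of_step h hT hpos
  have hincr : ∀ t, incr F S' t = incr G S' t := by
    intro t
    by_cases ht : t = w
    · subst ht
      linarith [hA.1 t, hA.1 l, hFn l h.ne, hGn l h.ne]
    · rw [← hFn t ht, ← hGn t ht, hA.1 t]
  refine ⟨hincr, fun j p hp => ?_⟩
  by_cases hj : j = l
  · subst hj
    rw [Function.update_self, (h.orbit_loser hT (hpos w)).2.mem_iff, List.mem_append,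
      List.mem_map] at hp
    rcases hp with hp | ⟨q, hq, rfl⟩
    · exact hA.2 j p hp
    · have hq' : q ∈ points S₀ (topPos S' w)
          (Function.update W j (loserWord W w j b) w) := by
        rw [Function.update_of_ne (Ne.symm h.ne), h.top_of_ne w (Ne.symm h.ne)]
        exact hq
      linarith [hF.floor hT' w hq', hG.floor hT' w hq', hincr w, hA.2 w q hq]
  · rw [Function.update_of_ne hj, h.top_of_ne j hj] at hp
    exact hA.2 j p hp

/-- The action of a Rauzy path on labelled permutations. -/
def Rows.moves (R : Rows A) (ms : List Move) : Rows A := ms.foldl Rows.move R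

/-- One matrix governs both sides: counts of floors are multiplied by it from the right, and
increments are the matrix times the later increments. The conclusions are joined so that they
concern the same towers. -/
theorem exists_tower_of_follows [Fintype A] {S S' : IETData A} {ms : List Move}
    (h : Follows S ms S') {W : A → List A} (hT : Tower S₀ S W) :
    ∃ W', Tower S₀ S' W' ∧ countMatrix W' = countMatrix W * S.rows.pathMatrix ms ∧
      (∀ F, InvCDF S₀ F → ∀ t, incr F S t = ∑ s, (S.rows.pathMatrix ms t s : ℝ) * incr F S' s) ∧
      (∀ F G, InvCDF S₀ F → InvCDF S₀ G → AgreeAt S₀ F G S W → AgreeAt S₀ F G S' W') ∧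
      S'.rows = S.rows.moves ms := by
  induction ms generalizing S W with
  | nil =>
    cases h
    refine ⟨W, hT, by simp [Rows.pathMatrix], fun F _ t => ?_, fun _ _ _ _ h => h, rfl⟩
    simp [Rows.pathMatrix, Matrix.one_apply]
  | cons m ms ih =>
    obtain ⟨S₁, h1, h2⟩ := h
    obtain ⟨hv, hpos, w, l, b, hg, hm, hr⟩ := exists_stepGeom hT.valid h1 hT.len_pos
    obtain ⟨W', h3, h4, h5, h6, h7⟩ := ih h2 (hg.tower hT hv hpos)
    have hpm : S.rows.pathMatrix (m :: ms) =
        (1 + Matrix.single w l 1) * S₁.rows.pathMatrix ms := by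
      rw [Rows.pathMatrix, hm, ← hr]
    refine ⟨W', h3, ?_, ?_, ?_, ?_⟩
    · rw [h4, hg.mul_single W (loserWord_perm W w l b), hpm, Matrix.mul_assoc]
    · intro F hF t
      obtain ⟨e1, e2⟩ := hF.incr_of_step hg hT hpos
      have hP : ∀ s, (S.rows.pathMatrix (m :: ms) t s : ℝ) = S₁.rows.pathMatrix ms t s +
          if t = w then (S₁.rows.pathMatrix ms l s : ℝ) else 0 := by
        intro s
        rw [hpm, add_mul, one_mul, Matrix.add_apply]
        by_cases ht : t = w
        · subst ht; simp
        · simp [ht, Matrix.single_mul_apply_of_ne _ _ _ _ _ ht]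
      simp only [hP, add_mul, Finset.sum_add_distrib]
      rw [← h5 F hF t]
      by_cases ht : t = w
      · subst ht
        simp only [if_true]
        rw [← h5 F hF l, e1]
      · simp [ht, e2 t ht]
    · exact fun F G hF hG hA => h6 F G hF hG (AgreeAt.step hF hG hg hT hv hpos hA)
    · rw [h7, hr]; rfl

end InvCDF

/-! ### Rauzy paths acting on row vectors -/

section Columns

variable {A B : Type} [DecidableEq A] [DecidableEq B]

/-- The effect of a Rauzy move on a row vector, multiplied by the matrix of the move. -/
def Rows.colStep (R : Rows A) (m : Move) (V : A → ℕ) : A → ℕ :=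
  match R.winner m, R.loser m with
  | some w, some l => fun j => V j + if j = l then V w else 0
  | _, _ => V

/-- The effect of a Rauzy path on a row vector. -/
def Rows.cols : Rows A → List Move → (A → ℕ) → A → ℕ
  | _, [], V => V
  | R, m :: ms, V => Rows.cols (R.move m) ms (R.colStep m V)

theorem vecMul_stepMatrix [Fintype A] (R : Rows A) (m : Move) (V : A → ℕ) :
    Matrix.vecMul V (R.stepMatrix m) = R.colStep m V := by
  unfold Rows.stepMatrix Rows.colStep
  cases R.winner m with
  | none => simp
  | some w =>
    cases R.loser m with
    | none => simp
    | some l =>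
      ext j
      rw [Matrix.vecMul_add, Matrix.vecMul_one, Pi.add_apply]
      congr 1
      rw [Matrix.vecMul, dotProduct, Finset.sum_eq_single w]
      · by_cases h : j = l
        · subst h; simp
        · simp [h, Matrix.single_apply_of_col_ne _ _ (Ne.symm h)]
      · intro i _ hi
        simp [Ne.symm hi]
      · simp

theorem vecMul_pathMatrix [Fintype A] (R : Rows A) (ms : List Move) (V : A → ℕ) :
    Matrix.vecMul V (R.pathMatrix ms) = R.cols ms V := by
  induction ms generalizing R V with
  | nil => simp [Rows.pathMatrix, Rows.cols]
  | cons m ms ih =>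
    rw [Rows.pathMatrix, ← Matrix.vecMul_vecMul, ih, vecMul_stepMatrix, Rows.cols]

/-- Renaming the letters. -/
def Rows.rename (f : A → B) (R : Rows A) : Rows B := ⟨R.top.map f, R.bot.map f⟩

theorem moveLastAfter_map {f : A → B} (hf : f.Injective) (w : Option A) (row : List A) :
    moveLastAfter (w.map f) (row.map f) = (moveLastAfter w row).map f := by
  rw [moveLastAfter, moveLastAfter, ← List.map_dropLast, List.flatMap_map, List.map_flatMap]
  congr 1
  ext1 x
  have : (some (f x) = w.map f) ↔ (some x = w) := by
    rw [← Option.map_some, (Option.map_injective hf).eq_iff]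
  simp only [this]
  split
  · rw [List.map_cons, List.getLast?_map, Option.toList_map]
  · simp

theorem move_rename {f : A → B} (hf : f.Injective) (R : Rows A) (m : Move) :
    (R.rename f).move m = (R.move m).rename f := by
  cases m <;>
    simp only [Rows.move, Rows.rename, ← moveLastAfter_map hf, List.getLast?_map]

/-- A path leads from one labelled permutation and row vector to another one. -/
def Run (R : Rows A) (V : A → ℕ) (ms : List Move) (R' : Rows A) (V' : A → ℕ) : Prop :=
  R.moves ms = R' ∧ R.cols ms V = V'

theorem cols_append (R : Rows A) (a b : List Move) (V : A → ℕ) :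
    R.cols (a ++ b) V = (R.moves a).cols b (R.cols a V) := by
  induction a generalizing R V with
  | nil => rfl
  | cons m a ih => exact ih _ _

theorem Run.append {R R' R'' : Rows A} {V V' V'' : A → ℕ} {a b : List Move}
    (h : Run R V a R' V') (h' : Run R' V' b R'' V'') : Run R V (a ++ b) R'' V'' := by
  obtain ⟨rfl, rfl⟩ := h
  obtain ⟨rfl, rfl⟩ := h'
  exact ⟨by simp [Rows.moves], cols_append _ _ _ _⟩

theorem Run.of_eq {R R' R₁ R₁' : Rows A} {V V' V₁' : A → ℕ} {ms ms₁ : List Move}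
    (h : Run R V ms R' V') (e : R = R₁) (em : ms = ms₁) (e' : R' = R₁') (eV : ∀ j, V' j = V₁' j) :
    Run R₁ V ms₁ R₁' V₁' := by
  obtain rfl : V' = V₁' := funext eV
  subst e em e'
  exact h

/-- Extension of a vector by zero. -/
def extendZero {n : ℕ} (V : Fin n → ℕ) (k : ℕ) : ℕ := if h : k < n then V ⟨k, h⟩ else 0

theorem extendZero_val {n : ℕ} (V : Fin n → ℕ) (j : Fin n) : extendZero V j.val = V j := by
  simp [extendZero]

theorem extendZero_colStep {n : ℕ} (R : Rows (Fin n)) (m : Move) (V : Fin n → ℕ) :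
    (R.rename Fin.val).colStep m (extendZero V) = extendZero (R.colStep m V) := by
  have hw : (R.rename Fin.val).winner m = (R.winner m).map Fin.val := by
    cases m <;> simp [Rows.winner, Rows.rename]
  have hl : (R.rename Fin.val).loser m = (R.loser m).map Fin.val := by
    cases m <;> simp [Rows.loser, Rows.rename]
  unfold Rows.colStep
  rw [hw, hl]
  cases R.winner m with
  | none => rfl
  | some w =>
    cases R.loser m with
    | none => rfl
    | some l =>
      ext k
      simp only [Option.map_some]
      by_cases hk : k < n
      · have e : ∀ U : Fin n → ℕ, extendZero U k = U ⟨k, hk⟩ := fun U => extendZero_val U ⟨k, hk⟩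
        rw [e, e, extendZero_val]
        simp [Fin.ext_iff]
      · have e : ∀ U : Fin n → ℕ, extendZero U k = 0 := fun U => by simp [extendZero, hk]
        rw [e, e, if_neg]
        rintro rfl
        exact hk l.isLt

/-- Allows the computations to be made with natural numbers as letters, which avoids bounds on
indices. -/
theorem run_rename {n : ℕ} (R : Rows (Fin n)) (V : Fin n → ℕ) (ms : List Move) :
    Run (R.rename Fin.val) (extendZero V) ms ((R.moves ms).rename Fin.val)
      (extendZero (R.cols ms V)) := by
  induction ms generalizing R V with
  | nil => exact ⟨rfl, rfl⟩
  | cons m ms ih =>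
    obtain ⟨h1, h2⟩ := ih (R.move m) (R.colStep m V)
    refine ⟨?_, ?_⟩
    · rw [Rows.moves, List.foldl_cons, move_rename Fin.val_injective]
      exact h1
    · rw [Rows.cols, move_rename Fin.val_injective, extendZero_colStep]
      exact h2

theorem run_one {p q s : List A} {w l : A} (hp : w ∉ p) (hq : w ∉ q) (V : A → ℕ) :
    Run ⟨p ++ w :: (q ++ [l]), s ++ [w]⟩ V [.one] ⟨p ++ w :: l :: q, s ++ [w]⟩
      fun j => V j + if j = l then V w else 0 := by
  have e : (p ++ w :: (q ++ [l])).getLast? = some l := by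
    rw [← List.cons_append, ← List.append_assoc, List.getLast?_concat]
  refine ⟨?_, ?_⟩
  · simp only [Rows.moves, List.foldl_cons, List.foldl_nil, Rows.move, List.getLast?_concat,
      moveLastAfter_append hp hq]
  · simp only [Rows.cols, Rows.colStep, Rows.winner, Rows.loser, List.getLast?_concat, e]

theorem run_zero {p q s : List A} {w l : A} (hp : w ∉ p) (hq : w ∉ q) (V : A → ℕ) :
    Run ⟨s ++ [w], p ++ w :: (q ++ [l])⟩ V [.zero] ⟨s ++ [w], p ++ w :: l :: q⟩
      fun j => V j + if j = l then V w else 0 := by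
  have e : (p ++ w :: (q ++ [l])).getLast? = some l := by
    rw [← List.cons_append, ← List.append_assoc, List.getLast?_concat]
  refine ⟨?_, ?_⟩
  · simp only [Rows.moves, List.foldl_cons, List.foldl_nil, Rows.move, List.getLast?_concat,
      moveLastAfter_append hp hq]
  · simp only [Rows.cols, Rows.colStep, Rows.winner, Rows.loser, List.getLast?_concat, e]

/-- Each move takes the last letter of the top row and puts it right after `w`. The letters of `r`
leave from the right one by one, so `r` jumps over `q` with its order preserved. The winner `w` is
never a loser here, so `V w` is constant. -/
theorem run_ones {p r s : List A} {w : A} (hp : w ∉ p) (hr : w ∉ r) (hn : r.Nodup) (q : List A)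
    (hq : w ∉ q) (V : A → ℕ) :
    Run ⟨p ++ w :: (q ++ r), s ++ [w]⟩ V (List.replicate r.length .one)
      ⟨p ++ w :: (r ++ q), s ++ [w]⟩ fun j => V j + if j ∈ r then V w else 0 := by
  induction r using List.reverseRecOn generalizing q V with
  | nil => exact ⟨by simp [Rows.moves], by simp [Rows.cols]⟩
  | append_singleton r l ih =>
    have hwl : w ≠ l := by rintro rfl; simp at hr
    have hlr : l ∉ r := by
      intro h
      rw [List.nodup_append] at hn
      exact hn.2.2 l h l (by simp) rfl
    have h1 := run_one (p := p) (s := s) (q := q ++ r) (l := l) hp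
      (by simp_all) V
    have h2 := ih (by simp_all) (by simp_all [List.nodup_append]) (l :: q) (by simp_all)
      (fun j => V j + if j = l then V w else 0)
    refine (h1.append h2).of_eq ?_ ?_ ?_ fun j => ?_
    · simp
    · rw [List.length_append, List.length_singleton, add_comm, List.replicate_add]
      rfl
    · simp
    · by_cases h : j = l
      · subst h; simp [hlr]
      · simp [h, hwl]

/-- With nothing between `w` and `r`, a round of `r.length` moves restores the rows and adds `V w`
once to each letter of `r`. -/
theorem run_ones_mul {p r s : List A} {w : A} (hp : w ∉ p) (hr : w ∉ r) (hn : r.Nodup) (c : ℕ)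
    (V : A → ℕ) :
    Run ⟨p ++ w :: r, s ++ [w]⟩ V (List.replicate (c * r.length) .one)
      ⟨p ++ w :: r, s ++ [w]⟩ fun j => V j + if j ∈ r then c * V w else 0 := by
  induction c with
  | zero => exact ⟨by simp [Rows.moves], by simp [Rows.cols]⟩
  | succ c ih =>
    have h1 := run_ones (p := p) (s := s) hp hr hn [] (by simp)
      (fun j => V j + if j ∈ r then c * V w else 0)
    rw [List.nil_append, List.append_nil] at h1
    refine (ih.append h1).of_eq rfl ?_ rfl fun j => ?_
    · rw [add_mul, one_mul, List.replicate_add]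
    · by_cases h : j ∈ r
      · simp [h, hr]; ring
      · simp [h]

/-- The loser already stands right after the winner, so the move fixes the rows and can be repeated.
-/
theorem run_zeros {p s : List A} {w l : A} (hp : w ∉ p) (hwl : w ≠ l) (a : ℕ) (V : A → ℕ) :
    Run ⟨s ++ [w], p ++ [w, l]⟩ V (List.replicate a .zero) ⟨s ++ [w], p ++ [w, l]⟩
      fun j => V j + if j = l then a * V w else 0 := by
  induction a with
  | zero => exact ⟨by simp [Rows.moves], by simp [Rows.cols]⟩
  | succ a ih =>
    have h1 := run_zero (p := p) (s := s) (q := []) (l := l) hp (by simp)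
      (fun j => V j + if j = l then a * V w else 0)
    refine (ih.append h1).of_eq rfl ?_ rfl fun j => ?_
    · rw [List.replicate_add]; rfl
    · by_cases h : j = l
      · simp [h, hwl]; ring
      · simp [h]

end Columns

/-! ### The transition matrix of the cycle -/

section Cycle

theorem range_eq_append (b k : ℕ) :
    List.range (b + 2 + k) = List.range b ++ b :: (b + 1) :: List.range' (b + 2) k := by
  rw [List.range_eq_range', List.range_eq_range', show b + 2 + k = b + (k + 1 + 1) by ring,
    ← List.range'_append_1, zero_add, List.range'_succ, List.range'_succ]

/-- The action of a block on row vectors. -/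
def blockCols (N a b : ℕ) (V : ℕ → ℕ) (j : ℕ) : ℕ :=
  if j = b then V b + a * V (b + 1) + (V N + V b)
  else if j = b + 1 then V b + (a + 1) * V (b + 1) + (V N + V b)
  else if b + 2 ≤ j ∧ j ≤ N then V j + V b
  else V j

/-- The initial moves of type `1` bring `b + 1` to the end of the top row, while the bottom row ends
with `b + 1, b`. Then `0^a` fixes the rows, the next `1` restores the top row, and `0^2` carries `b`
and then `b + 1` to the place right after `N`. Letters are counted from zero, so `b + 1` is the `m`
of the path. -/
theorem run_block {N b : ℕ} (hb : b + 2 ≤ N) (a : ℕ) (X : List ℕ) (hN : N ∉ X) (h1 : b + 1 ∉ X)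
    (V : ℕ → ℕ) :
    Run ⟨List.range (N + 1), N :: (X ++ [b + 1, b])⟩ V (block (N + 1) a (b + 1))
      ⟨List.range (N + 1), N :: (b + 1) :: b :: X⟩ (blockCols N a b V) := by
  -- The initial power of `1` has exponent `k + 1`, the number of letters after `b + 1` in the top
  -- row.
  obtain ⟨k, rfl⟩ : ∃ k, N = b + 1 + (k + 1) := ⟨N - b - 2, by omega⟩
  have hr : List.range (b + 1 + (k + 1) + 1) = List.range b ++ b :: (b + 1) ::
      List.range' (b + 2) (k + 1) := by
    rw [← range_eq_append]; congr 1; ring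
  have hr' : List.range (b + 1 + (k + 1) + 1) =
      List.range (b + 1 + (k + 1)) ++ [b + 1 + (k + 1)] := List.range_succ
  set N := b + 1 + (k + 1) with hNdef
  set M := List.range' (b + 2) (k + 1) with hM
  have hMn : M.Nodup := List.nodup_range'
  have hMmem : ∀ j, j ∈ M ↔ b + 2 ≤ j ∧ j ≤ N := by
    intro j; rw [hM, List.mem_range'_1]; omega
  have hbM : b ∉ M := by rw [hMmem]; omega
  have hbM1 : b + 1 ∉ M := by rw [hMmem]; omega
  have hNM : N ∈ M := by rw [hMmem]; omega
  have hlen : M.length = k + 1 := by rw [hM, List.length_range']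
  have s1 := (run_ones (p := List.range b) (w := b) (r := M) (s := N :: (X ++ [b + 1]))
    (by simp) hbM hMn [b + 1] (by simp) V).of_eq
    (R₁ := ⟨List.range (N + 1), N :: (X ++ [b + 1, b])⟩)
    (R₁' := ⟨(List.range b ++ b :: M) ++ [b + 1], (N :: X) ++ [b + 1, b]⟩)
    (by simp [hr]) rfl (by simp) (fun _ => rfl)
  obtain ⟨V1, hV1⟩ : ∃ V1, V1 = fun j => V j + if j ∈ M then V b else 0 := ⟨_, rfl⟩
  rw [← hV1] at s1
  have s2 := (run_zeros (s := List.range b ++ b :: M) (p := N :: X)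
    (w := b + 1) (l := b) (by simp [h1]; omega) (by omega) a V1)
  obtain ⟨V2, hV2⟩ : ∃ V2, V2 = fun j => V1 j + if j = b then a * V1 (b + 1) else 0 := ⟨_, rfl⟩
  rw [← hV2] at s2
  have s3 := (run_one (p := List.range b) (w := b) (q := M) (l := b + 1)
    (s := N :: (X ++ [b + 1])) (by simp) hbM V2).of_eq
    (R₁ := ⟨(List.range b ++ b :: M) ++ [b + 1], (N :: X) ++ [b + 1, b]⟩)
    (R₁' := ⟨List.range N ++ [N], [] ++ N :: ((X ++ [b + 1]) ++ [b])⟩)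
    (by simp) rfl (by rw [← hr', hr]; simp) (fun _ => rfl)
  obtain ⟨V3, hV3⟩ : ∃ V3, V3 = fun j => V2 j + if j = b + 1 then V2 b else 0 := ⟨_, rfl⟩
  rw [← hV3] at s3
  have s4 := (run_zero (s := List.range N) (w := N) (p := []) (q := X ++ [b + 1]) (l := b)
    (by simp) (by simp [hN]; omega) V3).of_eq rfl rfl
    (R₁' := ⟨List.range N ++ [N], [] ++ N :: ((b :: X) ++ [b + 1])⟩) (by simp) (fun _ => rfl)
  obtain ⟨V4, hV4⟩ : ∃ V4, V4 = fun j => V3 j + if j = b then V3 N else 0 := ⟨_, rfl⟩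
  rw [← hV4] at s4
  have s5 := run_zero (s := List.range N) (w := N) (p := []) (q := b :: X) (l := b + 1)
    (by simp) (by simp [hN]; omega) V4
  refine ((((s1.append s2).append s3).append s4).append s5).of_eq rfl ?_ (by rw [hr']; rfl) ?_
  · rw [block, hlen, show N + 1 - 1 - (b + 1) = k + 1 by omega]
    simp
  · intro j
    have e1 : V1 b = V b := by simp [hV1, hbM]
    have e1' : V1 (b + 1) = V (b + 1) := by simp [hV1, hbM1]
    have e1N : V1 N = V N + V b := by simp [hV1, hNM]
    have hNb : N ≠ b := by omega
    have hNb1 : N ≠ b + 1 := by omega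
    have e2 : V2 b = V b + a * V (b + 1) := by simp [hV2, e1, e1']
    have e2' : V2 (b + 1) = V (b + 1) := by simp [hV2, e1']
    have e2N : V2 N = V N + V b := by simp [hV2, e1N, hNb]
    have e3 : V3 b = V b + a * V (b + 1) := by simp [hV3, e2]
    have e3' : V3 (b + 1) = V (b + 1) + (V b + a * V (b + 1)) := by simp [hV3, e2, e2']
    have e3N : V3 N = V N + V b := by simp [hV3, e2N, hNb1]
    unfold blockCols
    by_cases hjb : j = b
    · subst hjb
      simp [hV4, e3, e3N]
    by_cases hjb1 : j = b + 1
    · subst hjb1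
      simp [hV4, e3', e3N, hNb]; ring
    · simp only [hV4, hV3, hV2, hV1, hjb, hjb1, if_false, hMmem, add_zero]
      split <;> simp

/-- The letters `2k, 2k-1`, in pairs, in the bottom row. -/
def pairs (k : ℕ) : List ℕ := (List.range k).flatMap fun s => [2 * s + 2, 2 * s + 1]

theorem pairs_succ (k : ℕ) : pairs (k + 1) = pairs k ++ [2 * k + 2, 2 * k + 1] := by
  simp [pairs, List.range_succ]

theorem mem_pairs {k j : ℕ} : j ∈ pairs k ↔ 1 ≤ j ∧ j ≤ 2 * k := by
  induction k with
  | zero => simp [pairs]; omega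
  | succ k ih => rw [pairs_succ, List.mem_append, ih]; simp; omega

/-- The action of the blocks on row vectors. -/
def blocksCols (N a k : ℕ) (V : ℕ → ℕ) (j : ℕ) : ℕ :=
  if j = 0 then V 0
  else if j ≤ 2 * k then
    (if Odd j then V j + a * V (j + 1) else V (j - 1) + (a + 1) * V j) +
      (V N + ∑ s ∈ Finset.range k, V (2 * s + 1))
  else if j ≤ N then V j + ∑ s ∈ Finset.range k, V (2 * s + 1)
  else V j

/-- A block with first letter `b` adds `V b` to all letters beyond its pair, among them the last
one. Higher pairs are treated earlier and receive this directly; lower pairs receive it through the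
entry of the last letter. So every letter of a pair ends up with the same sum over all pairs. -/
theorem blocksCols_succ {N k : ℕ} (a : ℕ) (hk : 2 * k + 3 ≤ N) (V : ℕ → ℕ) (j : ℕ) :
    blocksCols N a k (blockCols N a (2 * k + 1) V) j = blocksCols N a (k + 1) V j := by
  have hlow : ∀ i, i < 2 * k + 1 → blockCols N a (2 * k + 1) V i = V i := by
    intro i hi
    rw [blockCols, if_neg (by omega), if_neg (by omega), if_neg (by omega)]
  have hsum : ∑ s ∈ Finset.range k, blockCols N a (2 * k + 1) V (2 * s + 1) =
      ∑ s ∈ Finset.range k, V (2 * s + 1) := by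
    apply Finset.sum_congr rfl
    intro s hs
    rw [Finset.mem_range] at hs
    exact hlow _ (by omega)
  have hN : blockCols N a (2 * k + 1) V N = V N + V (2 * k + 1) := by
    rw [blockCols, if_neg (by omega), if_neg (by omega), if_pos (by omega)]
  unfold blocksCols
  rw [hsum, hN, Finset.sum_range_succ]
  by_cases h0 : j = 0
  · subst h0
    simp [hlow]
  rw [if_neg h0, if_neg h0]
  by_cases h1 : j ≤ 2 * k
  · have h2 : j ≤ 2 * (k + 1) := by omega
    rw [if_pos h1, if_pos h2, hlow j (by omega), hlow (j - 1) (by omega)]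
    by_cases ho : Odd j
    · obtain ⟨i, rfl⟩ := ho
      have ho : Odd (2 * i + 1) := ⟨i, rfl⟩
      rw [if_pos ho, if_pos ho, hlow _ (by omega)]
      ring
    · rw [if_neg ho, if_neg ho]
      ring
  rw [if_neg h1]
  by_cases h2 : j ≤ 2 * (k + 1)
  · rw [if_pos (by omega), if_pos h2]
    obtain rfl | rfl : j = 2 * k + 1 ∨ j = 2 * k + 2 := by omega
    · rw [if_pos ⟨k, rfl⟩, blockCols, if_pos rfl]
      ring
    · rw [if_neg (by rw [Nat.not_odd_iff_even]; exact ⟨k + 1, by ring⟩), blockCols,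
        if_neg (by omega), if_pos rfl]
      simp only [Nat.add_succ_sub_one]
      ring
  · rw [if_neg h2]
    by_cases h3 : j ≤ N
    · rw [if_pos h3, if_pos h3, blockCols, if_neg (by omega), if_neg (by omega),
        if_pos (by omega)]
      ring
    · rw [if_neg h3, if_neg h3, blockCols, if_neg (by omega), if_neg (by omega),
        if_neg (by omega)]

/-- Each block moves the last pair of the bottom row to the front, behind `N`. It thereby joins the
letters already treated, so the induction has to allow an arbitrary list `Y`. -/
theorem run_blocks {N k : ℕ} (hk : 2 * k + 1 ≤ N) (a : ℕ) (Y : List ℕ) (hN : N ∉ Y)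
    (hY : ∀ j ∈ Y, 1 ≤ j → 2 * k < j) (V : ℕ → ℕ) :
    Run ⟨List.range (N + 1), N :: (Y ++ pairs k)⟩ V
      ((List.range k).reverse.flatMap fun s => block (N + 1) a (2 * (s + 1)))
      ⟨List.range (N + 1), N :: (pairs k ++ Y)⟩ (blocksCols N a k V) := by
  induction k generalizing Y V with
  | zero =>
    refine ⟨by simp [Rows.moves, pairs], ?_⟩
    ext j
    by_cases h : j = 0
    · subst h; simp [Rows.cols, blocksCols]
    · simp [Rows.cols, blocksCols, h]
  | succ k ih =>
    have h1 : 2 * k + 1 + 1 ∉ Y ++ pairs k := by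
      rw [List.mem_append, mem_pairs]
      rintro (h | h)
      · have := hY _ h (by omega); omega
      · omega
    have s1 := run_block (N := N) (b := 2 * k + 1) (by omega) a (Y ++ pairs k)
      (by rw [List.mem_append, mem_pairs]; simp [hN]; omega) h1 V
    have s2 := ih (by omega) ((2 * k + 2) :: (2 * k + 1) :: Y) (by simp [hN]; omega)
      (by
        intro j hj hj1
        simp only [List.mem_cons] at hj
        rcases hj with rfl | rfl | hj
        · omega
        · omega
        · have := hY j hj hj1; omega) (blockCols N a (2 * k + 1) V)
    refine (s1.append s2).of_eq ?_ ?_ ?_ fun j => blocksCols_succ a (by omega) V j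
    · simp [pairs_succ]
    · rw [List.range_succ, List.reverse_append, List.reverse_singleton, List.singleton_append,
        List.flatMap_cons]
      rfl
    · simp [pairs_succ]

/-- The number of pairs of letters other than the first and the last one. -/
def numPairs (n : ℕ) : ℕ := n / 2 - 1

/-- The letters at the end of the bottom row. -/
def tailRow (n : ℕ) : List ℕ := if Even n then [0] else [n - 2, 0]

theorem initialRows_rename {n : ℕ} (hn : 4 ≤ n) :
    (initialRows n).rename Fin.val =
      ⟨List.range n, (n - 1) :: (pairs (numPairs n) ++ tailRow n)⟩ := by
  -- After the first letter the bottom row consists of swapped pairs; with positions counted from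
  -- zero, position `i` there carries `i + 2` or `i` according to parity.
  have key : ∀ k, (List.range (2 * k)).map (fun i => if Even i then i + 2 else i) = pairs k := by
    intro k
    induction k with
    | zero => rfl
    | succ k ih =>
      rw [pairs_succ, ← ih, show 2 * (k + 1) = 2 * k + 1 + 1 by ring, List.range_succ,
        List.range_succ]
      simp
  have hbot : ((List.finRange n).map (bottomLetter n)).map Fin.val = (List.range n).map fun q =>
      if q = 0 then n - 1 else if q = n - 1 then 0 else if Even q then q - 1
      else if q + 1 < n - 1 then q + 1 else q := by
    rw [List.map_map, ← List.map_coe_finRange_eq_range, List.map_map]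
    apply List.map_congr_left
    intro q _
    simp only [Function.comp_apply, bottomLetter]
    split_ifs <;> rfl
  have htop : (List.finRange n).map Fin.val = List.range n := List.map_coe_finRange_eq_range
  have hmid : ∀ k, 2 * k + 2 ≤ n →
      (List.range (2 * k)).map (fun i => if i + 1 = 0 then n - 1 else if i + 1 = n - 1 then 0
        else if Even (i + 1) then i + 1 - 1 else if i + 1 + 1 < n - 1 then i + 1 + 1 else i + 1)
        = pairs k := by
    intro k hk
    rw [← key k]
    apply List.map_congr_left
    intro i hi
    rw [List.mem_range] at hi
    rw [if_neg (by omega), if_neg (by omega)]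
    by_cases he : Even i
    · obtain ⟨m, rfl⟩ := he
      have : ¬ Even (m + m + 1) := by rw [Nat.not_even_iff_odd]; exact ⟨m, by ring⟩
      rw [if_neg this, if_pos (by omega), if_pos ⟨m, rfl⟩]
    · rw [if_pos (by rw [Nat.even_add_one]; exact he), if_neg he]
      rfl
  rw [Rows.rename]
  change Rows.mk ((List.finRange n).map Fin.val)
    (((List.finRange n).map (bottomLetter n)).map Fin.val) = _
  rw [htop, hbot]
  congr 1
  by_cases he : Even n
  · obtain ⟨k, rfl⟩ : ∃ k, n = 2 * k + 1 + 1 := by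
      obtain ⟨m, rfl⟩ := he
      exact ⟨m - 1, by omega⟩
    have hk : numPairs (2 * k + 1 + 1) = k := by unfold numPairs; omega
    rw [hk, tailRow, if_pos he, ← hmid k (by omega)]
    conv_lhs => rw [List.range_succ, List.range_succ_eq_map]
    simp [Function.comp_def]
  · obtain ⟨k, rfl⟩ : ∃ k, n = 2 * k + 1 + 1 + 1 := by
      rw [Nat.not_even_iff_odd] at he
      obtain ⟨m, rfl⟩ := he
      exact ⟨m - 1, by omega⟩
    have hk : numPairs (2 * k + 1 + 1 + 1) = k := by unfold numPairs; omega
    rw [hk, tailRow, if_neg he, ← hmid k (by omega)]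
    conv_lhs => rw [List.range_succ, List.range_succ, List.range_succ_eq_map]
    have ho : ¬ Even (2 * k + 1) := by rw [Nat.not_even_iff_odd]; exact ⟨k, rfl⟩
    simp [Function.comp_def]

/-- The action of the initial piece of the cycle on row vectors. -/
def startCols (n : ℕ) (V : ℕ → ℕ) (j : ℕ) : ℕ :=
  if j = 0 then V 0 + V (n - 1)
  else if Even n then V j
  else if j = n - 2 then 2 * V (n - 2) + V (n - 1)
  else if j = n - 1 then V (n - 1) + V (n - 2)
  else V j

/-- This moves the tail of the bottom row in front of the pairs; the blocks later move the pairs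
back. For odd `n` the middle move `1` fixes the rows, since `n - 1` already follows `n - 2` in the
top row. -/
theorem run_start {n : ℕ} (hn : 4 ≤ n) (V : ℕ → ℕ) :
    Run ⟨List.range n, (n - 1) :: (pairs (numPairs n) ++ tailRow n)⟩ V
      (if Even n then [.zero] else [.zero, .one, .zero])
      ⟨List.range n, (n - 1) :: (tailRow n ++ pairs (numPairs n))⟩
      (startCols n V) := by
  obtain ⟨N, rfl⟩ : ∃ N, n = N + 1 + 1 := ⟨n - 2, by omega⟩
  have hN : N + 1 ∉ pairs (numPairs (N + 1 + 1)) := by rw [mem_pairs, numPairs]; omega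
  by_cases he : Even (N + 1 + 1)
  · have s1 := run_zero (s := List.range (N + 1)) (w := N + 1) (p := [])
      (q := pairs (numPairs (N + 1 + 1))) (l := 0) (by simp) hN V
    rw [if_pos he]
    refine s1.of_eq ?_ rfl ?_ fun j => ?_
    · rw [List.range_succ (n := N + 1), tailRow, if_pos he]; rfl
    · rw [List.range_succ (n := N + 1), tailRow, if_pos he]; rfl
    · unfold startCols
      by_cases hj : j = 0
      · subst hj; simp
      · simp [hj, he]
  · have hN' : N ∉ pairs (numPairs (N + 1 + 1)) := by
      rw [mem_pairs, numPairs]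
      rw [Nat.not_even_iff_odd] at he
      obtain ⟨m, hm⟩ := he
      omega
    have s1 := (run_zero (s := List.range (N + 1)) (w := N + 1) (p := [])
      (q := pairs (numPairs (N + 1 + 1)) ++ [N]) (l := 0) (by simp) (by simp [hN]) V).of_eq
      (R₁ := ⟨List.range (N + 1 + 1), (N + 1) :: (pairs (numPairs (N + 1 + 1)) ++ [N, 0])⟩)
      (R₁' := ⟨List.range N ++ N :: ([] ++ [N + 1]),
        ((N + 1) :: 0 :: pairs (numPairs (N + 1 + 1))) ++ [N]⟩)
      (by rw [List.range_succ (n := N + 1)]; simp) rfl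
      (by rw [List.range_succ (n := N)]; simp) (fun _ => rfl)
    obtain ⟨V1, hV1⟩ : ∃ V1, V1 = fun j => V j + if j = 0 then V (N + 1) else 0 := ⟨_, rfl⟩
    rw [← hV1] at s1
    have s2 := (run_one (p := List.range N) (w := N) (q := []) (l := N + 1)
      (s := (N + 1) :: 0 :: pairs (numPairs (N + 1 + 1))) (by simp) (by simp) V1).of_eq
      (R₁' := ⟨(List.range N ++ [N]) ++ [N + 1],
        [] ++ (N + 1) :: ((0 :: pairs (numPairs (N + 1 + 1))) ++ [N])⟩)
      rfl rfl (by simp) (fun _ => rfl)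
    obtain ⟨V2, hV2⟩ : ∃ V2, V2 = fun j => V1 j + if j = N + 1 then V1 N else 0 := ⟨_, rfl⟩
    rw [← hV2] at s2
    have s3 := run_zero (s := List.range N ++ [N]) (w := N + 1) (p := [])
      (q := 0 :: pairs (numPairs (N + 1 + 1))) (l := N) (by simp) (by simp [hN]) V2
    rw [if_neg he, tailRow, if_neg he]
    refine ((s1.append s2).append s3).of_eq rfl rfl ?_ fun j => ?_
    · rw [List.range_succ (n := N + 1), List.range_succ (n := N)]; simp
    · have hN0 : N ≠ 0 := by omega
      unfold startCols
      rw [hV2, hV1]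
      simp only [he, if_false, Nat.add_sub_cancel, show N + 1 + 1 - 2 = N by omega]
      by_cases h0 : j = 0
      · subst h0
        simp [Ne.symm hN0]
      by_cases h1 : j = N
      · subst h1; simp [hN0]; ring
      by_cases h2 : j = N + 1
      · subst h2; simp [hN0]
      · simp [h0, h1, h2]

/-- The action of the cycle on row vectors. -/
def cycleCols (n a c : ℕ) (V : ℕ → ℕ) (j : ℕ) : ℕ :=
  if j = 0 then V 0 + V (n - 1)
  else if n ≤ j then V j
  else c * (V 0 + V (n - 1)) + V (n - 1) + ∑ s ∈ Finset.range ((n - 1) / 2), V (2 * s + 1) +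
    if j = n - 1 then 0
    else if Odd j then V j + (if j + 1 < n - 1 then a * V (j + 1) else 0)
    else V (j - 1) + (a + 1) * V j

theorem run_cycle {n : ℕ} (hn : 4 ≤ n) (a c : ℕ) (V : ℕ → ℕ) :
    Run ⟨List.range n, (n - 1) :: (pairs (numPairs n) ++ tailRow n)⟩ V (cycle n a c)
      ⟨List.range n, (n - 1) :: (pairs (numPairs n) ++ tailRow n)⟩ (cycleCols n a c V) := by
  have hrev := run_start hn V
  have hq : 2 * numPairs n + 2 ≤ n := by unfold numPairs; omega
  have hmem : ∀ j ∈ tailRow n, j = 0 ∨ (j = n - 2 ∧ ¬ Even n) := by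
    intro j hj
    unfold tailRow at hj
    by_cases he : Even n
    · simp [he] at hj; exact Or.inl hj
    · simp [he] at hj
      exact hj.symm.imp_right fun h => ⟨h, he⟩
  have hodd : ¬ Even n → 2 * numPairs n + 3 = n := by
    intro he
    rw [Nat.not_even_iff_odd] at he
    obtain ⟨m, rfl⟩ := he
    unfold numPairs; omega
  obtain ⟨N, rfl⟩ : ∃ N, n = N + 1 := ⟨n - 1, by omega⟩
  obtain ⟨q, hqdef⟩ : ∃ q, q = numPairs (N + 1) := ⟨_, rfl⟩
  rw [Nat.add_sub_cancel, ← hqdef] at hrev ⊢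
  rw [← hqdef] at hq hodd
  obtain ⟨U, hU⟩ : ∃ U, U = startCols (N + 1) V := ⟨_, rfl⟩
  rw [← hU] at hrev
  have s2 := run_blocks (N := N) (k := q) (by omega) a (tailRow (N + 1))
    (fun h => by rcases hmem _ h with h | h <;> omega)
    (fun j hj hj1 => by
      rcases hmem _ hj with h | h
      · omega
      · have := hodd h.2; omega) U
  obtain ⟨Z, hZ⟩ : ∃ Z, Z = blocksCols N a q U := ⟨_, rfl⟩
  rw [← hZ] at s2
  obtain ⟨t, ht⟩ : ∃ t, tailRow (N + 1) = t ++ [0] := by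
    unfold tailRow
    split
    · exact ⟨[], rfl⟩
    · exact ⟨[N + 1 - 2], rfl⟩
  -- The letter `0` is last in the bottom row and first in the top row, so each `N` moves of type
  -- `1` are a full rotation of the other letters.
  have s3 := run_ones_mul (p := []) (w := 0) (r := (List.range N).map Nat.succ)
    (s := N :: (pairs q ++ t)) (by simp) (by simp)
    (List.Nodup.map Nat.succ_injective List.nodup_range) c Z
  refine ((hrev.append s2).append (s3.of_eq ?_ rfl ?_ fun _ => rfl)).of_eq rfl ?_ rfl ?_
  · rw [List.range_succ_eq_map, ht]; simp
  · rw [List.range_succ_eq_map, ht]; simp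
  · rw [cycle, List.length_map, List.length_range, hqdef]
    rfl
  · intro j
    have hmemj : j ∈ (List.range N).map Nat.succ ↔ j ≠ 0 ∧ j < N + 1 := by
      simp only [List.mem_map, List.mem_range, Nat.succ_eq_add_one]
      constructor
      · rintro ⟨i, hi, rfl⟩; omega
      · rintro ⟨h0, h1⟩; exact ⟨j - 1, by omega, by omega⟩
    have hU0 : U 0 = V 0 + V N := by simp [hU, startCols]
    have hZ0 : Z 0 = V 0 + V N := by rw [hZ, blocksCols, if_pos rfl, hU0]
    have hUj : ∀ i, 1 ≤ i → i ≤ 2 * q → U i = V i := by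
      intro i h1 h2
      rw [hU, startCols, if_neg (by omega)]
      by_cases he : Even (N + 1)
      · rw [if_pos he]
      · have := hodd he
        rw [if_neg he, if_neg (by omega), if_neg (by omega)]
    have hUsum : ∑ s ∈ Finset.range q, U (2 * s + 1) = ∑ s ∈ Finset.range q, V (2 * s + 1) := by
      apply Finset.sum_congr rfl
      intro s hs
      rw [Finset.mem_range] at hs
      exact hUj _ (by omega) (by omega)
    have hUN : U N + ∑ s ∈ Finset.range q, U (2 * s + 1) =
        V N + ∑ s ∈ Finset.range (N / 2), V (2 * s + 1) := by
      rw [hUsum, hU, startCols, if_neg (by omega)]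
      by_cases he : Even (N + 1)
      · rw [if_pos he, show N / 2 = q by unfold numPairs at hqdef; obtain ⟨m, hm⟩ := he; omega]
      · have := hodd he
        rw [if_neg he, if_neg (by omega), if_pos (by omega), show N / 2 = q + 1 by omega,
          Finset.sum_range_succ, show N + 1 - 2 = 2 * q + 1 by omega, Nat.add_sub_cancel]
        ring
    simp only [hmemj]
    unfold cycleCols
    by_cases h0 : j = 0
    · subst h0; simp [hZ0]
    by_cases hjn : N + 1 ≤ j
    · rw [if_neg (by omega), if_neg h0, if_pos hjn, hZ, blocksCols, if_neg h0, if_neg (by omega),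
        if_neg (by omega), hU, startCols, if_neg h0]
      split_ifs
      · rfl
      · omega
      · omega
      · rfl
    rw [if_pos ⟨h0, by omega⟩, if_neg h0, if_neg hjn, hZ0, Nat.add_sub_cancel, hZ, blocksCols,
      if_neg h0]
    by_cases h2 : j ≤ 2 * q
    · rw [if_pos h2, hUN, if_neg (show j ≠ N by omega), hUj j (by omega) h2]
      by_cases ho : Odd j
      · have : j + 1 ≤ 2 * q := by obtain ⟨m, rfl⟩ := ho; omega
        rw [if_pos ho, if_pos ho, if_pos (by omega), hUj _ (by omega) this]
        ring
      · have : j ≠ 1 := by rintro rfl; exact ho odd_one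
        rw [if_neg ho, if_neg ho, hUj _ (by omega) (by omega)]
        ring
    · rw [if_neg h2, if_pos (by omega)]
      by_cases hjN : j = N
      · subst hjN
        rw [hUN, if_pos rfl]
        ring
      · have he : ¬ Even (N + 1) := by
          rintro ⟨m, hm⟩
          unfold numPairs at hqdef
          omega
        have := hodd he
        have hj : j = 2 * q + 1 := by omega
        have ho : Odd j := ⟨q, hj⟩
        rw [if_neg hjN, if_pos ho, if_neg (by omega), hUsum, hU, startCols, if_neg h0, if_neg he,
          if_pos (by omega), show N / 2 = q + 1 by omega, Finset.sum_range_succ,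
          show N + 1 - 2 = 2 * q + 1 by omega, hj, Nat.add_sub_cancel]
        ring

theorem rename_val_injective {n : ℕ} :
    Function.Injective (Rows.rename (Fin.val : Fin n → ℕ)) := by
  intro R R' h
  cases R
  cases R'
  simp only [Rows.rename, Rows.mk.injEq] at h
  rw [List.map_injective_iff.2 Fin.val_injective h.1, List.map_injective_iff.2 Fin.val_injective h.2]

/-- The path is closed. -/
theorem moves_cycle {n : ℕ} (hn : 4 ≤ n) (a c : ℕ) :
    (initialRows n).moves (cycle n a c) = initialRows n := by
  apply rename_val_injective
  have h1 := (run_rename (initialRows n) (fun _ => 0) (cycle n a c)).1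
  have h2 := (run_cycle hn a c (fun _ => 0)).1
  rw [← h1, initialRows_rename hn, h2]

theorem vecMul_Theta {n : ℕ} (hn : 4 ≤ n) (a c : ℕ) (V : Fin n → ℕ) (j : Fin n) :
    Matrix.vecMul V (Theta n a c) j = cycleCols n a c (extendZero V) j := by
  have h1 := (run_rename (initialRows n) V (cycle n a c)).2
  rw [initialRows_rename hn, (run_cycle hn a c (extendZero V)).2] at h1
  rw [h1, extendZero_val, Theta, vecMul_pathMatrix]

theorem initialRows_isValid {n : ℕ} (hn : 4 ≤ n) : (initialRows n).IsValid := by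
  have h := initialRows_rename hn
  simp only [Rows.rename, Rows.mk.injEq] at h
  have hlen : (initialRows n).bot.length = n := by simp [initialRows]
  have hmem : ∀ t, t ∈ (initialRows n).bot := by
    intro t
    rw [← List.mem_map_of_injective Fin.val_injective, h.2]
    have := t.isLt
    generalize t.val = k at this
    simp only [List.mem_cons, List.mem_append, mem_pairs]
    by_cases he : Even n
    · obtain ⟨m, rfl⟩ := he
      simp [tailRow, numPairs]; omega
    · have he' := he
      rw [Nat.not_even_iff_odd] at he'
      obtain ⟨m, rfl⟩ := he'
      simp [tailRow, numPairs]; omega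
  refine ⟨List.nodup_finRange n, ?_, List.mem_finRange, hmem⟩
  -- A list of length `n` that contains all `n` letters has no repetitions.
  rw [← Multiset.coe_nodup, ← Multiset.toFinset_card_eq_card_iff_nodup, Multiset.coe_card, hlen,
    show ((initialRows n).bot : Multiset (Fin n)).toFinset = Finset.univ by ext t; simp [hmem t],
    Finset.card_univ, Fintype.card_fin]

end Cycle

/-! ### Growth of the heights of the towers and convergence of the columns -/

section Heights

/-- The conditions on the parameters. -/
structure Params (n p : ℕ) (a c : ℕ → ℕ) : Prop where
  four_le : 4 ≤ n
  lt_p : n + 1 ≤ p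
  c_zero : 0 < c 0
  recur : ∀ i, c (i + 1) = p * a i ∧ p * a i = p ^ 2 * c i

variable {n p : ℕ} {a c : ℕ → ℕ}

theorem Params.a_eq (h : Params n p a c) (i : ℕ) : a i = p * c i := by
  have h1 := (h.recur i).2
  have : 0 < p := by have := h.lt_p; omega
  rw [pow_two, mul_assoc] at h1
  exact Nat.eq_of_mul_eq_mul_left this h1

theorem Params.c_succ (h : Params n p a c) (i : ℕ) : c (i + 1) = p ^ 2 * c i :=
  (h.recur i).1.trans (h.recur i).2

theorem Params.c_eq (h : Params n p a c) (i : ℕ) : c i = p ^ (2 * i) * c 0 := by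
  induction i with
  | zero => simp
  | succ i ih => rw [h.c_succ, ih]; ring

theorem Params.pow_le_c (h : Params n p a c) (i : ℕ) : p ^ (2 * i) ≤ c i := by
  rw [h.c_eq]; exact Nat.le_mul_of_pos_right _ h.c_zero

theorem Params.c_pos (h : Params n p a c) (i : ℕ) : 1 ≤ c i :=
  (Nat.one_le_pow _ _ (by have := h.lt_p; omega)).trans (h.pow_le_c i)

theorem Params.five_le (h : Params n p a c) : 5 ≤ p := by
  have := h.lt_p; have := h.four_le; omega

theorem Params.p_le_a (h : Params n p a c) (i : ℕ) : p ≤ a i := by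
  rw [h.a_eq]; exact Nat.le_mul_of_pos_right _ (h.c_pos i)

theorem Params.two_pow_le_c (h : Params n p a c) (i : ℕ) : 2 ^ i ≤ c i := by
  refine le_trans ?_ (h.pow_le_c i)
  rw [pow_mul]
  exact Nat.pow_le_pow_left (by have := h.five_le; nlinarith) i

theorem ThetaProd_succ (n : ℕ) (a c : ℕ → ℕ) (m : ℕ) :
    ThetaProd n a c (m + 1) = ThetaProd n a c m * Theta n (a m) (c m) := by
  simp [ThetaProd, List.range_succ]

/-- The heights of the towers, that is, the column sums of `ThetaProd`. -/
def height (n : ℕ) (a c : ℕ → ℕ) (m : ℕ) : Fin n → ℕ :=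
  Matrix.vecMul (fun _ => 1) (ThetaProd n a c m)

theorem height_zero (n : ℕ) (a c : ℕ → ℕ) (j : Fin n) : height n a c 0 j = 1 := by
  simp [height, ThetaProd]

theorem height_succ (n : ℕ) (a c : ℕ → ℕ) (m : ℕ) :
    height n a c (m + 1) = Matrix.vecMul (height n a c m) (Theta n (a m) (c m)) := by
  rw [height, height, ThetaProd_succ, Matrix.vecMul_vecMul]

theorem height_eq_sum (n : ℕ) (a c : ℕ → ℕ) (m : ℕ) (j : Fin n) :
    height n a c m j = ∑ t, ThetaProd n a c m t j := by
  simp [height, Matrix.vecMul, dotProduct]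

/-- The heights of the towers depend only on the kind of the letter: `u` is the height for the
first letter, `y` for the last letter, `e` and `x` for the first and second letter of a
pair, and `z` for the remaining letter if the number of letters is odd. -/
structure Profile where
  u : ℕ
  e : ℕ
  x : ℕ
  y : ℕ
  z : ℕ

/-- The heights listed by a profile. -/
def Profile.val (P : Profile) (n j : ℕ) : ℕ :=
  if j = 0 then P.u else if j = n - 1 then P.y
  else if Odd j then (if j + 1 < n - 1 then P.e else P.z) else P.x

/-- The common part of the new heights. -/
def Profile.base (P : Profile) (n c : ℕ) : ℕ :=
  c * (P.u + P.y) + P.y + (numPairs n * P.e + if Even n then 0 else P.z)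

/-- The change of the profile along a cycle. -/
def Profile.next (P : Profile) (n a c : ℕ) : Profile :=
  ⟨P.u + P.y, P.base n c + P.e + a * P.x, P.base n c + P.e + (a + 1) * P.x, P.base n c,
    P.base n c + P.z⟩

theorem Profile.sum_odd (P : Profile) {n : ℕ} (hn : 4 ≤ n) :
    ∑ s ∈ Finset.range ((n - 1) / 2), P.val n (2 * s + 1) =
      numPairs n * P.e + if Even n then 0 else P.z := by
  have key : ∀ k, 2 * k + 1 < n → ∑ s ∈ Finset.range k, P.val n (2 * s + 1) = k * P.e := by
    intro k hk
    rw [Finset.sum_congr rfl (g := fun _ => P.e), Finset.sum_const, Finset.card_range, smul_eq_mul]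
    intro s hs
    rw [Finset.mem_range] at hs
    rw [Profile.val, if_neg (by omega), if_neg (by omega), if_pos ⟨s, rfl⟩, if_pos (by omega)]
  by_cases he : Even n
  · rw [if_pos he, add_zero, key _ (by obtain ⟨m, rfl⟩ := he; omega), numPairs,
      show (n - 1) / 2 = n / 2 - 1 by obtain ⟨m, rfl⟩ := he; omega]
  · rw [if_neg he]
    rw [Nat.not_even_iff_odd] at he
    obtain ⟨m, rfl⟩ := he
    rw [show (2 * m + 1 - 1) / 2 = (m - 1) + 1 by omega, Finset.sum_range_succ,
      key _ (by omega), numPairs, show (2 * m + 1) / 2 - 1 = m - 1 by omega]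
    congr 1
    rw [Profile.val, if_neg (by omega), if_neg (by omega), if_pos ⟨m - 1, rfl⟩, if_neg (by omega)]

/-- Row vectors whose entries depend only on the kind of the letter are preserved by a cycle, so the
heights reduce to a recursion for five numbers. -/
theorem Profile.cycleCols_val (P : Profile) {n : ℕ} (hn : 4 ≤ n) (a c : ℕ) (V : ℕ → ℕ)
    (hV : ∀ j, j < n → V j = P.val n j) {j : ℕ} (hj : j < n) :
    cycleCols n a c V j = (P.next n a c).val n j := by
  have h0 : V 0 = P.u := by rw [hV 0 (by omega), Profile.val, if_pos rfl]
  have hN : V (n - 1) = P.y := by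
    rw [hV _ (by omega), Profile.val, if_neg (by omega), if_pos rfl]
  have hs : ∑ s ∈ Finset.range ((n - 1) / 2), V (2 * s + 1) =
      numPairs n * P.e + if Even n then 0 else P.z := by
    rw [← P.sum_odd hn]
    apply Finset.sum_congr rfl
    intro s hs
    rw [Finset.mem_range] at hs
    exact hV _ (by omega)
  have hb : c * (V 0 + V (n - 1)) + V (n - 1) + ∑ s ∈ Finset.range ((n - 1) / 2), V (2 * s + 1) =
      P.base n c := by rw [h0, hN, hs, Profile.base]
  unfold cycleCols
  rw [hb]
  by_cases hj0 : j = 0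
  · subst hj0
    simp [Profile.val, Profile.next, h0, hN]
  rw [if_neg hj0, if_neg (by omega), Profile.val, if_neg hj0]
  by_cases hjN : j = n - 1
  · rw [if_pos hjN, if_pos hjN, add_zero, Profile.next]
  rw [if_neg hjN, if_neg hjN]
  by_cases ho : Odd j
  · rw [if_pos ho, if_pos ho, hV j hj, Profile.val, if_neg hj0, if_neg hjN, if_pos ho]
    by_cases hlt : j + 1 < n - 1
    · rw [if_pos hlt, if_pos hlt, if_pos hlt, hV _ (by omega), Profile.val, if_neg (by omega),
        if_neg (by omega), if_neg (by rw [Nat.not_odd_iff_even]; exact ho.add_one), Profile.next]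
      ring
    · rw [if_neg hlt, if_neg hlt, if_neg hlt, Profile.next, add_zero]
  · rw [if_neg ho, if_neg ho, hV j hj, Profile.val, if_neg hj0, if_neg hjN, if_neg ho,
      hV _ (by omega), Profile.val]
    have hj1 : j ≠ 1 := by rintro rfl; exact ho odd_one
    have ho' : Odd (j - 1) := by
      rw [Nat.not_odd_iff_even] at ho
      obtain ⟨m, rfl⟩ := ho
      exact ⟨m - 1, by omega⟩
    rw [if_neg (by omega), if_neg (by omega), if_pos ho', if_pos (by omega), Profile.next]
    ring

/-- The profile of the heights. -/
def profile (n : ℕ) (a c : ℕ → ℕ) : ℕ → Profile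
  | 0 => ⟨1, 1, 1, 1, 1⟩
  | m + 1 => (profile n a c m).next n (a m) (c m)

theorem height_eq_profile {n : ℕ} (hn : 4 ≤ n) (a c : ℕ → ℕ) (m : ℕ) (j : Fin n) :
    height n a c m j = (profile n a c m).val n j := by
  induction m generalizing j with
  | zero => simp [height_zero, profile, Profile.val]
  | succ m ih =>
    rw [height_succ, vecMul_Theta hn]
    exact Profile.cycleCols_val _ hn _ _ _ (fun k hk => by
      rw [← ih ⟨k, hk⟩]; exact extendZero_val _ ⟨k, hk⟩) j.isLt

/-- The basic inequalities between the heights. -/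
theorem profile_bounds (h : Params n p a c) (m : ℕ) :
    let P := profile n a c m
    1 ≤ P.u ∧ P.u ≤ P.y ∧ P.u ≤ P.e ∧ P.u ≤ P.z ∧ P.e ≤ P.x ∧ P.z ≤ P.x ∧ P.y ≤ P.x := by
  induction m with
  | zero => simp [profile]
  | succ m ih =>
    obtain ⟨h1, h2, h3, h4, h5, h6, h7⟩ := ih
    have hB : (profile n a c m).u + (profile n a c m).y ≤ (profile n a c m).base n (c m) := by
      unfold Profile.base
      have := Nat.le_mul_of_pos_left ((profile n a c m).u + (profile n a c m).y) (h.c_pos m)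
      omega
    have hx := Nat.zero_le (a m * (profile n a c m).x)
    simp only [profile, Profile.next, add_mul, one_mul]
    refine ⟨by omega, hB, by omega, by omega, by omega, by omega, by omega⟩

theorem profile_base_le (h : Params n p a c) (m : ℕ) :
    let P := profile n a c m
    c m * (P.u + P.y) ≤ P.base n (c m) ∧ P.e ≤ P.base n (c m) ∧
      P.base n (c m) ≤ c m * P.u + (c m + 1) * P.y + n * P.x := by
  obtain ⟨h1, h2, h3, h4, h5, h6, h7⟩ := profile_bounds h m
  have hq : 1 ≤ numPairs n ∧ numPairs n + 1 ≤ n := by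
    have := h.four_le; unfold numPairs; omega
  have e1 : numPairs n * (profile n a c m).e ≤ numPairs n * (profile n a c m).x :=
    Nat.mul_le_mul_left _ h5
  have e2 : (numPairs n + 1) * (profile n a c m).x ≤ n * (profile n a c m).x :=
    Nat.mul_le_mul_right _ hq.2
  have e3 := Nat.le_mul_of_pos_left (profile n a c m).e hq.1
  rw [add_mul, one_mul] at e2
  have e4 : (if Even n then 0 else (profile n a c m).z) ≤ (profile n a c m).x := by
    split_ifs <;> omega
  simp only [Profile.base, mul_add, add_mul, one_mul]
  refine ⟨by omega, by omega, by omega⟩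

/-- Per cycle `x` grows by about `a = p c` and `y` by at least `c`, while `c` itself is multiplied
by `p²`. So `c y / x` gains about a factor `p`, of which only `2` is kept. -/
theorem two_pow_mul_x_le (h : Params n p a c) (m : ℕ) :
    2 ^ m * (profile n a c m).x ≤ c m * (profile n a c m).y := by
  induction m with
  | zero => simpa [profile] using h.c_pos 0
  | succ m ih =>
    obtain ⟨h1, h2, h3, h4, h5, h6, h7⟩ := profile_bounds h m
    obtain ⟨b1, b2, b3⟩ := profile_base_le h m
    have e1 := h.five_le
    have e2 := h.two_pow_le_c m
    have e3 := h.a_eq m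
    rw [h.c_succ]
    simp only [profile, Profile.next]
    set P := profile n a c m
    set B := P.base n (c m)
    have hB : c m * P.y ≤ B := le_trans (Nat.mul_le_mul_left _ (by omega)) b1
    have k1 : 2 ^ m * P.x ≤ B := ih.trans hB
    have k2 : 2 ^ (m + 1) * (B + P.e + (a m + 1) * P.x) ≤ 2 ^ (m + 1) * B + 2 * (a m + 2) * B := by
      calc 2 ^ (m + 1) * (B + P.e + (a m + 1) * P.x)
          ≤ 2 ^ (m + 1) * (B + P.x + (a m + 1) * P.x) := by gcongr
        _ = 2 ^ (m + 1) * B + 2 * (a m + 2) * (2 ^ m * P.x) := by ring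
        _ ≤ _ := by gcongr
    refine k2.trans ?_
    rw [← add_mul]
    apply Nat.mul_le_mul_right
    rw [e3]
    have : 5 * c m ≤ p * c m := Nat.mul_le_mul_right _ e1
    have h5 : 5 * (p * c m) ≤ p ^ 2 * c m := by
      rw [pow_two, mul_assoc]; exact Nat.mul_le_mul_right _ e1
    have : 2 ^ (m + 1) ≤ 2 * c m := by rw [pow_succ]; omega
    have := h.c_pos m
    omega

/-- The new `u` is the sum `u + y`, and the new `y` contains this sum `c` times. -/
theorem two_pow_mul_u_le (h : Params n p a c) (m : ℕ) :
    2 ^ m * (profile n a c m).u ≤ 2 * (profile n a c m).y := by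
  cases m with
  | zero => simp [profile]
  | succ m =>
    obtain ⟨b1, b2, b3⟩ := profile_base_le h m
    simp only [profile, Profile.next]
    calc 2 ^ (m + 1) * ((profile n a c m).u + (profile n a c m).y)
        = 2 * (2 ^ m * ((profile n a c m).u + (profile n a c m).y)) := by ring
      _ ≤ 2 * (c m * ((profile n a c m).u + (profile n a c m).y)) := by
        gcongr; exact h.two_pow_le_c m
      _ ≤ _ := by gcongr

theorem c_mul_u_le (h : Params n p a c) (m : ℕ) :
    c (m + 1) * (profile n a c (m + 1)).u ≤ p ^ 2 * (profile n a c (m + 1)).y := by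
  obtain ⟨b1, b2, b3⟩ := profile_base_le h m
  rw [h.c_succ, mul_assoc]
  exact Nat.mul_le_mul_left _ b1

/-- The new `x` is at least `a x`, whereas the new `y` is about `c y` once `c u` and `n x` are
controlled. The ratio `x / y` thus gains about `a / c = p`. The control of `c u` by `p² y` is
available only from stage one on, which is why two stages are treated separately. -/
theorem two_pow_mul_y_le (h : Params n p a c) (m : ℕ) :
    2 ^ m * (profile n a c m).y ≤ 2 * (profile n a c m).x := by
  induction m with
  | zero => simp [profile]
  | succ m ih =>
    cases m with
    | zero =>
      have := (profile_bounds h 1).2.2.2.2.2.2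
      simpa using this
    | succ m =>
      have hu := c_mul_u_le h m
      have hpc := h.pow_le_c (m + 1)
      generalize hk : m + 1 = k at *
      obtain ⟨b1, b2, b3⟩ := profile_base_le h k
      have e1 := h.five_le
      have e3 := h.a_eq k
      have hc2 : p ^ 2 ≤ c k :=
        le_trans (Nat.pow_le_pow_right (by omega) (by omega)) hpc
      -- Here `n ≤ p` is needed: the number of letters times `2 ^ k` must be absorbed by `c k`,
      -- which is at least `p ^ (2 * k)`.
      have hcn : 2 ^ k * n + 2 ≤ c k := by
        have f1 : 2 ^ k * 2 ≤ p ^ (2 * m + 1) := by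
          calc 2 ^ k * 2 = 4 * 2 ^ m := by rw [← hk]; ring
            _ ≤ 5 * 25 ^ m := Nat.mul_le_mul (by norm_num) (Nat.pow_le_pow_left (by norm_num) m)
            _ = 5 ^ (2 * m + 1) := by rw [pow_succ, pow_mul]; norm_num [mul_comm]
            _ ≤ _ := Nat.pow_le_pow_left e1 _
        have f2 : 2 ^ k * 2 * n ≤ p ^ (2 * m + 1) * p :=
          Nat.mul_le_mul f1 (by have := h.lt_p; omega)
        have f3 : p ^ (2 * m + 1) * p = p ^ (2 * k) := by rw [← hk, ← pow_succ]; congr 1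
        have f4 : 1 ≤ 2 ^ k := Nat.one_le_two_pow
        have f5 := h.four_le
        have : 2 ≤ 2 ^ k * n := by nlinarith
        rw [mul_right_comm] at f2
        omega
      simp only [profile, Profile.next]
      set P := profile n a c k
      set B := P.base n (c k)
      have k1 : B ≤ (p ^ 2 + c k + 1) * P.y + n * P.x := by
        calc B ≤ _ := b3
          _ ≤ p ^ 2 * P.y + (c k + 1) * P.y + n * P.x := by gcongr
          _ = _ := by ring
      calc 2 ^ (k + 1) * B ≤ 2 ^ (k + 1) * ((p ^ 2 + c k + 1) * P.y + n * P.x) := by gcongr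
        _ = 2 * (p ^ 2 + c k + 1) * (2 ^ k * P.y) + 2 * (2 ^ k * n) * P.x := by ring
        _ ≤ 2 * (p ^ 2 + c k + 1) * (2 * P.x) + 2 * (2 ^ k * n) * P.x := by gcongr
        _ = (4 * (p ^ 2 + c k + 1) + 2 * (2 ^ k * n)) * P.x := by ring
        _ ≤ (2 * a k) * P.x := by
          gcongr
          have : 5 * c k ≤ a k := by rw [e3]; exact Nat.mul_le_mul_right _ e1
          omega
        _ ≤ _ := by nlinarith

theorem x_succ_le (h : Params n p a c) (m : ℕ) :
    (profile n a c (m + 1)).x ≤ 6 * a m * (profile n a c m).x := by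
  obtain ⟨h1, h2, h3, h4, h5, h6, h7⟩ := profile_bounds h m
  obtain ⟨b1, b2, b3⟩ := profile_base_le h m
  have e1 := h.five_le
  have e2 := h.p_le_a m
  have e3 : 5 * c m ≤ a m := by rw [h.a_eq]; exact Nat.mul_le_mul_right _ e1
  have e4 := h.lt_p
  simp only [profile, Profile.next]
  set P := profile n a c m
  set B := P.base n (c m)
  calc B + P.e + (a m + 1) * P.x ≤ (c m * P.x + (c m + 1) * P.x + n * P.x) + P.x +
        (a m + 1) * P.x := by
        gcongr
        refine b3.trans ?_
        gcongr
        omega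
    _ = (2 * c m + n + a m + 3) * P.x := by ring
    _ ≤ _ := by gcongr; omega

/-- Each cycle multiplies `y` by at least `c i ≥ p ^ (2 * i)`, and `∑_{i < m} 2 i = m (m - 1)`. -/
theorem pow_le_y (h : Params n p a c) (m : ℕ) : p ^ (m * (m - 1)) ≤ (profile n a c m).y := by
  induction m with
  | zero => simp [profile]
  | succ m ih =>
    obtain ⟨b1, b2, b3⟩ := profile_base_le h m
    have e : (m + 1) * (m + 1 - 1) = 2 * m + m * (m - 1) := by
      cases m with
      | zero => rfl
      | succ m => simp only [Nat.add_sub_cancel]; ring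
    rw [e, pow_add]
    simp only [profile, Profile.next]
    refine le_trans ?_ b1
    exact Nat.mul_le_mul (h.pow_le_c m) (ih.trans (by omega))

theorem y_le_u_succ (m : ℕ) : (profile n a c m).y ≤ (profile n a c (m + 1)).u := by
  simp only [profile, Profile.next]; omega

/-- Three cycles make the least height exceed the largest: `x` enters the next `e`, that `e` enters
the next `y`, and that `y` enters the next `u`. -/
theorem x_le_u (h : Params n p a c) (m : ℕ) :
    (profile n a c m).x ≤ (profile n a c (m + 3)).u := by
  refine le_trans ?_ (y_le_u_succ (m + 2))
  refine le_trans ?_ (profile_base_le h (m + 1)).2.1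
  have := Nat.le_mul_of_pos_left (profile n a c m).x
    (lt_of_lt_of_le (by have := h.five_le; omega) (h.p_le_a m))
  simp only [profile, Profile.next]
  omega

theorem u_le_height (h : Params n p a c) (m : ℕ) (j : Fin n) :
    (profile n a c m).u ≤ height n a c m j := by
  obtain ⟨h1, h2, h3, h4, h5, h6, h7⟩ := profile_bounds h m
  rw [height_eq_profile h.four_le, Profile.val]
  split_ifs <;> omega

theorem height_le_x (h : Params n p a c) (m : ℕ) (j : Fin n) :
    height n a c m j ≤ (profile n a c m).x := by
  obtain ⟨h1, h2, h3, h4, h5, h6, h7⟩ := profile_bounds h m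
  rw [height_eq_profile h.four_le, Profile.val]
  split_ifs <;> omega

theorem Theta_apply {n : ℕ} (hn : 4 ≤ n) (a c : ℕ) (i j : Fin n) :
    Theta n a c i j = cycleCols n a c (extendZero (Pi.single i 1)) j := by
  rw [← vecMul_Theta hn, Matrix.single_one_vecMul]
  rfl

/-- The tower `j` at the next stage consists mainly of copies of the tower `j`. -/
theorem two_pow_mul_sub_le (h : Params n p a c) (m : ℕ) {j : Fin n} (hj : j ∈ indexSet n) :
    2 ^ m * height n a c (m + 1) j ≤
      2 ^ m * (Theta n (a m) (c m) j j * height n a c m j) + (n + 2) * height n a c (m + 1) j := by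
  obtain ⟨h1, h2, h3, h4, h5, h6, h7⟩ := profile_bounds h m
  obtain ⟨b1, b2, b3⟩ := profile_base_le h m
  have hn := h.four_le
  have hy := two_pow_mul_y_le h (m + 1)
  have hu := two_pow_mul_u_le h m
  have hx := two_pow_mul_x_le h m
  have hE : extendZero (Pi.single j 1 : Fin n → ℕ) j.val = 1 := by
    rw [extendZero_val, Pi.single_eq_same]
  have hjlt := j.isLt
  by_cases hjN : j.val = n - 1
  -- The last letter: `c + 1` copies of its own tower, and the rest, at most `c u + n x`, is
  -- negligible against `c y`.
  · have hT : c m + 1 ≤ Theta n (a m) (c m) j j := by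
      rw [Theta_apply hn, cycleCols, if_neg (by omega), if_neg (by omega), ← hjN, hE]
      refine le_trans ?_ (Nat.le_add_right _ _)
      rw [mul_add, mul_one]
      omega
    have e1 : height n a c m j = (profile n a c m).y := by
      rw [height_eq_profile hn, Profile.val, if_neg (by omega), if_pos hjN]
    have e2 : height n a c (m + 1) j = (profile n a c m).base n (c m) := by
      rw [height_eq_profile hn, Profile.val, if_neg (by omega), if_pos hjN]; rfl
    rw [e1, e2]
    set P := profile n a c m
    set B := P.base n (c m)
    have hcy : c m * P.y ≤ B := le_trans (Nat.mul_le_mul_left _ (by omega)) b1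
    calc 2 ^ m * B ≤ 2 ^ m * (c m * P.u + (c m + 1) * P.y + n * P.x) := by gcongr
      _ = 2 ^ m * ((c m + 1) * P.y) + (c m * (2 ^ m * P.u) + n * (2 ^ m * P.x)) := by ring
      _ ≤ 2 ^ m * (Theta n (a m) (c m) j j * P.y) + (c m * (2 * P.y) + n * (c m * P.y)) := by
        gcongr
      _ = 2 ^ m * (Theta n (a m) (c m) j j * P.y) + (n + 2) * (c m * P.y) := by ring
      _ ≤ _ := by gcongr
  · have hev : ¬ Odd j.val ∧ 2 ≤ j.val := by
      rcases hj with ⟨ho, h3, -⟩ | h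
      · rw [Nat.not_odd_iff_even]
        refine ⟨?_, by omega⟩
        rw [Nat.odd_add_one, Nat.not_odd_iff_even] at ho
        exact ho
      · omega
    -- The second letter of a pair: `a + 1` copies of its own tower, and the rest `B + e` is
    -- negligible against the new `x`.
    have hT : a m + 1 ≤ Theta n (a m) (c m) j j := by
      rw [Theta_apply hn, cycleCols, if_neg (by omega), if_neg (by omega), if_neg hjN,
        if_neg hev.1, hE]
      omega
    have e1 : height n a c m j = (profile n a c m).x := by
      rw [height_eq_profile hn, Profile.val, if_neg (by omega), if_neg hjN, if_neg hev.1]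
    have e2 : height n a c (m + 1) j = (profile n a c (m + 1)).x := by
      rw [height_eq_profile hn, Profile.val, if_neg (by omega), if_neg hjN, if_neg hev.1]
    have h2a : 2 ^ m ≤ a m :=
      (h.two_pow_le_c m).trans (by rw [h.a_eq]; exact Nat.le_mul_of_pos_left _ (by have := h.lt_p; omega))
    rw [e1, e2]
    simp only [profile, Profile.next] at hy ⊢
    set P := profile n a c m
    set B := P.base n (c m)
    set X := B + P.e + (a m + 1) * P.x with hX
    have k1 : 2 ^ m * B ≤ X := by rw [pow_succ] at hy; linarith
    have k2 : 2 ^ m * P.e ≤ X := by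
      calc 2 ^ m * P.e ≤ a m * P.x := Nat.mul_le_mul h2a h5
        _ ≤ X := by rw [hX, add_mul]; omega
    calc 2 ^ m * X = 2 ^ m * ((a m + 1) * P.x) + (2 ^ m * B + 2 ^ m * P.e) := by rw [hX]; ring
      _ ≤ 2 ^ m * (Theta n (a m) (c m) j j * P.x) + (X + X) := by gcongr
      _ ≤ _ := by gcongr; nlinarith

/-- Positivity of the product of three consecutive matrices. -/
theorem one_le_Theta_mul {n : ℕ} (hn : 4 ≤ n) {a₁ a₂ a₃ c₁ c₂ c₃ : ℕ} (ha₁ : 1 ≤ a₁)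
    (hc₁ : 1 ≤ c₁) (hc₂ : 1 ≤ c₂) (hc₃ : 1 ≤ c₃) (i j : Fin n) :
    1 ≤ (Theta n a₁ c₁ * Theta n a₂ c₂ * Theta n a₃ c₃) i j := by
  have hN : n - 1 < n := by omega
  -- A positive entry at the last letter becomes a positive row after one cycle, and a positive
  -- entry at an odd place reaches the last letter after one cycle.
  have last : ∀ {a c : ℕ} {V : Fin n → ℕ}, 1 ≤ c → 1 ≤ V ⟨n - 1, hN⟩ →
      ∀ j, 1 ≤ Matrix.vecMul V (Theta n a c) j := by
    intro a c V hc hV j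
    rw [vecMul_Theta hn]
    have e : extendZero V (n - 1) = V ⟨n - 1, hN⟩ := extendZero_val V ⟨n - 1, hN⟩
    have := j.isLt
    unfold cycleCols
    rw [e]
    split_ifs <;> omega
  have odd : ∀ {a c : ℕ} {V : Fin n → ℕ} (k : ℕ) (hk : k < n), Odd k → 1 ≤ V ⟨k, hk⟩ →
      1 ≤ Matrix.vecMul V (Theta n a c) ⟨n - 1, hN⟩ := by
    intro a c V k hk ho hV
    rw [vecMul_Theta hn]
    have e : extendZero V k = V ⟨k, hk⟩ := extendZero_val V ⟨k, hk⟩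
    rw [cycleCols, if_neg (by simp only; omega), if_neg (by simp only; omega)]
    by_cases hk' : k = n - 1
    · have e' : extendZero V (n - 1) = V ⟨k, hk⟩ := by rw [← e, hk']
      rw [e']; omega
    · obtain ⟨s, rfl⟩ := ho
      have := Finset.single_le_sum (f := fun s => extendZero V (2 * s + 1))
        (fun _ _ => Nat.zero_le _) (Finset.mem_range.2 (show s < (n - 1) / 2 by omega))
      simp only [e] at this
      omega
  have hrow : (Theta n a₁ c₁ * Theta n a₂ c₂ * Theta n a₃ c₃) i j =
      Matrix.vecMul (Matrix.vecMul (Matrix.vecMul (Pi.single i 1) (Theta n a₁ c₁))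
        (Theta n a₂ c₂)) (Theta n a₃ c₃) j := by
    rw [Matrix.vecMul_vecMul, Matrix.vecMul_vecMul, Matrix.single_one_vecMul, Matrix.mul_assoc]
    rfl
  rw [hrow]
  set V : Fin n → ℕ := Pi.single i 1
  have hE : V i = 1 := Pi.single_eq_same i 1
  have hlt := i.isLt
  by_cases hi0 : i.val = 0
  · have h1 : 1 ≤ Matrix.vecMul V (Theta n a₁ c₁) ⟨n - 1, hN⟩ := by
      rw [vecMul_Theta hn, cycleCols, if_neg (by simp only; omega), if_neg (by simp only; omega)]
      have e : extendZero V 0 = 1 := by rw [← hi0, extendZero_val, hE]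
      rw [e]
      have : 1 * 1 ≤ c₁ * (1 + extendZero V (n - 1)) := Nat.mul_le_mul hc₁ (by omega)
      omega
    exact last hc₃ (last hc₂ h1 _) j
  by_cases ho : Odd i.val
  · exact last hc₃ (last hc₂ (odd i.val hlt ho (by rw [← hE])) _) j
  by_cases hiN : i.val = n - 1
  · refine last hc₃ (last hc₂ (last hc₁ ?_ _) _) j
    rw [← show i = ⟨n - 1, hN⟩ from Fin.ext hiN, hE]
  -- The second letter of a pair is the longest way: one cycle to its partner, one to the last
  -- letter, one to all letters.
  · have h1 : 1 ≤ Matrix.vecMul V (Theta n a₁ c₁) ⟨i.val - 1, by omega⟩ := by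
      rw [vecMul_Theta hn, cycleCols]
      have ho' : Odd (i.val - 1) := by
        rw [Nat.not_odd_iff_even] at ho
        obtain ⟨m, hm⟩ := ho
        exact ⟨m - 1, by omega⟩
      have e : extendZero V (i.val - 1 + 1) = 1 := by
        rw [Nat.sub_add_cancel (by omega), extendZero_val, hE]
      have hne : i.val ≠ 1 := fun h => ho (by rw [h]; exact odd_one)
      rw [if_neg (by simp only; omega), if_neg (by simp only; omega),
        if_neg (by simp only; omega)]
      simp only
      rw [if_pos ho', if_pos (by omega), e]
      omega
    refine last hc₃ (odd (i.val - 1) (by omega) ?_ h1) j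
    rw [Nat.not_odd_iff_even] at ho
    obtain ⟨m, hm⟩ := ho
    exact ⟨m - 1, by omega⟩

/-- The normalized columns with index in `indexSet n` converge. -/
theorem exists_tendsto_normalizedColumn (h : Params n p a c) {j : Fin n} (hj : j ∈ indexSet n)
    (t : Fin n) : ∃ L, Tendsto (fun m => normalizedColumn n a c j m t) atTop (𝓝 L) := by
  have hbound : ∀ m, dist (normalizedColumn n a c j m t) (normalizedColumn n a c j (m + 1) t) ≤
      (n + 2 : ℝ) / 2 / 2 ^ m * 2 := by
    intro m
    set T := Theta n (a m) (c m)
    set θ : ℝ := (T j j : ℝ)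
    set v : ℝ := (height n a c m j : ℝ) with hv
    set v' : ℝ := (height n a c (m + 1) j : ℝ) with hv'
    set P : ℝ := (ThetaProd n a c m t j : ℝ)
    set P' : ℝ := (ThetaProd n a c (m + 1) t j : ℝ) with hP'
    have hpos : ∀ k, (0 : ℝ) < (height n a c k j : ℝ) := fun k => by
      have := (profile_bounds h k).1.trans (u_le_height h k j)
      exact_mod_cast this
    have hPs : (∑ s, (ThetaProd n a c m s j : ℝ)) = v := by
      rw [hv, height_eq_sum]; push_cast; rfl
    have hPs' : (∑ s, (ThetaProd n a c (m + 1) s j : ℝ)) = v' := by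
      rw [hv', height_eq_sum]; push_cast; rfl
    have hθv : θ * v ≤ v' := by
      have : T j j * height n a c m j ≤ height n a c (m + 1) j := by
        rw [height_succ, Matrix.vecMul, dotProduct, mul_comm]
        exact Finset.single_le_sum (f := fun i => height n a c m i * T i j)
          (fun _ _ => Nat.zero_le _) (Finset.mem_univ j)
      have := Nat.cast_le (α := ℝ).2 this
      push_cast at this
      exact this
    have hPle : P ≤ v := by
      rw [← hPs]
      exact Finset.single_le_sum (f := fun s => (ThetaProd n a c m s j : ℝ))
        (fun _ _ => Nat.cast_nonneg _) (Finset.mem_univ t)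
    have hP0 : 0 ≤ P := Nat.cast_nonneg _
    have hR0 : θ * P ≤ P' := by
      have : ThetaProd n a c m t j * T j j ≤ ThetaProd n a c (m + 1) t j := by
        rw [ThetaProd_succ, Matrix.mul_apply]
        exact Finset.single_le_sum (f := fun s => ThetaProd n a c m t s * T s j)
          (fun _ _ => Nat.zero_le _) (Finset.mem_univ j)
      rw [mul_comm]
      have := Nat.cast_le (α := ℝ).2 this
      push_cast at this
      exact this
    -- `P' - θ P` is the contribution of the columns other than `j`; it is nonnegative in each row,
    -- and its sum over the rows is `v' - θ v`.
    have hR1 : P' - θ * P ≤ v' - θ * v := by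
      have key : ∀ s, (ThetaProd n a c (m + 1) s j : ℝ) - θ * ThetaProd n a c m s j =
          ∑ i ∈ Finset.univ.erase j, (ThetaProd n a c m s i : ℝ) * T i j := by
        intro s
        rw [ThetaProd_succ, Matrix.mul_apply]
        push_cast
        rw [← Finset.add_sum_erase _ _ (Finset.mem_univ j)]
        ring
      rw [← hPs, ← hPs', Finset.mul_sum, ← Finset.sum_sub_distrib]
      refine Finset.single_le_sum
        (f := fun s => (ThetaProd n a c (m + 1) s j : ℝ) - θ * ThetaProd n a c m s j)
        (fun s _ => ?_) (Finset.mem_univ t)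
      rw [key s]
      exact Finset.sum_nonneg fun i _ => by positivity
    have hv0 : 0 < v := hpos m
    have hv0' : 0 < v' := hpos (m + 1)
    have hD : 2 ^ m * v' ≤ 2 ^ m * (θ * v) + (n + 2) * v' := by
      have := two_pow_mul_sub_le h m hj
      have := Nat.cast_le (α := ℝ).2 this
      push_cast at this
      exact this
    -- The multiple `θ` of the old column cancels in the difference of the quotients, so only the
    -- small remainders are left.
    have e : normalizedColumn n a c j m t - normalizedColumn n a c j (m + 1) t =
        (P * (v' - θ * v) - (P' - θ * P) * v) / (v * v') := by
      rw [normalizedColumn, normalizedColumn, hPs, hPs']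
      field_simp
      ring
    have hnum : |P * (v' - θ * v) - (P' - θ * P) * v| ≤ v * (v' - θ * v) := by
      have f1 : 0 ≤ P * (v' - θ * v) := mul_nonneg hP0 (by linarith)
      have f2 : P * (v' - θ * v) ≤ v * (v' - θ * v) :=
        mul_le_mul_of_nonneg_right hPle (by linarith)
      have f3 : 0 ≤ (P' - θ * P) * v := mul_nonneg (by linarith) hv0.le
      have f4 : (P' - θ * P) * v ≤ v * (v' - θ * v) := by
        rw [mul_comm]; exact mul_le_mul_of_nonneg_left hR1 hv0.le
      rw [abs_le]
      constructor <;> linarith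
    rw [Real.dist_eq, e, abs_div, abs_of_pos (mul_pos hv0 hv0'), div_le_iff₀ (by positivity)]
    refine hnum.trans ?_
    have h2 : (0 : ℝ) < 2 ^ m := by positivity
    have : v' - θ * v ≤ (n + 2) / 2 ^ m * v' := by
      rw [div_mul_eq_mul_div, le_div_iff₀ h2]
      linarith
    calc v * (v' - θ * v) ≤ v * ((n + 2) / 2 ^ m * v') := by gcongr
      _ = _ := by ring
  have hc := cauchySeq_of_le_geometric_two (C := (n + 2 : ℝ) * 2) (fun m => by
    refine (hbound m).trans (le_of_eq ?_)
    ring)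
  exact cauchySeq_tendsto_of_complete hc

end Heights

/-! ### Invariant measures and their distribution functions -/

section Map

variable {A : Type} [DecidableEq A] [Fintype A]

/-- An interval exchange of `[0,1)`. -/
structure IETData.IsUnit (S : IETData A) : Prop where
  valid : S.rows.IsValid
  len_pos : ∀ t, 0 < S.len t
  sum_len : ∑ t, S.len t = 1

variable {S : IETData A}

theorem IETData.IsUnit.exists_row (hS : S.IsUnit) {row : List A} (hn : row.Nodup)
    (hm : ∀ t, t ∈ row) {x : ℝ} (h0 : 0 ≤ x) (h1 : x < 1) :
    ∃ t, offset row S.len t ≤ x ∧ x < offset row S.len t + S.len t := by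
  obtain ⟨t, -, h⟩ := exists_mem_interval (len := S.len) hn h0
    (by rw [sum_map_eq hn hm, hS.sum_len]; exact h1)
  exact ⟨t, h⟩

theorem IETData.IsUnit.row_le (hS : S.IsUnit) {row : List A} (hn : row.Nodup)
    (hm : ∀ t, t ∈ row) (t : A) :
    0 ≤ offset row S.len t ∧ offset row S.len t + S.len t ≤ 1 := by
  refine ⟨offset_nonneg (fun s => (hS.len_pos s).le) t, ?_⟩
  have := offset_add_le (fun s => (hS.len_pos s).le) (hm t)
  rwa [sum_map_eq hn hm, hS.sum_len] at this

theorem IETData.IsUnit.row_unique (hS : S.IsUnit) {row : List A} (hm : ∀ t, t ∈ row) {s t : A}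
    {x : ℝ} (hs : offset row S.len s ≤ x ∧ x < offset row S.len s + S.len s)
    (ht : offset row S.len t ≤ x ∧ x < offset row S.len t + S.len t) : s = t := by
  by_contra hne
  rcases offset_disjoint (fun s => (hS.len_pos s).le) (hm s) (hm t) hne with h | h <;> linarith

theorem IETData.IsUnit.top_le (hS : S.IsUnit) (t : A) :
    0 ≤ topPos S t ∧ topPos S t + S.len t ≤ 1 :=
  hS.row_le hS.valid.nodup_top hS.valid.mem_top t

theorem IETData.IsUnit.bot_le (hS : S.IsUnit) (t : A) :
    0 ≤ botPos S t ∧ botPos S t + S.len t ≤ 1 :=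
  hS.row_le hS.valid.nodup_bot hS.valid.mem_bot t

omit [Fintype A] in
theorem topPos_add_disp (S : IETData A) (t : A) : topPos S t + disp S t = botPos S t := by
  rw [disp]; ring

theorem IETData.IsUnit.toFun_of_mem (hS : S.IsUnit) {t : A} {x : ℝ} (h : x ∈ S.interval t) :
    S.toFun x = x + disp S t := by
  rw [IETData.toFun, Finset.sum_eq_single t]
  · rw [Set.indicator_of_mem h]; rfl
  · intro s _ hs
    rw [Set.indicator_of_notMem]
    intro h'
    exact hs (hS.row_unique hS.valid.mem_top h' h)
  · simp

theorem IETData.IsUnit.toFun_of_notMem (hS : S.IsUnit) {x : ℝ} (h : x ∉ Set.Ico (0 : ℝ) 1) :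
    S.toFun x = x := by
  rw [IETData.toFun, Finset.sum_eq_zero, add_zero]
  intro t _
  rw [Set.indicator_of_notMem]
  intro h'
  have := hS.top_le t
  exact h ⟨this.1.trans h'.1, h'.2.trans_le this.2⟩

theorem IETData.measurable_toFun (S : IETData A) : Measurable S.toFun := by
  unfold IETData.toFun
  refine measurable_id.add (Finset.measurable_sum _ fun t _ => ?_)
  exact measurable_const.indicator measurableSet_Ico

/-- The image of a subinterval of an exchanged interval contains images of its points only. -/
theorem IETData.IsUnit.add_disp_mem_iff (hS : S.IsUnit) {s t : A} {u v z : ℝ}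
    (hu : topPos S t ≤ u) (hv : v ≤ topPos S t + S.len t)
    (hz : topPos S s ≤ z ∧ z < topPos S s + S.len s) :
    z + disp S s ∈ Set.Ico (u + disp S t) (v + disp S t) ↔ z ∈ Set.Ico u v := by
  have e := topPos_add_disp S s
  have e' := topPos_add_disp S t
  constructor
  · intro h
    have : s = t := hS.row_unique hS.valid.mem_bot (x := z + disp S s)
      ⟨by change botPos S s ≤ _; linarith, by change _ < botPos S s + _; linarith⟩
      ⟨by change botPos S t ≤ _; linarith [h.1], by change _ < botPos S t + _; linarith [h.2]⟩
    subst this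
    exact ⟨by linarith [h.1], by linarith [h.2]⟩
  · intro h
    have : s = t := hS.row_unique hS.valid.mem_top hz ⟨by linarith [h.1], by linarith [h.2]⟩
    subst this
    exact ⟨by linarith [h.1], by linarith [h.2]⟩

/-- The bottom intervals are disjoint, so no other exchanged interval reaches this set; points
outside `[0,1)` are fixed and stay outside. -/
theorem IETData.IsUnit.preimage_Ico (hS : S.IsUnit) {t : A} {u v : ℝ}
    (hu : topPos S t ≤ u) (hv : v ≤ topPos S t + S.len t) :
    S.toFun ⁻¹' Set.Ico (u + disp S t) (v + disp S t) = Set.Ico u v := by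
  have e := topPos_add_disp S t
  have hb := hS.bot_le t
  have ht := hS.top_le t
  ext z
  rw [Set.mem_preimage]
  by_cases hz : z ∈ Set.Ico (0 : ℝ) 1
  · obtain ⟨s, hs⟩ := hS.exists_row hS.valid.nodup_top hS.valid.mem_top hz.1 hz.2
    rw [hS.toFun_of_mem hs]
    exact hS.add_disp_mem_iff hu hv hs
  · rw [hS.toFun_of_notMem hz]
    constructor
    · intro h
      exact absurd ⟨by linarith [h.1], by linarith [h.2]⟩ hz
    · intro h
      exact absurd ⟨by linarith [h.1], by linarith [h.2]⟩ hz

/-- The distribution function of a measure. -/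
noncomputable def cdfOf (μ : Measure ℝ) (x : ℝ) : ℝ := μ.real (Set.Iio x)

theorem cdfOf_sub (μ : Measure ℝ) [IsProbabilityMeasure μ] {x y : ℝ} (h : x ≤ y) :
    cdfOf μ y - cdfOf μ x = μ.real (Set.Ico x y) := by
  rw [cdfOf, cdfOf, ← Set.Iio_union_Ico_eq_Iio h, measureReal_union _ measurableSet_Ico]
  · ring
  · rw [Set.disjoint_left]
    intro z hz hz'
    exact absurd hz'.1 (not_le.2 hz)

theorem cdfOf_of_Ico {μ : Measure ℝ} [IsProbabilityMeasure μ] (h : μ (Set.Ico 0 1) = 1) :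
    (∀ x ≤ 0, cdfOf μ x = 0) ∧ ∀ x, 1 ≤ x → cdfOf μ x = 1 := by
  have hc : μ (Set.Ico (0 : ℝ) 1)ᶜ = 0 := by
    rw [prob_compl_eq_zero_iff measurableSet_Ico]; exact h
  constructor
  · intro x hx
    rw [cdfOf, Measure.real, measure_mono_null _ hc]
    · simp
    · intro z hz hz'
      exact absurd hz'.1 (not_le.2 (lt_of_lt_of_le hz hx))
  · intro x hx
    rw [cdfOf, Measure.real]
    have : μ (Set.Iio x) = 1 := by
      refine le_antisymm prob_le_one ?_
      rw [← h]
      exact measure_mono fun z hz => lt_of_lt_of_le hz.2 hx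
    simp [this]

theorem invCDF_cdfOf (hS : S.IsUnit) {μ : Measure ℝ} [IsProbabilityMeasure μ]
    (h1 : μ (Set.Ico 0 1) = 1) (hT : MeasurePreserving S.toFun μ μ) : InvCDF S (cdfOf μ) := by
  refine ⟨?_, (cdfOf_of_Ico h1).1 0 le_rfl, (cdfOf_of_Ico h1).2 1 le_rfl, ?_⟩
  · intro x y hxy
    exact measureReal_mono (Set.Iio_subset_Iio hxy)
  · intro t u v hu huv hv
    rw [cdfOf_sub μ huv, cdfOf_sub μ (by linarith), Measure.real, Measure.real,
      ← hT.measure_preimage measurableSet_Ico.nullMeasurableSet, hS.preimage_Ico hu hv]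

theorem incr_cdfOf (hS : S.IsUnit) (μ : Measure ℝ) [IsProbabilityMeasure μ] (t : A) :
    incr (cdfOf μ) S t = μ.real (S.interval t) := by
  rw [incr, cdfOf_sub μ (by linarith [hS.len_pos t])]
  rfl

/-- A measure on `[0,1)` is the sum of its restrictions to the intervals of a row. -/
theorem IETData.IsUnit.measure_eq_sum (hS : S.IsUnit) {row : List A} (hn : row.Nodup)
    (hm : ∀ t, t ∈ row) {μ : Measure ℝ} (hμ : μ (Set.Ico (0 : ℝ) 1)ᶜ = 0) {B : Set ℝ}
    (hB : MeasurableSet B) :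
    μ B = ∑ t, μ (Set.Ico (offset row S.len t) (offset row S.len t + S.len t) ∩ B) := by
  rw [← measure_biUnion_finset]
  · apply le_antisymm
    · refine (measure_mono (t := (⋃ t ∈ Finset.univ, Set.Ico (offset row S.len t)
        (offset row S.len t + S.len t) ∩ B) ∪ (Set.Ico (0 : ℝ) 1)ᶜ) ?_).trans
        ((measure_union_le _ _).trans (by rw [hμ, add_zero]))
      intro x hx
      by_cases h : x ∈ Set.Ico (0 : ℝ) 1
      · obtain ⟨t, ht⟩ := hS.exists_row hn hm h.1 h.2
        exact Or.inl (Set.mem_biUnion (Finset.mem_univ t) ⟨ht, hx⟩)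
      · exact Or.inr h
    · exact measure_mono (Set.iUnion₂_subset fun t _ => Set.inter_subset_right)
  · intro s _ t _ hst
    rw [Function.onFun, Set.disjoint_left]
    intro x hs ht
    exact hst (hS.row_unique hm hs.1 ht.1)
  · exact fun t _ => measurableSet_Ico.inter hB

theorem incr_sum (hS : S.IsUnit) {F : ℝ → ℝ} (hF : InvCDF S F) : ∑ t, incr F S t = 1 := by
  have := sum_increments (len := S.len) hS.valid.nodup_top F 0
  simp only [zero_add] at this
  rw [sum_map_eq hS.valid.nodup_top hS.valid.mem_top,
    sum_map_eq hS.valid.nodup_top hS.valid.mem_top, hS.sum_len, hF.one, hF.zero, sub_zero] at this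
  exact this

end Map

/-! ### Comparing two invariant functions through the floors -/

section Floors

variable {A : Type} [DecidableEq A] {S₀ S : IETData A} {W : A → List A} {F G : ℝ → ℝ}

/-- If the `G`-length of an interval is smaller than that of all floors, the interval meets at
most two floors, and its `F`-length is bounded accordingly. -/
theorem Tower.sub_le_of_sub_lt (hT : Tower S₀ S W) (hF : InvCDF S₀ F) (hG : InvCDF S₀ G) {M : ℝ}
    (hM : ∀ t, incr F S t ≤ M) {x y : ℝ} (h0 : 0 ≤ x) (hxy : x < y) (h1 : y ≤ 1)
    (hxyG : ∀ t, G y - G x < incr G S t) : F y - F x ≤ 2 * M := by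
  obtain ⟨j, p, hp, hpx, hxp⟩ := hT.cover x h0 (by linarith)
  have hfl := hF.floor hT j hp
  have hMj := hM j
  have hM0 : 0 ≤ M := by
    refine le_trans ?_ hMj
    rw [← hfl]
    linarith [hF.mono (show p ≤ p + S.len j by linarith [hT.len_pos j])]
  have hFp := hF.mono hpx
  by_cases hy : y ≤ p + S.len j
  · linarith [hF.mono hy]
  push Not at hy
  rcases hT.right_end j p hp with h | ⟨j', hj'⟩
  · linarith
  have hfl' := hF.floor hT j' hj'
  have hflG := hG.floor hT j' hj'
  by_cases hy' : y ≤ p + S.len j + S.len j'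
  · linarith [hF.mono hy', hM j']
  · push Not at hy'
    -- Otherwise the whole second floor would lie between `x` and `y`.
    exfalso
    linarith [hG.mono hy'.le, hG.mono hxp.le, hxyG j']

theorem Tower.exists_floor (hT : Tower S₀ S W) (hF : InvCDF S₀ F) {x : ℝ} (h0 : 0 ≤ x)
    (h1 : x < 1) : ∃ j, ∃ p ∈ points S₀ (topPos S j) (W j), p ≤ x ∧ x < p + S.len j ∧
      F x - F p ≤ incr F S j := by
  obtain ⟨j, p, hp, hpx, hxp⟩ := hT.cover x h0 h1
  exact ⟨j, p, hp, hpx, hxp, by linarith [hF.floor hT j hp, hF.mono hxp.le]⟩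

end Floors

/-! ### Construction of an invariant measure from the towers -/

section Construction

variable {A : Type} [DecidableEq A] [Fintype A] {S : IETData A}

/-- The number of the points to the left of `x`. -/
noncomputable def countLT (L : List ℝ) (x : ℝ) : ℝ :=
  (L.map ((Set.Iio x).indicator fun _ => (1 : ℝ))).sum

theorem sum_map_indicator_nonneg (L : List ℝ) (B : Set ℝ) :
    0 ≤ (L.map (B.indicator fun _ => (1 : ℝ))).sum := by
  apply List.sum_nonneg
  intro x hx
  obtain ⟨p, -, rfl⟩ := List.mem_map.1 hx
  exact Set.indicator_nonneg (fun _ _ => zero_le_one) p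

theorem countLT_sub (L : List ℝ) {x y : ℝ} (h : x ≤ y) :
    countLT L y - countLT L x = (L.map ((Set.Ico x y).indicator fun _ => (1 : ℝ))).sum := by
  induction L with
  | nil => simp [countLT]
  | cons p L ih =>
    simp only [countLT, List.map_cons, List.sum_cons] at ih ⊢
    rw [← ih]
    simp only [Set.indicator, Set.mem_Iio, Set.mem_Ico]
    split_ifs <;> first | (exfalso; grind) | ring

theorem countLT_le_length (L : List ℝ) (x : ℝ) : countLT L x ≤ L.length := by
  induction L with
  | nil => simp [countLT]
  | cons p L ih =>
    simp only [countLT, List.map_cons, List.sum_cons, List.length_cons, Nat.cast_add,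
      Nat.cast_one] at ih ⊢
    have : (Set.Iio x).indicator (fun _ => (1 : ℝ)) p ≤ 1 :=
      Set.indicator_le_self' (fun _ _ => zero_le_one) p
    linarith

theorem countLT_eq_zero {L : List ℝ} {x : ℝ} (h : ∀ p ∈ L, x ≤ p) : countLT L x = 0 := by
  rw [countLT]
  apply List.sum_eq_zero
  intro y hy
  obtain ⟨p, hp, rfl⟩ := List.mem_map.1 hy
  rw [Set.indicator_of_notMem]
  simpa using h p hp

theorem countLT_eq_length {L : List ℝ} {x : ℝ} (h : ∀ p ∈ L, p < x) :
    countLT L x = L.length := by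
  induction L with
  | nil => simp [countLT]
  | cons p L ih =>
    have h1 := ih fun q hq => h q (by simp [hq])
    simp only [countLT, List.map_cons, List.sum_cons, List.length_cons, Nat.cast_add,
      Nat.cast_one] at h1 ⊢
    rw [h1, Set.indicator_of_mem (show p ∈ Set.Iio x from h p (by simp)), add_comm]

theorem Orbit.mem_Ico (hS : S.IsUnit) {ℓ x y : ℝ} (hℓ : 0 < ℓ) {W : List A}
    (h : Orbit S ℓ x W y) : ∀ p ∈ points S x W, 0 ≤ p ∧ p < 1 := by
  induction W generalizing x with
  | nil => simp [points]
  | cons t W ih =>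
    intro p hp
    rw [points, List.mem_cons] at hp
    rcases hp with rfl | hp
    · have := hS.top_le t
      exact ⟨this.1.trans h.1, by linarith [h.2.1]⟩
    · exact ih h.2.2 p hp

/-- Counting the visits of an orbit segment to an exchanged interval. -/
theorem Orbit.sum_interval (hS : S.IsUnit) {ℓ x y : ℝ} (hℓ : 0 < ℓ) {W : List A}
    (h : Orbit S ℓ x W y) (t : A) :
    ((points S x W).map ((Set.Ico (topPos S t) (topPos S t + S.len t)).indicator
      fun _ => (1 : ℝ))).sum = W.count t := by
  induction W generalizing x with
  | nil => simp [points]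
  | cons s W ih =>
    rw [points, List.map_cons, List.sum_cons, ih h.2.2, List.count_cons]
    have hx : topPos S s ≤ x ∧ x < topPos S s + S.len s := ⟨h.1, by linarith [h.2.1]⟩
    by_cases hst : s = t
    · subst hst
      rw [Set.indicator_of_mem (show x ∈ Set.Ico _ _ from hx)]
      simp [add_comm]
    · rw [Set.indicator_of_notMem]
      · simp [hst]
      · intro h'
        exact hst (hS.row_unique hS.valid.mem_top hx h')

/-- Visits of an orbit segment to an interval and to its image. -/
theorem Orbit.sum_image (hS : S.IsUnit) {ℓ x y : ℝ} (hℓ : 0 < ℓ) {W : List A}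
    (h : Orbit S ℓ x W y) {t : A} {u v : ℝ} (hu : topPos S t ≤ u)
    (hv : v ≤ topPos S t + S.len t) :
    ((points S x W).map ((Set.Ico u v).indicator fun _ => (1 : ℝ))).sum +
        (Set.Ico (u + disp S t) (v + disp S t)).indicator (fun _ => 1) x =
      ((points S x W).map ((Set.Ico (u + disp S t) (v + disp S t)).indicator
        fun _ => (1 : ℝ))).sum +
        (Set.Ico (u + disp S t) (v + disp S t)).indicator (fun _ => 1) y := by
  induction W generalizing x with
  | nil => cases h; simp [points]
  | cons s W ih =>
    have h1 := ih h.2.2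
    rw [points, List.map_cons, List.sum_cons, List.map_cons, List.sum_cons]
    have h2 : (Set.Ico (u + disp S t) (v + disp S t)).indicator (fun _ => (1 : ℝ))
        (x + disp S s) = (Set.Ico u v).indicator (fun _ => 1) x := by
      have := hS.add_disp_mem_iff (s := s) hu hv (z := x) ⟨h.1, by linarith [h.2.1]⟩
      simp only [Set.indicator, this]
    rw [h2] at h1
    linarith

/-- An invariant distribution function is obtained from the visits of the orbits that go up the
towers `j`. -/
theorem exists_invCDF (hS : S.IsUnit) {U : ℕ → IETData A} {W : ℕ → A → List A}
    (hT : ∀ k, Tower S (U k) (W k)) (j : A)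
    (hlen : Tendsto (fun k => ((W k j).length : ℝ)) atTop atTop) {L : A → ℝ}
    (hL : ∀ t, Tendsto (fun k => ((W k j).count t : ℝ) / (W k j).length) atTop (𝓝 (L t))) :
    ∃ F, InvCDF S F ∧ (∀ x ≤ 0, F x = 0) ∧ (∀ x, 1 ≤ x → F x = 1) ∧ ∀ t, incr F S t = L t := by
  set Q : ℕ → List ℝ := fun k => points S (topPos (U k) j) (W k j) with hQ
  set h : ℕ → ℝ := fun k => ((W k j).length : ℝ) with hh
  have hQlen : ∀ k, ((Q k).length : ℝ) = h k := fun k => by rw [hQ, hh]; simp only [length_points]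
  have hpos : ∀ k, 0 < h k := fun k => by
    have := List.length_pos_iff.2 ((hT k).ne_nil j)
    exact Nat.cast_pos.2 this
  have hmem : ∀ k, ∀ p ∈ Q k, 0 ≤ p ∧ p < 1 := fun k =>
    ((hT k).orbit j).mem_Ico hS ((hT k).len_pos j)
  set f : ℝ → ℕ → ℝ := fun x k => countLT (Q k) x / h k with hf
  have hIcc : ∀ x k, f x k ∈ Set.Icc (0 : ℝ) 1 := by
    intro x k
    refine ⟨div_nonneg (sum_map_indicator_nonneg _ _) (hpos k).le, ?_⟩
    rw [hf]
    simp only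
    rw [div_le_one (hpos k), ← hQlen]
    exact countLT_le_length _ _
  -- Frequencies of visits are known to converge only for the exchanged intervals. A limit along an
  -- ultrafilter provides a value at every point; uniqueness is settled separately.
  set 𝒰 : Ultrafilter ℕ := hyperfilter ℕ
  have h𝒰 : (𝒰 : Filter ℕ) ≤ atTop := by
    rw [← Nat.cofinite_eq_atTop]; exact hyperfilter_le_cofinite
  have hlim : ∀ x, ∃ y, Tendsto (f x) 𝒰 (𝓝 y) := by
    intro x
    obtain ⟨y, -, hy⟩ := (isCompact_Icc (a := (0 : ℝ)) (b := 1)).ultrafilter_le_nhds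
      (𝒰.map (f x)) (by
        rw [le_principal_iff]
        exact Filter.mem_map.2 (Filter.univ_mem' (hIcc x)))
    exact ⟨y, hy⟩
  choose F hF using hlim
  have hsub : ∀ x y, x ≤ y → ∀ k, f y k - f x k =
      ((Q k).map ((Set.Ico x y).indicator fun _ => (1 : ℝ))).sum / h k := by
    intro x y hxy k
    rw [← countLT_sub _ hxy, hf]
    simp only
    rw [sub_div]
  have hzero : ∀ x ≤ 0, F x = 0 := by
    intro x hx
    refine tendsto_nhds_unique (hF x) ?_
    have : f x = fun _ => 0 := by
      ext k
      simp only [hf]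
      rw [countLT_eq_zero fun p hp => hx.trans (hmem k p hp).1, zero_div]
    rw [this]
    exact tendsto_const_nhds
  have hone : ∀ x, 1 ≤ x → F x = 1 := by
    intro x hx
    refine tendsto_nhds_unique (hF x) ?_
    have : f x = fun _ => 1 := by
      ext k
      simp only [hf]
      rw [countLT_eq_length fun p hp => lt_of_lt_of_le (hmem k p hp).2 hx, hQlen,
        div_self (hpos k).ne']
    rw [this]
    exact tendsto_const_nhds
  refine ⟨F, ⟨?_, hzero 0 le_rfl, hone 1 le_rfl, ?_⟩, hzero, hone, ?_⟩
  · intro x y hxy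
    refine le_of_tendsto_of_tendsto' (hF x) (hF y) fun k => ?_
    rw [← sub_nonneg, hsub x y hxy]
    exact div_nonneg (sum_map_indicator_nonneg _ _) (hpos k).le
  · intro t u v hu huv hv
    have h1 := ((hF (v + disp S t)).sub (hF (u + disp S t))).sub ((hF v).sub (hF u))
    -- An orbit segment visits an interval and its image equally often up to its two ends, so the
    -- defect of invariance is at most one over the number of floors.
    have h2 : Tendsto (fun k => f (v + disp S t) k - f (u + disp S t) k - (f v k - f u k)) 𝒰
        (𝓝 0) := by
      rw [tendsto_zero_iff_abs_tendsto_zero]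
      refine squeeze_zero (fun k => abs_nonneg _) (g := fun k => (h k)⁻¹) (fun k => ?_)
        (hlen.inv_tendsto_atTop.mono_left h𝒰)
      have := ((hT k).orbit j).sum_image hS ((hT k).len_pos j) hu hv
      simp only [Function.comp_apply]
      rw [hsub _ _ huv, hsub _ _ (by linarith), ← sub_div, abs_div, abs_of_pos (hpos k),
        div_eq_mul_inv]
      refine mul_le_of_le_one_left (inv_nonneg.2 (hpos k).le) ?_
      have b : ∀ z, 0 ≤ (Set.Ico (u + disp S t) (v + disp S t)).indicator (fun _ => (1 : ℝ)) z ∧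
          (Set.Ico (u + disp S t) (v + disp S t)).indicator (fun _ => (1 : ℝ)) z ≤ 1 := fun z =>
        ⟨Set.indicator_nonneg (fun _ _ => zero_le_one) z,
          Set.indicator_le_self' (fun _ _ => zero_le_one) z⟩
      have b1 := b (topPos (U k) j)
      have b2 := b (botPos (U k) j)
      rw [abs_le]
      constructor <;> linarith
    have := tendsto_nhds_unique h1 h2
    linarith
  · intro t
    refine tendsto_nhds_unique ((hF _).sub (hF _)) ?_
    refine ((hL t).mono_left h𝒰).congr fun k => ?_
    rw [hsub _ _ (by linarith [hS.len_pos t]),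
      ((hT k).orbit j).sum_interval hS ((hT k).len_pos j)]

/-- A continuous invariant distribution function comes from an invariant measure. -/
theorem InvCDF.exists_measure (hS : S.IsUnit) {F : ℝ → ℝ} (hF : InvCDF S F)
    (h0 : ∀ x ≤ 0, F x = 0) (h1 : ∀ x, 1 ≤ x → F x = 1) (hc : Continuous F) :
    ∃ μ : Measure ℝ, IsProbabilityMeasure μ ∧ μ (Set.Ico 0 1) = 1 ∧
      MeasurePreserving S.toFun μ μ ∧ ∀ t, μ.real (S.interval t) = incr F S t := by
  set f : StieltjesFunction ℝ := ⟨F, hF.mono, fun x => hc.continuousWithinAt⟩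
  have hleft : ∀ x, Function.leftLim f x = F x := fun x =>
    (hc.continuousWithinAt).leftLim_eq
  have hIco : ∀ x y, f.measure (Set.Ico x y) = ENNReal.ofReal (F y - F x) := by
    intro x y
    rw [StieltjesFunction.measure_Ico, hleft, hleft]
  have hbot : Tendsto F atBot (𝓝 0) :=
    tendsto_const_nhds.congr' ((eventually_le_atBot 0).mono fun x hx => (h0 x hx).symm)
  have htop : Tendsto F atTop (𝓝 1) :=
    tendsto_const_nhds.congr' ((eventually_ge_atTop 1).mono fun x hx => (h1 x hx).symm)
  have hprob : IsProbabilityMeasure f.measure := f.isProbabilityMeasure hbot htop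
  have hI : f.measure (Set.Ico 0 1) = 1 := by rw [hIco, hF.one, hF.zero]; simp
  have hcompl : f.measure (Set.Ico (0 : ℝ) 1)ᶜ = 0 := by
    rw [prob_compl_eq_zero_iff measurableSet_Ico]; exact hI
  refine ⟨f.measure, hprob, hI, ⟨S.measurable_toFun, ?_⟩, ?_⟩
  · have := Measure.isProbabilityMeasure_map (μ := f.measure) S.measurable_toFun.aemeasurable
    refine Measure.ext_of_Ico _ _ fun a b hab => ?_
    -- The preimage is cut along the top row and the interval itself along the bottom row; the
    -- pieces with the same letter are translates.
    rw [Measure.map_apply S.measurable_toFun measurableSet_Ico,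
      hS.measure_eq_sum hS.valid.nodup_top hS.valid.mem_top hcompl
        (S.measurable_toFun measurableSet_Ico),
      hS.measure_eq_sum hS.valid.nodup_bot hS.valid.mem_bot hcompl measurableSet_Ico]
    refine Finset.sum_congr rfl fun t _ => ?_
    have e := topPos_add_disp S t
    have e1 : Set.Ico (topPos S t) (topPos S t + S.len t) ∩ S.toFun ⁻¹' Set.Ico a b =
        Set.Ico (max (topPos S t) (a - disp S t))
          (min (topPos S t + S.len t) (b - disp S t)) := by
      ext z
      simp only [Set.mem_inter_iff, Set.mem_preimage, Set.mem_Ico, max_le_iff, lt_min_iff]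
      constructor
      · rintro ⟨hz, hz'⟩
        rw [hS.toFun_of_mem hz] at hz'
        exact ⟨⟨hz.1, by linarith⟩, hz.2, by linarith⟩
      · rintro ⟨⟨h2, h3⟩, h4, h5⟩
        refine ⟨⟨h2, h4⟩, ?_⟩
        rw [hS.toFun_of_mem ⟨h2, h4⟩]
        exact ⟨by linarith, by linarith⟩
    have e2 : Set.Ico (botPos S t) (botPos S t + S.len t) ∩ Set.Ico a b =
        Set.Ico (max (topPos S t) (a - disp S t) + disp S t)
          (min (topPos S t + S.len t) (b - disp S t) + disp S t) := by
      rw [Set.Ico_inter_Ico, ← e, ← max_add_add_right, ← min_add_add_right, sub_add_cancel,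
        sub_add_cancel, add_right_comm]
    change f.measure (Set.Ico (topPos S t) (topPos S t + S.len t) ∩ S.toFun ⁻¹' Set.Ico a b) =
      f.measure (Set.Ico (botPos S t) (botPos S t + S.len t) ∩ Set.Ico a b)
    rw [e1, e2]
    rcases le_total (max (topPos S t) (a - disp S t))
      (min (topPos S t + S.len t) (b - disp S t)) with h | h
    · rw [hIco, hIco, hF.inv t _ _ (le_max_left _ _) h (min_le_left _ _)]
    · rw [Set.Ico_eq_empty (not_lt.2 h), Set.Ico_eq_empty (not_lt.2 (by linarith))]
  · intro t
    rw [Measure.real, IETData.interval, hIco, ENNReal.toReal_ofReal]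
    · rfl
    · rw [sub_nonneg]
      exact hF.mono (by linarith [hS.len_pos t])

end Construction

/-! ### Estimates for the floors; existence and uniqueness of the limit measures -/

section Sequence

theorem map_offset_eq {A : Type} [DecidableEq A] {S : IETData A} (hn : S.rows.top.Nodup)
    (hm : ∀ t, t ∈ S.rows.top) {F G : ℝ → ℝ} (hF : F 0 = 0) (hG : G 0 = 0)
    (h : ∀ t, incr F S t = incr G S t) (t : A) : F (topPos S t) = G (topPos S t) := by
  obtain ⟨p, q, e, hp⟩ := List.eq_append_cons_of_mem (hm t)
  have hpn : p.Nodup := by rw [e] at hn; exact hn.of_append_left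
  have key : ∀ H : ℝ → ℝ, H 0 = 0 →
      (p.map fun s => incr H S s).sum = H (topPos S t) := by
    intro H hH
    have := sum_increments (len := S.len) hpn H 0
    simp only [zero_add, hH, sub_zero] at this
    rw [topPos, e, offset_append_cons hp, ← this]
    congr 1
    apply List.map_congr_left
    intro s hs
    rw [incr, topPos, e, offset_append_left hs]
  rw [← key F hF, ← key G hG]
  simp only [h]

variable {n p : ℕ} {a c : ℕ → ℕ}

/-- A sequence of towers over the stages of the Rauzy induction that are labelled by the initial
permutation. -/
structure TowerSeq (n : ℕ) (a c : ℕ → ℕ) (S : IETData (Fin n)) (U : ℕ → IETData (Fin n))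
    (W : ℕ → Fin n → List (Fin n)) : Prop where
  isUnit : S.IsUnit
  tower : ∀ k, Tower S (U k) (W k)
  count : ∀ k, countMatrix (W k) = ThetaProd n a c k
  incr_zero : ∀ F t, incr F (U 0) t = incr F S t
  incr_eq : ∀ F, InvCDF S F → ∀ k t,
    incr F (U k) t = ∑ s, (Theta n (a k) (c k) t s : ℝ) * incr F (U (k + 1)) s
  agree : ∀ F G, InvCDF S F → InvCDF S G → (∀ t, incr F S t = incr G S t) →
    ∀ k, AgreeAt S F G (U k) (W k)

theorem exists_towerSeq (hn : 4 ≤ n) {α : Fin n → ℝ} (hα : ∀ t, 0 < α t) (hα1 : ∑ t, α t = 1)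
    (hgen : IsGeneratedBy n a c ⟨initialRows n, α⟩) :
    ∃ U W, TowerSeq n a c ⟨initialRows n, α⟩ U W := by
  set S : IETData (Fin n) := ⟨initialRows n, α⟩
  obtain ⟨U, hU0, hU⟩ := hgen
  have hS : S.IsUnit := ⟨initialRows_isValid hn, hα, hα1⟩
  have key : ∀ k, ∃ W, Tower S (U k) W ∧ countMatrix W = ThetaProd n a c k ∧
      (U k).rows = initialRows n ∧
      ∀ F G, InvCDF S F → InvCDF S G → (∀ t, incr F S t = incr G S t) →
        AgreeAt S F G (U k) W := by
    intro k
    induction k with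
    | zero =>
      rw [hU0]
      refine ⟨fun j => [j], Tower.refl hS.valid hα hα1, ?_, rfl, fun F G hF hG h => ⟨h, ?_⟩⟩
      · ext t j
        by_cases htj : t = j
        · subst htj; simp [countMatrix, ThetaProd]
        · simp [countMatrix, ThetaProd, htj, Ne.symm htj]
      · intro j q hq
        rw [points, points, List.mem_singleton] at hq
        subst hq
        exact map_offset_eq hS.valid.nodup_top hS.valid.mem_top hF.zero hG.zero h j
    | succ k ih =>
      obtain ⟨W, h1, h2, h3, h4⟩ := ih
      obtain ⟨W', g1, g2, -, g4, g5⟩ := exists_tower_of_follows (hU k) h1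
      refine ⟨W', g1, ?_, ?_, fun F G hF hG h => g4 F G hF hG (h4 F G hF hG h)⟩
      · rw [g2, h2, h3, ThetaProd_succ]; rfl
      · rw [g5, h3, moves_cycle hn]
  choose W hW using key
  refine ⟨U, W, hS, fun k => (hW k).1, fun k => (hW k).2.1, fun F t => by rw [hU0], ?_,
    fun F G hF hG h k => (hW k).2.2.2 F G hF hG h⟩
  intro F hF k t
  obtain ⟨W', -, -, g3, -, -⟩ := exists_tower_of_follows (hU k) (hW k).1
  rw [g3 F hF t, (hW k).2.2.1]
  rfl

variable {S : IETData (Fin n)} {U : ℕ → IETData (Fin n)} {W : ℕ → Fin n → List (Fin n)}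
  {F G : ℝ → ℝ}

theorem InvCDF.incr_nonneg {A : Type} [DecidableEq A] {S₀ S : IETData A} {W : A → List A}
    {F : ℝ → ℝ} (hF : InvCDF S₀ F) (hT : Tower S₀ S W) (t : A) : 0 ≤ incr F S t :=
  sub_nonneg.2 (hF.mono (by linarith [hT.len_pos t]))

/-- The pairing of heights and increments does not depend on the stage: `Θ` acts on the heights from
the right and relates the increments from the left. At stage zero it is the total mass. -/
theorem TowerSeq.sum_height (hT : TowerSeq n a c S U W) (hF : InvCDF S F) (k : ℕ) :
    ∑ t, (height n a c k t : ℝ) * incr F (U k) t = 1 := by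
  induction k with
  | zero =>
    simp only [height_zero, Nat.cast_one, one_mul, hT.incr_zero]
    exact incr_sum hT.isUnit hF
  | succ k ih =>
    rw [← ih]
    simp only [hT.incr_eq F hF k, Finset.mul_sum]
    rw [Finset.sum_comm]
    apply Finset.sum_congr rfl
    intro s _
    rw [height_succ, Matrix.vecMul, dotProduct]
    push_cast
    rw [Finset.sum_mul]
    apply Finset.sum_congr rfl
    intro t _
    ring

/-- The least height of a tower, as a real number. -/
noncomputable def minHeight (n : ℕ) (a c : ℕ → ℕ) (k : ℕ) : ℝ := ((profile n a c k).u : ℝ)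

/-- The largest height of a tower, as a real number. -/
noncomputable def maxHeight (n : ℕ) (a c : ℕ → ℕ) (k : ℕ) : ℝ := ((profile n a c k).x : ℝ)

theorem minHeight_pos (h : Params n p a c) (k : ℕ) : 0 < minHeight n a c k :=
  Nat.cast_pos.2 (profile_bounds h k).1

theorem maxHeight_pos (h : Params n p a c) (k : ℕ) : 0 < maxHeight n a c k := by
  obtain ⟨h1, h2, h3, h4, h5, h6, h7⟩ := profile_bounds h k
  exact Nat.cast_pos.2 (by omega)

theorem pow_le_minHeight (h : Params n p a c) (k : ℕ) :
    (p : ℝ) ^ (k * (k - 1)) ≤ minHeight n a c (k + 1) := by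
  have := (pow_le_y h k).trans (y_le_u_succ k)
  rw [minHeight]
  exact_mod_cast this

theorem tendsto_minHeight (h : Params n p a c) :
    Tendsto (minHeight n a c) atTop atTop := by
  rw [← tendsto_add_atTop_iff_nat 1]
  refine tendsto_atTop_mono (f := fun k : ℕ => (k : ℝ) - 1) (fun k => ?_)
    (tendsto_atTop_add_const_right _ _ tendsto_natCast_atTop_atTop)
  refine le_trans ?_ (pow_le_minHeight h k)
  have h1 : k ≤ p ^ (k * (k - 1)) + 1 := by
    have h2 : k * (k - 1) < p ^ (k * (k - 1)) :=
      Nat.lt_pow_self (by have := h.five_le; omega)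
    rcases k with _ | _ | k
    · omega
    · omega
    · have : k + 1 + 1 ≤ (k + 1 + 1) * (k + 1 + 1 - 1) := Nat.le_mul_of_pos_right _ (by omega)
      omega
  have : (k : ℝ) ≤ (p : ℝ) ^ (k * (k - 1)) + 1 := by exact_mod_cast h1
  linarith

/-- A single term of the identity `sum_height`, with its height replaced by the least one. -/
theorem TowerSeq.incr_le (hT : TowerSeq n a c S U W) (h : Params n p a c) (hF : InvCDF S F)
    (k : ℕ) (t : Fin n) : incr F (U k) t ≤ (minHeight n a c k)⁻¹ := by
  have h0 := fun t => hF.incr_nonneg (hT.tower k) t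
  have h1 : minHeight n a c k * incr F (U k) t ≤ 1 := by
    rw [← hT.sum_height hF k]
    refine le_trans ?_ (Finset.single_le_sum
      (f := fun t => (height n a c k t : ℝ) * incr F (U k) t)
      (fun s _ => mul_nonneg (Nat.cast_nonneg _) (h0 s)) (Finset.mem_univ t))
    exact mul_le_mul_of_nonneg_right (Nat.cast_le.2 (u_le_height h k t)) (h0 t)
  rw [← one_div, le_div_iff₀ (minHeight_pos h k), mul_comm]
  exact h1

/-- By positivity of three consecutive matrices, every increment at stage `k` is at least the sum of
all increments at stage `k + 3`; by `sum_height` that sum is at least the inverse of the largest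
height there. -/
theorem TowerSeq.le_incr (hT : TowerSeq n a c S U W) (h : Params n p a c) (hF : InvCDF S F)
    (k : ℕ) (t : Fin n) : (maxHeight n a c (k + 3))⁻¹ ≤ incr F (U k) t := by
  have h0 := fun s => hF.incr_nonneg (hT.tower (k + 3)) s
  have hsum : 1 ≤ maxHeight n a c (k + 3) * ∑ s, incr F (U (k + 3)) s := by
    rw [← hT.sum_height hF (k + 3), Finset.mul_sum]
    exact Finset.sum_le_sum fun s _ =>
      mul_le_mul_of_nonneg_right (Nat.cast_le.2 (height_le_x h (k + 3) s)) (h0 s)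
  have hM : incr F (U k) t = ∑ s, ((Theta n (a k) (c k) * Theta n (a (k + 1)) (c (k + 1)) *
      Theta n (a (k + 2)) (c (k + 2))) t s : ℝ) * incr F (U (k + 3)) s := by
    rw [hT.incr_eq F hF k]
    simp only [hT.incr_eq F hF (k + 1), hT.incr_eq F hF (k + 2), Matrix.mul_apply]
    push_cast
    simp only [Finset.mul_sum, Finset.sum_mul]
    rw [Finset.sum_congr rfl fun s _ => Finset.sum_comm, Finset.sum_comm]
    apply Finset.sum_congr rfl
    intro r _
    rw [Finset.sum_comm]
    apply Finset.sum_congr rfl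
    intro s _
    apply Finset.sum_congr rfl
    intro q _
    ring
  have hle : ∑ s, incr F (U (k + 3)) s ≤ incr F (U k) t := by
    rw [hM]
    refine Finset.sum_le_sum fun s _ => le_mul_of_one_le_left (h0 s) ?_
    have := one_le_Theta_mul (a₂ := a (k + 1)) (a₃ := a (k + 2)) h.four_le
      (by have := h.p_le_a k; have := h.five_le; omega : 1 ≤ a k) (h.c_pos k) (h.c_pos (k + 1))
      (h.c_pos (k + 2)) t s
    exact_mod_cast this
  rw [← one_div, div_le_iff₀ (maxHeight_pos h _), mul_comm]
  exact hsum.trans (mul_le_mul_of_nonneg_left hle (maxHeight_pos h _).le)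

/-- If an interval is short in the sense of `G`, then it is short in the sense of `F`. -/
theorem TowerSeq.sub_le (hT : TowerSeq n a c S U W) (h : Params n p a c) (hF : InvCDF S F)
    (hG : InvCDF S G) (hF0 : ∀ x ≤ 0, F x = 0) (hF1 : ∀ x, 1 ≤ x → F x = 1) (k : ℕ) {x y : ℝ}
    (hxyG : G y - G x < (maxHeight n a c (k + 3))⁻¹) :
    F y - F x ≤ 2 * (minHeight n a c k)⁻¹ := by
  have hpos := inv_pos.2 (minHeight_pos h k)
  -- `F` is constant outside `[0,1]`, and truncation to `[0,1]` does not increase the `G`-length.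
  have ex : F x = F (max x 0) := by
    rcases le_total x 0 with hx | hx
    · rw [max_eq_right hx, hF0 x hx, hF.zero]
    · rw [max_eq_left hx]
  have ey : F y = F (min y 1) := by
    rcases le_total y 1 with hy | hy
    · rw [min_eq_left hy]
    · rw [min_eq_right hy, hF1 y hy, hF.one]
  rw [ex, ey]
  by_cases hlt : max x 0 < min y 1
  · refine (hT.tower k).sub_le_of_sub_lt hF hG (hT.incr_le h hF k) (le_max_right _ _) hlt
      (min_le_right _ _) fun t => ?_
    have h1 := hG.mono (min_le_left y 1)
    have h2 := hG.mono (le_max_left x 0)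
    linarith [hT.le_incr h hG k t]
  · linarith [hF.mono (not_lt.1 hlt)]

theorem exists_two_mul_inv_lt (h : Params n p a c) {ε : ℝ} (hε : 0 < ε) :
    ∃ k, 2 * (minHeight n a c k)⁻¹ < ε := by
  have h1 : Tendsto (fun k => 2 * (minHeight n a c k)⁻¹) atTop (𝓝 (2 * 0)) :=
    (tendsto_minHeight h).inv_tendsto_atTop.const_mul 2
  rw [mul_zero] at h1
  exact (h1.eventually_lt_const hε).exists

/-- The comparison `TowerSeq.sub_le` with Lebesgue length, that is, `G = id`. -/
theorem TowerSeq.continuous (hT : TowerSeq n a c S U W) (h : Params n p a c) (hF : InvCDF S F)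
    (hF0 : ∀ x ≤ 0, F x = 0) (hF1 : ∀ x, 1 ≤ x → F x = 1) : Continuous F := by
  rw [Metric.continuous_iff]
  intro x ε hε
  obtain ⟨k, hk⟩ := exists_two_mul_inv_lt h hε
  refine ⟨(maxHeight n a c (k + 3))⁻¹, inv_pos.2 (maxHeight_pos h _), fun y hy => ?_⟩
  rw [Real.dist_eq] at hy ⊢
  have key := fun x y => hT.sub_le h hF (InvCDF.id S) hF0 hF1 k (x := x) (y := y)
  simp only [id] at key
  have hy' := abs_lt.1 hy
  rcases le_total x y with hxy | hxy
  · rw [abs_of_nonneg (sub_nonneg.2 (hF.mono hxy))]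
    exact (key x y hy'.2).trans_lt hk
  · rw [abs_sub_comm, abs_of_nonneg (sub_nonneg.2 (hF.mono hxy))]
    exact (key y x (by linarith)).trans_lt hk

/-- The two functions agree at the left ends of all floors, and on a floor each of them varies by at
most the inverse of the least height. -/
theorem TowerSeq.eq_of_incr (hT : TowerSeq n a c S U W) (h : Params n p a c) (hF : InvCDF S F)
    (hG : InvCDF S G) (he : ∀ t, incr F S t = incr G S t) {x : ℝ} (h0 : 0 ≤ x) (h1 : x < 1) :
    F x = G x := by
  rw [← sub_eq_zero, ← abs_nonpos_iff]
  refine le_of_forall_pos_lt_add fun ε hε => ?_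
  obtain ⟨k, hk⟩ := exists_two_mul_inv_lt h hε
  obtain ⟨j, q, hq, hqx, hxq, hle⟩ := (hT.tower k).exists_floor hF h0 h1
  have hagree := (hT.agree F G hF hG he k).2 j q hq
  have hleG : G x - G q ≤ incr G (U k) j := by
    linarith [hG.floor (hT.tower k) j hq, hG.mono hxq.le]
  have b1 := hT.incr_le h hF k j
  have b2 := hT.incr_le h hG k j
  have := inv_pos.2 (minHeight_pos h k)
  rw [zero_add, abs_lt]
  constructor <;> linarith [hF.mono hqx, hG.mono hqx]

/-- At a late stage the floor through the midpoint is shorter than half of the interval, so it lies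
inside; every floor has positive increment. -/
theorem TowerSeq.strictMono (hT : TowerSeq n a c S U W) (h : Params n p a c) (hF : InvCDF S F)
    {x y : ℝ} (h0 : 0 ≤ x) (hxy : x < y) (h1 : y < 1) : F x < F y := by
  obtain ⟨k, hk⟩ := exists_two_mul_inv_lt h (sub_pos.2 hxy)
  obtain ⟨j, q, hq, hqz, hzq, -⟩ := (hT.tower k).exists_floor hF (x := (x + y) / 2)
    (by linarith) (by linarith)
  have hlen : (U k).len j ≤ (minHeight n a c k)⁻¹ := by
    have := hT.incr_le h (InvCDF.id S) k j
    simpa [incr] using this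
  have h2 := hF.floor (hT.tower k) j hq
  have h3 := hT.le_incr h hF k j
  have h4 := inv_pos.2 (maxHeight_pos h (k + 3))
  have h5 := hF.mono (show x ≤ q by linarith)
  have h6 := hF.mono (show q + (U k).len j ≤ y by linarith)
  linarith

theorem TowerSeq.length_eq (hT : TowerSeq n a c S U W) (k : ℕ) (j : Fin n) :
    (W k j).length = height n a c k j := by
  rw [height_eq_sum, ← hT.count k]
  simp only [countMatrix, Matrix.of_apply]
  have := Multiset.sum_count_eq_card (s := Finset.univ) (m := (W k j : Multiset (Fin n)))
    fun _ _ => Finset.mem_univ _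
  simpa using this.symm

theorem TowerSeq.existsUnique (hT : TowerSeq n a c S U W) (h : Params n p a c) {j : Fin n}
    (hj : j ∈ indexSet n) : ∃! μ : Measure ℝ, IsLimitMeasure n a c S j μ := by
  choose L hL using exists_tendsto_normalizedColumn h hj
  have hlen : ∀ k, ((W k j).length : ℝ) = ∑ s, (ThetaProd n a c k s j : ℝ) := by
    intro k
    rw [hT.length_eq, height_eq_sum]
    push_cast
    rfl
  obtain ⟨F, hF, hF0, hF1, hFL⟩ := exists_invCDF hT.isUnit hT.tower j (L := L)
    (tendsto_atTop_mono (fun k => by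
      rw [hT.length_eq]; exact Nat.cast_le.2 (u_le_height h k j)) (tendsto_minHeight h))
    (fun t => (hL t).congr fun k => by
      rw [normalizedColumn, hlen, ← hT.count k]; rfl)
  obtain ⟨μ, hμ, hμ1, hμT, hμF⟩ := hF.exists_measure hT.isUnit hF0 hF1 (hT.continuous h hF hF0 hF1)
  refine ⟨μ, ⟨hμ, hμ1, hμT, fun t => ?_⟩, fun ν hν => ?_⟩
  · have := hμF t
    rw [Measure.real] at this
    rw [this, hFL]
    exact hL t
  · have hν' := hν.isProbabilityMeasure
    have hcν := invCDF_cdfOf hT.isUnit hν.measure_Ico hν.invariant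
    have hcμ := invCDF_cdfOf hT.isUnit hμ1 hμT
    -- The increments of both distribution functions are the limits of the same normalized columns.
    have he : ∀ t, incr (cdfOf ν) S t = incr (cdfOf μ) S t := by
      intro t
      rw [incr_cdfOf hT.isUnit, incr_cdfOf hT.isUnit, hμF, hFL]
      exact tendsto_nhds_unique (hν.tendsto t) (hL t)
    have hall : ∀ x, cdfOf ν x = cdfOf μ x := by
      intro x
      rcases le_total x 0 with h0 | h0
      · rw [(cdfOf_of_Ico hν.measure_Ico).1 x h0, (cdfOf_of_Ico hμ1).1 x h0]
      rcases le_or_gt 1 x with h1 | h1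
      · rw [(cdfOf_of_Ico hν.measure_Ico).2 x h1, (cdfOf_of_Ico hμ1).2 x h1]
      · exact hT.eq_of_incr h hcν hcμ he h0 h1
    refine Measure.ext_of_Ico _ _ fun x y hxy => ?_
    rw [← measureReal_eq_measureReal_iff, ← cdfOf_sub ν hxy.le, ← cdfOf_sub μ hxy.le, hall, hall]

end Sequence

/-! ### The Hausdorff dimension -/

section Dimension

theorem edist_measureLine (ν : Measure ℝ) [IsProbabilityMeasure ν] (x y : MeasureLine ν) :
    edist x y = edist (cdfOf ν x.1) (cdfOf ν y.1) := by
  change ν (Set.Ico (min x.1 y.1) (max x.1 y.1)) = _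
  rw [← ofReal_measureReal, ← cdfOf_sub ν min_le_max, edist_dist, Real.dist_eq]
  congr 1
  have hmono : Monotone (cdfOf ν) := fun x y hxy => measureReal_mono (Set.Iio_subset_Iio hxy)
  rcases le_total x.1 y.1 with h | h
  · rw [max_eq_right h, min_eq_left h, abs_sub_comm, abs_of_nonneg (sub_nonneg.2 (hmono h))]
  · rw [max_eq_left h, min_eq_right h, abs_of_nonneg (sub_nonneg.2 (hmono h))]

/-- The distribution function maps `[0,1)` with the distance given by the measure isometrically
to the line. -/
theorem setDim_eq (ν : Measure ℝ) [IsProbabilityMeasure ν] {A : Set ℝ} (hA : A ⊆ Set.Ico 0 1) :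
    setDim ν A = dimH (cdfOf ν '' A) := by
  set g : MeasureLine ν → ℝ := fun x => cdfOf ν x.1 with hg
  have hins : ∀ x y : MeasureLine ν, Inseparable x y → g x = g y := by
    intro x y h
    rw [EMetric.inseparable_iff, edist_measureLine] at h
    exact edist_eq_zero.1 h
  have hiso : Isometry (SeparationQuotient.lift g hins) := by
    intro x y
    obtain ⟨x, rfl⟩ := SeparationQuotient.surjective_mk x
    obtain ⟨y, rfl⟩ := SeparationQuotient.surjective_mk y
    rw [SeparationQuotient.lift_mk, SeparationQuotient.lift_mk, SeparationQuotient.edist_mk,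
      edist_measureLine]
  rw [setDim, ← hiso.dimH_image, Set.image_image]
  congr 1
  ext z
  constructor
  · rintro ⟨x, hx, rfl⟩
    exact ⟨x.1, hx, rfl⟩
  · rintro ⟨x, hx, rfl⟩
    exact ⟨(⟨x, hA hx⟩ : Set.Ico (0 : ℝ) 1), hx, rfl⟩

theorem measureDim_le_one (μ ν : Measure ℝ) [IsProbabilityMeasure ν] : measureDim μ ν ≤ 1 := by
  have h0 : μ (Set.Ico (0 : ℝ) 1 \ Set.Ico 0 1) = 0 := by rw [Set.sdiff_self]; exact measure_empty
  have h1 : measureDim μ ν ≤ setDim ν (Set.Ico 0 1) :=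
    iInf_le_of_le (Set.Ico 0 1) (iInf_le_of_le subset_rfl
      (iInf_le_of_le measurableSet_Ico (iInf_le_of_le h0 le_rfl)))
  refine h1.trans ?_
  rw [setDim_eq ν subset_rfl, ← Real.dimH_univ]
  exact dimH_mono (Set.subset_univ _)

variable {n p : ℕ} {a c : ℕ → ℕ}

/-- The largest height grows by at most `6 a` per cycle. Seven cycles, with `a (i + k) ≤ c 0 * p ^
13 * p ^ (2 * i)` for `k ≤ 6`, lead from `x` at stage `i` to stage `i + 7`; the former is at most
`u` at stage `i + 3`. -/
theorem maxHeight_le (h : Params n p a c) (i : ℕ) :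
    maxHeight n a c (i + 7) ≤
      (6 * (c 0 : ℝ) * p ^ 13) ^ 7 * ((p : ℝ) ^ 14) ^ i * minHeight n a c (i + 3) := by
  have hstep : ∀ k, k ≤ 6 → (profile n a c (i + k + 1)).x ≤
      6 * c 0 * p ^ 13 * (p ^ 2) ^ i * (profile n a c (i + k)).x := by
    intro k hk
    refine (x_succ_le h (i + k)).trans (Nat.mul_le_mul_right _ ?_)
    rw [h.a_eq, h.c_eq]
    have : p ^ (2 * (i + k)) ≤ p ^ 12 * (p ^ 2) ^ i := by
      rw [← pow_mul, ← pow_add]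
      exact Nat.pow_le_pow_right (by have := h.five_le; omega) (by omega)
    calc 6 * (p * (p ^ (2 * (i + k)) * c 0)) ≤ 6 * (p * (p ^ 12 * (p ^ 2) ^ i * c 0)) := by gcongr
      _ = _ := by ring
  have hiter : ∀ k, k ≤ 7 → (profile n a c (i + k)).x ≤
      (6 * c 0 * p ^ 13 * (p ^ 2) ^ i) ^ k * (profile n a c i).x := by
    intro k
    induction k with
    | zero => simp
    | succ k ih =>
      intro hk
      refine (hstep k (by omega)).trans ?_
      have := ih (by omega)
      generalize 6 * c 0 * p ^ 13 * (p ^ 2) ^ i = q at this ⊢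
      exact (Nat.mul_le_mul_left q this).trans_eq (by ring)
  have h7 := (hiter 7 le_rfl).trans (Nat.mul_le_mul_left _ (x_le_u h i))
  have h7' : (maxHeight n a c (i + 7)) ≤
      (6 * (c 0 : ℝ) * p ^ 13 * ((p : ℝ) ^ 2) ^ i) ^ 7 * minHeight n a c (i + 3) := by
    rw [maxHeight, minHeight]
    exact_mod_cast h7
  refine h7'.trans (le_of_eq ?_)
  ring

/-- The heights of the towers grow so fast that neighbouring heights are comparable on the
logarithmic scale. -/
theorem eventually_rpow_maxHeight_le (h : Params n p a c) {d : ℝ} (hd0 : 0 ≤ d) (hd1 : d < 1) :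
    ∃ K, ∀ k, K ≤ k → 2 * maxHeight n a c (k + 4) ^ d ≤ minHeight n a c k := by
  have hp5 : (5 : ℝ) ≤ p := by exact_mod_cast h.five_le
  have hp1 : (1 : ℝ) ≤ p := by linarith
  set C : ℝ := (6 * (c 0 : ℝ) * p ^ 13) ^ 7 with hC
  have hC1 : 1 ≤ C := by
    have h1 : (1 : ℝ) ≤ c 0 := by exact_mod_cast h.c_pos 0
    have h2 : (1 : ℝ) ≤ (p : ℝ) ^ 13 := one_le_pow₀ hp1
    exact one_le_pow₀ (by nlinarith)
  obtain ⟨E, hE⟩ : ∃ E : ℕ, 2 * C < (p : ℝ) ^ E := pow_unbounded_of_one_lt _ (by linarith)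
  -- Chosen so that `E + 14 i ≤ i² (1 - d)` for `i ≥ I`, `i ≥ 1`: the quadratic exponent in the
  -- least height beats the linear one in the ratio of the heights.
  obtain ⟨I, hI⟩ := exists_nat_ge ((E + 14 : ℝ) / (1 - d))
  refine ⟨I + 1 + 3, fun k hk => ?_⟩
  obtain ⟨i, rfl⟩ : ∃ i, k = i + 3 := ⟨k - 3, by omega⟩
  have hi1 : 1 ≤ i := by omega
  have hiI : (I : ℝ) ≤ i := by exact_mod_cast (by omega : I ≤ i)
  set u := minHeight n a c (i + 3) with hu
  have hu0 : 0 < u := minHeight_pos h _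
  have hup : (p : ℝ) ^ (i * i) ≤ u := by
    refine le_trans ?_ (pow_le_minHeight h (i + 2))
    refine pow_le_pow_right₀ hp1 ?_
    exact Nat.mul_le_mul (by omega) (by omega)
  have hQ1 : 1 ≤ C * ((p : ℝ) ^ 14) ^ i :=
    one_le_mul_of_one_le_of_one_le hC1 (one_le_pow₀ (one_le_pow₀ hp1))
  have h1 : maxHeight n a c (i + 7) ^ d ≤ C * ((p : ℝ) ^ 14) ^ i * u ^ d := by
    calc maxHeight n a c (i + 7) ^ d ≤ (C * ((p : ℝ) ^ 14) ^ i * u) ^ d :=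
          Real.rpow_le_rpow (maxHeight_pos h _).le (maxHeight_le h i) hd0
      _ = (C * ((p : ℝ) ^ 14) ^ i) ^ d * u ^ d := Real.mul_rpow (by linarith) hu0.le
      _ ≤ C * ((p : ℝ) ^ 14) ^ i * u ^ d := by
        gcongr
        calc (C * ((p : ℝ) ^ 14) ^ i) ^ d ≤ (C * ((p : ℝ) ^ 14) ^ i) ^ (1 : ℝ) :=
              Real.rpow_le_rpow_of_exponent_le hQ1 hd1.le
          _ = _ := Real.rpow_one _
  have h2 : 2 * (C * ((p : ℝ) ^ 14) ^ i) ≤ u ^ (1 - d) := by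
    have e1 : 2 * (C * ((p : ℝ) ^ 14) ^ i) ≤ (p : ℝ) ^ ((E + 14 * i : ℕ) : ℝ) := by
      rw [Real.rpow_natCast, pow_add, pow_mul]
      rw [← mul_assoc]
      gcongr
    have e2 : (p : ℝ) ^ ((E + 14 * i : ℕ) : ℝ) ≤ ((p : ℝ) ^ (i * i)) ^ (1 - d) := by
      rw [← Real.rpow_natCast (p : ℝ) (i * i), ← Real.rpow_mul (by linarith)]
      refine Real.rpow_le_rpow_of_exponent_le hp1 ?_
      rw [div_le_iff₀ (by linarith)] at hI
      push_cast
      have hi1' : (1 : ℝ) ≤ i := by exact_mod_cast hi1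
      have hE0 : (0 : ℝ) ≤ E := Nat.cast_nonneg E
      have : (E + 14 : ℝ) ≤ i * (1 - d) :=
        hI.trans (mul_le_mul_of_nonneg_right hiI (by linarith))
      nlinarith
    exact e1.trans (e2.trans (Real.rpow_le_rpow (by positivity) hup (by linarith)))
  calc 2 * maxHeight n a c (i + 7) ^ d ≤ 2 * (C * ((p : ℝ) ^ 14) ^ i * u ^ d) := by gcongr
    _ = 2 * (C * ((p : ℝ) ^ 14) ^ i) * u ^ d := by ring
    _ ≤ u ^ (1 - d) * u ^ d := by gcongr
    _ = u := by rw [← Real.rpow_add hu0]; simp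

variable {S : IETData (Fin n)} {U : ℕ → IETData (Fin n)} {W : ℕ → Fin n → List (Fin n)}

/-- The preimage of a short interval under the distribution function of `ν` has small
`μ`-measure. -/
theorem TowerSeq.measure_preimage_le (hT : TowerSeq n a c S U W) (h : Params n p a c)
    {μ ν : Measure ℝ} [IsProbabilityMeasure μ] [IsProbabilityMeasure ν]
    (hμ1 : μ (Set.Ico 0 1) = 1) (hν1 : ν (Set.Ico 0 1) = 1)
    (hμ : MeasurePreserving S.toFun μ μ) (hν : MeasurePreserving S.toFun ν ν) (k : ℕ) {r s : ℝ}
    (hrs : s - r < (maxHeight n a c (k + 3))⁻¹) :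
    μ (cdfOf ν ⁻¹' Set.Icc r s) ≤ ENNReal.ofReal (2 * (minHeight n a c k)⁻¹) := by
  have hF := invCDF_cdfOf hT.isUnit hμ1 hμ
  have hG := invCDF_cdfOf hT.isUnit hν1 hν
  obtain ⟨hF0, hF1⟩ := cdfOf_of_Ico hμ1
  obtain ⟨hG0, hG1⟩ := cdfOf_of_Ico hν1
  have hGc := hT.continuous h hG hG0 hG1
  have hcompl : μ (Set.Ico (0 : ℝ) 1)ᶜ = 0 := by
    rw [prob_compl_eq_zero_iff measurableSet_Ico]; exact hμ1
  set B := cdfOf ν ⁻¹' Set.Icc r s ∩ Set.Ico (0 : ℝ) 1 with hB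
  have hμB : μ (cdfOf ν ⁻¹' Set.Icc r s) ≤ μ B := by
    refine (measure_mono (t := B ∪ (Set.Ico (0 : ℝ) 1)ᶜ) ?_).trans
      ((measure_union_le _ _).trans (by rw [hcompl, add_zero]))
    intro x hx
    by_cases h01 : x ∈ Set.Ico (0 : ℝ) 1
    · exact Or.inl ⟨hx, h01⟩
    · exact Or.inr h01
  refine hμB.trans ?_
  rcases B.eq_empty_or_nonempty with he | hne
  · rw [he]; simp
  have hbb : BddBelow B := ⟨0, fun x hx => hx.2.1⟩
  have hba : BddAbove B := ⟨1, fun x hx => hx.2.2.le⟩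
  -- By continuity the infimum and the supremum of `B` still have values in `[r, s]`.
  have hcl : closure B ⊆ cdfOf ν ⁻¹' Set.Icc r s :=
    closure_minimal Set.inter_subset_left (isClosed_Icc.preimage hGc)
  have hx0 := hcl (csInf_mem_closure hne hbb)
  have hy0 := hcl (csSup_mem_closure hne hba)
  set x₀ := sInf B
  set y₀ := sSup B
  have hlt : cdfOf ν y₀ - cdfOf ν x₀ < (maxHeight n a c (k + 3))⁻¹ := by
    have h1 := hx0.1
    have h2 := hy0.2
    linarith
  -- The supremum may belong to `B`; the strict inequality leaves room to move the right end a
  -- little, so that a half-open interval contains `B`.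
  obtain ⟨y₁, hy₁, hy₁lt⟩ : ∃ y₁, cdfOf ν y₁ - cdfOf ν x₀ < (maxHeight n a c (k + 3))⁻¹ ∧
      y₀ < y₁ := by
    have : ∀ᶠ y in 𝓝 y₀, cdfOf ν y - cdfOf ν x₀ < (maxHeight n a c (k + 3))⁻¹ :=
      (hGc.sub continuous_const).continuousAt.eventually_lt continuousAt_const hlt
    obtain ⟨y, hy⟩ := ((this.filter_mono nhdsWithin_le_nhds).and
      (self_mem_nhdsWithin : Set.Ioi y₀ ∈ 𝓝[>] y₀)).exists
    exact ⟨y, hy⟩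
  have hsub : B ⊆ Set.Ico x₀ y₁ := fun x hx =>
    ⟨csInf_le hbb hx, (le_csSup hba hx).trans_lt hy₁lt⟩
  have hle : x₀ ≤ y₁ := by
    obtain ⟨x, hx⟩ := hne
    exact (hsub hx).1.trans (hsub hx).2.le
  refine (measure_mono hsub).trans ?_
  rw [← ofReal_measureReal, ← cdfOf_sub μ hle]
  exact ENNReal.ofReal_le_ofReal (hT.sub_le h hF hG hF0 hF1 k hy₁)

/-- The mass distribution principle: for each `d < 1` the image of `μ` under the distribution
function of `ν` is dominated by the `d`-dimensional Hausdorff measure on the line, so the image of a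
set of full `μ`-measure cannot be null for the latter. -/
theorem TowerSeq.one_le_measureDim (hT : TowerSeq n a c S U W) (h : Params n p a c)
    {μ ν : Measure ℝ} [IsProbabilityMeasure μ] [IsProbabilityMeasure ν]
    (hμ1 : μ (Set.Ico 0 1) = 1) (hν1 : ν (Set.Ico 0 1) = 1)
    (hμ : MeasurePreserving S.toFun μ μ) (hν : MeasurePreserving S.toFun ν ν) :
    1 ≤ measureDim μ ν := by
  have hG := invCDF_cdfOf hT.isUnit hν1 hν
  refine le_iInf₂ fun A hA => le_iInf₂ fun hAm hA0 => ?_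
  rw [setDim_eq ν hA]
  refine le_of_forall_lt fun d' hd' => ?_
  obtain ⟨d, hd1, hd2⟩ := ENNReal.lt_iff_exists_nnreal_btwn.1 hd'
  refine hd1.trans_le (le_dimH_of_hausdorffMeasure_ne_zero ?_)
  have hdlt : (d : ℝ) < 1 := by exact_mod_cast hd2
  have hdpos : 0 < (d : ℝ) := by
    have : (0 : ℝ≥0∞) < d := zero_le.trans_lt hd1
    exact_mod_cast this
  obtain ⟨K, hK⟩ := eventually_rpow_maxHeight_le h hdpos.le hdlt
  have hGmeas : Measurable (cdfOf ν) := hG.mono.measurable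
  set m : Measure ℝ := μ.map (cdfOf ν) with hm
  have hinv : ∀ k, 0 < (maxHeight n a c k)⁻¹ := fun k => inv_pos.2 (maxHeight_pos h k)
  have hle : m ≤ μH[(d : ℝ)] := by
    refine Measure.le_hausdorffMeasure d m
      -- The half makes the bound on the diameter strict at the starting stage `K`.
      (ENNReal.ofReal ((maxHeight n a c (K + 3))⁻¹ / 2)) (by
        rw [ENNReal.ofReal_pos]; exact half_pos (hinv _)) fun s hs => ?_
    have hbdd : Bornology.IsBounded s := by
      rw [Metric.isBounded_iff_ediam_ne_top]
      exact (hs.trans_lt ENNReal.ofReal_lt_top).ne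
    rw [Real.ediam_eq hbdd] at hs ⊢
    rcases s.eq_empty_or_nonempty with he | hne
    · rw [he]; simp
    have hsT : s ⊆ Set.Icc (sInf s) (sSup s) := fun x hx =>
      ⟨csInf_le hbdd.bddBelow hx, le_csSup hbdd.bddAbove hx⟩
    have hr0 : 0 ≤ sSup s - sInf s := by
      rw [sub_nonneg]; exact csInf_le_csSup hne hbdd.bddBelow hbdd.bddAbove
    set r := sSup s - sInf s with hr
    have hms : ∀ k, r < (maxHeight n a c (k + 3))⁻¹ →
        m s ≤ ENNReal.ofReal (2 * (minHeight n a c k)⁻¹) := by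
      intro k hk
      refine (measure_mono hsT).trans ?_
      rw [hm, Measure.map_apply hGmeas measurableSet_Icc]
      exact hT.measure_preimage_le h hμ1 hν1 hμ hν k hk
    have hrK : r < (maxHeight n a c (K + 3))⁻¹ := by
      have := (ENNReal.ofReal_le_ofReal_iff (half_pos (hinv _)).le).1 hs
      linarith [half_lt_self (hinv (K + 3))]
    have hex : ∀ k, r < (maxHeight n a c (k + 3))⁻¹ → (maxHeight n a c (k + 4))⁻¹ ≤ r → K ≤ k →
        m s ≤ ENNReal.ofReal r ^ (d : ℝ) := by
      intro k hk1 hk2 hKk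
      refine (hms k hk1).trans ?_
      rw [ENNReal.ofReal_rpow_of_nonneg hr0 hdpos.le]
      refine ENNReal.ofReal_le_ofReal ?_
      have h1 := hK k hKk
      have h2 := maxHeight_pos h (k + 4)
      have h3 := minHeight_pos h k
      have h4 : ((maxHeight n a c (k + 4)) ^ (d : ℝ))⁻¹ ≤ r ^ (d : ℝ) := by
        rw [← Real.inv_rpow h2.le]
        exact Real.rpow_le_rpow (inv_pos.2 h2).le hk2 hdpos.le
      refine le_trans ?_ h4
      have h5 : 0 < maxHeight n a c (k + 4) ^ (d : ℝ) := Real.rpow_pos_of_pos h2 _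
      rw [← div_eq_mul_inv, div_le_iff₀ h3, inv_mul_eq_div, le_div_iff₀ h5]
      exact h1
    -- The first stage `k ≥ K` whose threshold `(maxHeight n a c (k + 4))⁻¹` is at most `r`; by
    -- minimality, or by the choice of the mesh if `k = K`, `r` is below the preceding threshold.
    by_cases hfind : ∃ k, K ≤ k ∧ (maxHeight n a c (k + 4))⁻¹ ≤ r
    · classical
      obtain ⟨hk1, hk2⟩ := Nat.find_spec hfind
      refine hex (Nat.find hfind) ?_ hk2 hk1
      rcases hk1.eq_or_lt with he | hlt
      · rw [← he]; exact hrK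
      · have := Nat.find_min hfind (m := Nat.find hfind - 1) (by omega)
        rw [not_and, not_le] at this
        have h1 := this (by omega)
        rwa [show Nat.find hfind - 1 + 4 = Nat.find hfind + 3 by omega] at h1
    · push Not at hfind
      -- Now `r` is below all thresholds, and the bounds on the mass tend to zero.
      have hz : m s ≤ 0 := by
        have ht : Tendsto (fun k => ENNReal.ofReal (2 * (minHeight n a c k)⁻¹)) atTop (𝓝 0) := by
          have h1 : Tendsto (fun k => 2 * (minHeight n a c k)⁻¹) atTop (𝓝 (2 * 0)) :=
            (tendsto_minHeight h).inv_tendsto_atTop.const_mul 2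
          rw [mul_zero] at h1
          simpa using ENNReal.tendsto_ofReal h1
        refine ge_of_tendsto ht ((eventually_ge_atTop (K + 1)).mono fun k hk => hms k ?_)
        have := hfind (k - 1) (by omega)
        rwa [show k - 1 + 4 = k + 3 by omega] at this
      exact hz.trans zero_le
  have hAm1 : μ A = 1 := by
    have := measure_sdiff_add_inter (μ := μ) (Set.Ico (0 : ℝ) 1) hAm
    rw [hA0, zero_add, Set.inter_eq_right.2 hA, hμ1] at this
    exact this
  have h1 : (1 : ℝ≥0∞) ≤ μH[(d : ℝ)] (cdfOf ν '' A) := by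
    rw [← hAm1]
    -- The image of `A` need not be known to be measurable; the inequality for image measures that
    -- holds for all sets is enough.
    calc μ A ≤ μ (cdfOf ν ⁻¹' (cdfOf ν '' A)) := measure_mono (Set.subset_preimage_image _ _)
      _ ≤ m (cdfOf ν '' A) := Measure.le_map_apply hGmeas.aemeasurable _
      _ ≤ _ := hle _
  exact (zero_lt_one.trans_le h1).ne'

end Dimension

end RauzyIET

theorem corollary3 (n p : ℕ) (hn : 4 ≤ n) (hp : n + 1 ≤ p) (a c : ℕ → ℕ) (hc : 0 < c 0)
    (hac : ∀ i, c (i + 1) = p * a i ∧ p * a i = p ^ 2 * c i)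
    (α : Fin n → ℝ) (hα : ∀ t, 0 < α t) (hα1 : ∑ t, α t = 1)
    (hgen : RauzyIET.IsGeneratedBy n a c ⟨RauzyIET.initialRows n, α⟩) :
    (∀ j ∈ RauzyIET.indexSet n,
      ∃! μ : Measure ℝ, RauzyIET.IsLimitMeasure n a c ⟨RauzyIET.initialRows n, α⟩ j μ) ∧
    ∀ i ∈ RauzyIET.indexSet n, ∀ j ∈ RauzyIET.indexSet n, i ≠ j →
      ∀ μ ν : Measure ℝ,
        RauzyIET.IsLimitMeasure n a c ⟨RauzyIET.initialRows n, α⟩ i μ →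
        RauzyIET.IsLimitMeasure n a c ⟨RauzyIET.initialRows n, α⟩ j ν →
        (∀ x y : ℝ, 0 ≤ x → x < y → y < 1 → 0 < ν (Set.Ico x y)) ∧
        RauzyIET.measureDim μ ν = 1 := by
  have h : RauzyIET.Params n p a c := ⟨hn, hp, hc, hac⟩
  obtain ⟨U, W, hT⟩ := RauzyIET.exists_towerSeq hn hα hα1 hgen
  refine ⟨fun j hj => hT.existsUnique h hj, fun i _ j _ _ μ ν hμ hν => ?_⟩
  have hμp := hμ.isProbabilityMeasure
  have hνp := hν.isProbabilityMeasure
  -- Positive measure of nondegenerate intervals is what makes the pseudometric `d_ν` a metric.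
  refine ⟨fun x y h0 hxy h1 => ?_, le_antisymm (RauzyIET.measureDim_le_one μ ν)
    (hT.one_le_measureDim h hμ.measure_Ico hν.measure_Ico hμ.invariant hν.invariant)⟩
  have := hT.strictMono h
    (RauzyIET.invCDF_cdfOf hT.isUnit hν.measure_Ico hν.invariant) h0 hxy h1
  rw [← sub_pos, RauzyIET.cdfOf_sub ν hxy.le, measureReal_def, ENNReal.toReal_pos_iff] at this
  exact this.1
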